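/- Theorem 11. A $3$-sided die in the balanced uniform model is a random point $(a_1,a_2,a_3)$ of $[0,1]^3$ chosen uniformly and conditioned on $a_1+a_2+a_3=3/2$ (that is, its law is the normalized area on the plane section $\{a\in[0,1]^3 : a_1+a_2+a_3=3/2\}$). A die $A$ dominates a die $B$, written $A\succ B$, if $\sum_{i,j}\operatorname{sgn}(a_i-b_j)>0$. Take four independent $3$-sided dice in the balanced uniform model, and consider the directed graph on the four dice with an edge from $A$ to $B$ exactly when $A\succ B$. The probabilities that this graph is a tournament in each of the four isomorphism classes of tournaments on four vertices are the following: \begin{align*} P(\text{transitive chain}) &= \frac{110413771}{258048000},\\ P(\text{intransitive 4-cycle}) &= \frac{99930571}{258048000},\\ P(\text{winner}+\text{3-cycle}) &= \frac{23851829}{258048000},\\ P(\text{loser}+\text{3-cycle}) &= \frac{23851829}{258048000}. \end{align*} Here the transitive chain is the class of the tournament given by a linear order; the intransitive 4-cycle is the class of the tournaments that contain a directed cycle $A\succ B\succ C\succ D\succ A$ through all four vertices; winner + 3-cycle (respectively loser + 3-cycle) is the class of the tournaments in which one vertex beats (respectively loses to) each of the other three, and those three form a directed 3-cycle. -/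

import Mathlib

open MeasureTheory ProbabilityTheory

/-- An `n`-sided die is the vector of its face values, regarded as a point of `n`-dimensional
Euclidean space. -/
abbrev Die (n : ℕ) : Type := EuclideanSpace ℝ (Fin n)

/-- `A` dominates `B` if `∑ i, j, sgn (a_i - b_j) > 0`: when both dice are rolled, `A` is more likely
to show the higher value than `B`. -/
def Dominates {n m : ℕ} (A : Die n) (B : Die m) : Prop :=
  0 < ∑ i, ∑ j, (SignType.sign (A i - B j) : ℤ)

/-- The balanced dice with face values in `[0, 1]`: the slice of the unit cube `[0, 1] ^ n` by the
hyperplane on which the sum of the coordinates is `n / 2`. -/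
def balancedDice (n : ℕ) : Set (Die n) :=
  {a | (∀ i, a i ∈ Set.Icc (0 : ℝ) 1) ∧ ∑ i, a i = (n : ℝ) / 2}

/-- The balanced uniform model: a point chosen uniformly from `[0, 1] ^ n`, conditioned on the sum of
its coordinates being `n / 2`, that is, the normalized `(n - 1)`-dimensional volume on the slice
`balancedDice n`. -/
noncomputable def balancedUniform (n : ℕ) : Measure (Die n) :=
  ProbabilityTheory.cond μHE[n - 1] (balancedDice n)

/-- The directed graph of the dominance relation on a family of dice, with an edge from `i` to `j`
when die `i` dominates die `j`. If there are no ties, it is a tournament. -/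
def dominanceGraph {k n : ℕ} (A : Fin k → Die n) : Digraph (Fin k) where
  Adj i j := Dominates (A i) (A j)

/-- Two directed graphs are isomorphic if some bijection of the vertices preserves and reflects the
edges. -/
def Digraph.Isomorphic {V W : Type*} (G : Digraph V) (H : Digraph W) : Prop :=
  ∃ e : V ≃ W, ∀ u v : V, G.Adj u v ↔ H.Adj (e u) (e v)

/-- The transitive chain on four vertices: `i → j` exactly when `i < j`. -/
def transitiveChain : Digraph (Fin 4) where
  Adj i j := i < j

/-- The intransitive 4-cycle: the tournament `0 → 1 → 2 → 3 → 0` with the diagonals `0 → 2` and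
`1 → 3`. (Any other choice of directions for the two diagonals gives an isomorphic tournament.) -/
def intransitiveFourCycle : Digraph (Fin 4) where
  Adj i j := (i, j) ∈ ({(0, 1), (1, 2), (2, 3), (3, 0), (0, 2), (1, 3)} : Set (Fin 4 × Fin 4))

/-- Winner plus 3-cycle: vertex `0` beats the others, and `1 → 2 → 3 → 1`. -/
def winnerThreeCycle : Digraph (Fin 4) where
  Adj i j := (i, j) ∈ ({(0, 1), (0, 2), (0, 3), (1, 2), (2, 3), (3, 1)} : Set (Fin 4 × Fin 4))

/-- Loser plus 3-cycle: vertex `0` loses to the others, and `1 → 2 → 3 → 1`. -/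
def loserThreeCycle : Digraph (Fin 4) where
  Adj i j := (i, j) ∈ ({(1, 0), (2, 0), (3, 0), (1, 2), (2, 3), (3, 1)} : Set (Fin 4 × Fin 4))

open scoped ENNReal

/-! The smallest and largest faces of a balanced die determine its median. With smallest face `(1 -
P) / 2` and largest face `(1 + Q) / 2`, the sorting and range conditions become `P < 2 * Q`, `Q < 2
* P`, `P < 1`, `Q < 1` up to null sets, so `(P, Q)` is uniform on a kite of area `1 / 2`
(`map_extremes_balancedUniform`). Without ties, a die dominates another one exactly when at least
two of its three sorted faces are larger (`dominates_iff_beats`).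

Among the four classes of tournaments, only the transitive chain has two vertices that both beat the
other two, and it has exactly one such pair. A vertex that beats all others exists, and is then
unique, in the chain and in the winner class only; dually for a vertex that loses to all others. Let
`d` be the probability of dominating a random die, and `m` the probability that two given dice both
dominate a random one. By conditional independence P(chain) = 6 E[m²] and P(chain) + P(winner) = 4
E[d³], likewise for the loser class, and the four probabilities add up to 1. The reflection x ↦ 1 -
x of the faces exchanges P and Q and turns d into 1 - d, so E[d] = 1/2 and E[d³] = (3/2) E[d²] -
1/4. Two integrals remain: `integral_commonDominance_sq` and `integral_dominance_sq`.

Since Q = P + (Q - P), the indicator of dominance is almost everywhere a linear combination of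
indicators of half-planes (`indicator_beats_eq`). So `d` and `m` are combinations of joint
distribution functions on the kite, which are signed sums of squares of linear forms, each cut off
to a polyhedral region. The integral of a product of two such squares is turned by homogeneity into
an integral over a cone in ℝ⁵ with an exponential weight (`conesLIntegral_startCone`). The cone is
cut into simplicial cones (`conesLIntegral_cutCone`), and over each of them the integral is a
coefficient of a rational generating function (`coneLIntegral_eq_homogeneousCoeff`). This is exact
integer arithmetic, which the kernel evaluates; `integral_eval_sq` identifies its outcome with the
integral. -/

/-! ### Lebesgue integrals over translated simplicial cones. -/

theorem setLIntegral_Ioi_comp_mul (f : ℝ → ℝ≥0∞) {c : ℝ} (hc : 0 < c) :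
    ∫⁻ t in Set.Ioi 0, f t = ENNReal.ofReal c * ∫⁻ t in Set.Ioi 0, f (c * t) := by
  rw [← lintegral_indicator measurableSet_Ioi, ← lintegral_indicator measurableSet_Ioi]
  conv_lhs => rw [← Real.smul_map_volume_mul_left hc.ne']
  rw [lintegral_smul_measure, abs_of_pos hc, smul_eq_mul]
  congr 1
  have := lintegral_map_equiv (μ := volume) ((Set.Ioi (0:ℝ)).indicator f)
    (Homeomorph.mulLeft₀ c hc.ne').toMeasurableEquiv
  have h2 : (⇑(Homeomorph.mulLeft₀ c hc.ne').toMeasurableEquiv) = (fun x => c * x) := by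
    ext; simp
  rw [h2] at this
  rw [this]
  congr 1
  ext t
  simp [Set.indicator, hc]

theorem setLIntegral_Ioi_add (f : ℝ → ℝ≥0∞) (r : ℝ) :
    ∫⁻ t in Set.Ioi r, f t = ∫⁻ t in Set.Ioi 0, f (t + r) := by
  rw [← lintegral_indicator measurableSet_Ioi, ← lintegral_indicator measurableSet_Ioi,
    ← lintegral_add_right_eq_self _ r]
  congr 1
  ext t
  simp [Set.indicator]

/-- The ray through `(a, b)` cuts the quadrant in two. The part below it is parametrized by `(s + r
* a, r * b)`, with Jacobian `b`, and the part above it by `(r * a, t + r * b)`, with Jacobian `a`.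
-/
theorem setLIntegral_quadrant_split {F : ℝ → ℝ → ℝ≥0∞} (hF : Measurable (Function.uncurry F))
    {a b : ℝ} (ha : 0 < a) (hb : 0 < b) :
    ∫⁻ s in Set.Ioi 0, ∫⁻ t in Set.Ioi 0, F s t =
      ENNReal.ofReal b * (∫⁻ s in Set.Ioi 0, ∫⁻ r in Set.Ioi 0, F (s + r * a) (r * b)) +
      ENNReal.ofReal a * ∫⁻ r in Set.Ioi 0, ∫⁻ t in Set.Ioi 0, F (r * a) (t + r * b) := by
  have h1 : ∀ s ∈ Set.Ioi (0:ℝ), ∫⁻ t in Set.Ioi 0, F s t =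
      (∫⁻ t in Set.Ioc 0 (s / a * b), F s t) + ∫⁻ t in Set.Ioi 0, F s (t + s / a * b) := by
    intro s hs
    have hs' : 0 ≤ s / a * b := by have : (0:ℝ) < s := hs; positivity
    rw [← setLIntegral_Ioi_add, ← Set.Ioc_union_Ioi_eq_Ioi hs',
      lintegral_union measurableSet_Ioi]
    rw [Set.disjoint_left]
    intro x hx hx'
    exact absurd hx.2 (not_le.2 hx')
  rw [setLIntegral_congr_fun measurableSet_Ioi h1, lintegral_add_right]
  swap
  · have hm : Measurable (Function.uncurry fun s t : ℝ => F s (t + s / a * b)) :=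
      hF.comp (by fun_prop : Measurable fun z : ℝ × ℝ => (z.1, z.2 + z.1 / a * b))
    exact Measurable.lintegral_prod_right hm
  congr 1
  -- Below the ray the shear translates the first coordinate, so the order of integration has to be
  -- exchanged before substituting.
  · have h2 : ∀ s ∈ Set.Ioi (0:ℝ), ∫⁻ t in Set.Ioc 0 (s / a * b), F s t =
        ∫⁻ t in Set.Ioi 0, (Set.Ici (t / b * a)).indicator (fun s => F s t) s := by
      intro s hs
      rw [← lintegral_indicator measurableSet_Ioc, ← lintegral_indicator measurableSet_Ioi]
      congr 1
      ext t
      have : t ≤ s / a * b ↔ t / b * a ≤ s := by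
        rw [div_mul_eq_mul_div, div_mul_eq_mul_div, le_div_iff₀ ha, div_le_iff₀ hb]
      by_cases ht : 0 < t <;> by_cases hst : t / b * a ≤ s <;>
        simp [Set.indicator, ht, hst, this]
    have hm : Measurable (Function.uncurry fun s t : ℝ =>
        (Set.Ici (t / b * a)).indicator (fun s => F s t) s) := by
      have : (Function.uncurry fun s t : ℝ =>
        (Set.Ici (t / b * a)).indicator (fun s => F s t) s) =
        {z : ℝ × ℝ | z.2 / b * a ≤ z.1}.indicator (Function.uncurry F) := by
        ext ⟨s, t⟩
        simp [Set.indicator]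
      rw [this]
      exact hF.indicator (measurableSet_le (by fun_prop) (by fun_prop))
    rw [setLIntegral_congr_fun measurableSet_Ioi h2, lintegral_lintegral_swap hm.aemeasurable]
    have h3 : ∀ t ∈ Set.Ioi (0:ℝ), ∫⁻ s in Set.Ioi 0,
        (Set.Ici (t / b * a)).indicator (fun s => F s t) s =
        ∫⁻ s in Set.Ioi 0, F (s + t / b * a) t := by
      intro t ht
      have ht' : 0 < t / b * a := by have : (0:ℝ) < t := ht; positivity
      rw [← setLIntegral_Ioi_add (fun s => F s t) (t / b * a),
        setLIntegral_indicator measurableSet_Ici]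
      have hI : Set.Ici (t / b * a) ∩ Set.Ioi 0 = Set.Ici (t / b * a) :=
        Set.inter_eq_left.2 fun x hx => lt_of_lt_of_le ht' hx
      rw [hI]
      exact setLIntegral_congr Ioi_ae_eq_Ici.symm
    rw [setLIntegral_congr_fun measurableSet_Ioi h3, setLIntegral_Ioi_comp_mul _ hb,
      lintegral_lintegral_swap (f := fun s r => F (s + r * a) (r * b))]
    · congr 1
      refine lintegral_congr fun r => lintegral_congr fun s => ?_
      rw [mul_div_cancel_left₀ _ hb.ne', mul_comm b r]
    · exact (hF.comp (by fun_prop :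
        Measurable fun z : ℝ × ℝ => (z.1 + z.2 * a, z.2 * b))).aemeasurable
  · rw [setLIntegral_Ioi_comp_mul _ ha]
    congr 1
    refine lintegral_congr fun r => lintegral_congr fun s => ?_
    rw [mul_div_cancel_left₀ _ ha.ne', mul_comm a r]

section coneIntegral

variable {E : Type*} [AddCommGroup E] [Module ℝ E]

/-- The integral of `φ` over the translate by `x` of the open cone generated by the vectors of a
list, with respect to the Lebesgue measure in the coordinates given by the generators. -/
noncomputable def coneLIntegral (φ : E → ℝ≥0∞) : List E → E → ℝ≥0∞
  | [], x => φ x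
  | v :: V, x => ∫⁻ t in Set.Ioi (0 : ℝ), coneLIntegral φ V (x + t • v)

theorem coneLIntegral_cons (φ : E → ℝ≥0∞) (v : E) (V : List E) (x : E) :
    coneLIntegral φ (v :: V) x = ∫⁻ t in Set.Ioi (0 : ℝ), coneLIntegral φ V (x + t • v) := rfl

/-- A function supported on the half-space where a linear form is positive integrates to zero over
a cone on which the form is nonpositive. -/
theorem coneLIntegral_eq_zero {φ : E → ℝ≥0∞} {f : E →ₗ[ℝ] ℝ} (hφ : ∀ y, f y ≤ 0 → φ y = 0)
    {V : List E} (hV : ∀ v ∈ V, f v ≤ 0) {x : E} (hx : f x ≤ 0) : coneLIntegral φ V x = 0 := by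
  induction V generalizing x with
  | nil => exact hφ x hx
  | cons v V ih =>
    rw [coneLIntegral_cons]
    refine (setLIntegral_congr_fun measurableSet_Ioi fun t ht => ?_).trans lintegral_zero
    refine ih (fun w hw => hV w (by simp [hw])) ?_
    have := hV v (by simp)
    have ht' : (0:ℝ) < t := ht
    simp only [map_add, map_smul, smul_eq_mul]
    nlinarith

/-- Two functions that agree where a linear form is positive have the same integral over a cone on
which the form is nonnegative, and not identically zero. -/
theorem coneLIntegral_congr_of_pos {φ ψ : E → ℝ≥0∞} {f : E →ₗ[ℝ] ℝ} (h : ∀ y, 0 < f y → φ y = ψ y)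
    {V : List E} (hV : ∀ v ∈ V, 0 ≤ f v) {x : E} (hx : 0 ≤ f x)
    (hpos : 0 < f x ∨ ∃ v ∈ V, 0 < f v) : coneLIntegral φ V x = coneLIntegral ψ V x := by
  induction V generalizing x with
  | nil =>
    rcases hpos with hpos | ⟨v, hv, -⟩
    · exact h x hpos
    · simp at hv
  | cons v V ih =>
    rw [coneLIntegral_cons, coneLIntegral_cons]
    refine setLIntegral_congr_fun measurableSet_Ioi fun t ht => ?_
    have ht' : (0:ℝ) < t := ht
    have hv := hV v (by simp)
    have hm : f (x + t • v) = f x + t * f v := by simp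
    refine ih (fun w hw => hV w (by simp [hw])) (by rw [hm]; positivity) ?_
    rcases hpos with hpos | ⟨w, hw, hpos⟩
    · left; rw [hm]; positivity
    · rcases List.mem_cons.1 hw with rfl | hw
      · left; rw [hm]; positivity
      · exact Or.inr ⟨w, hw, hpos⟩

theorem coneLIntegral_smul_cons (φ : E → ℝ≥0∞) {c : ℝ} (hc : 0 < c) (v : E) (V : List E) (x : E) :
    coneLIntegral φ (v :: V) x = ENNReal.ofReal c * coneLIntegral φ ((c • v) :: V) x := by
  rw [coneLIntegral_cons, coneLIntegral_cons, setLIntegral_Ioi_comp_mul _ hc]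
  simp only [smul_smul, mul_comm]

variable [MeasurableSpace E] [MeasurableAdd₂ E] [MeasurableSMul₂ ℝ E]

theorem measurable_coneLIntegral {φ : E → ℝ≥0∞} (hφ : Measurable φ) (V : List E) :
    Measurable (coneLIntegral φ V) := by
  induction V with
  | nil => exact hφ
  | cons v V ih =>
    have : Measurable (Function.uncurry fun (x : E) (t : ℝ) => coneLIntegral φ V (x + t • v)) :=
      ih.comp (by fun_prop : Measurable fun z : E × ℝ => z.1 + z.2 • v)
    exact Measurable.lintegral_prod_right this

/-- A transposition of neighbouring generators is Tonelli's theorem. -/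
theorem coneLIntegral_perm {φ : E → ℝ≥0∞} (hφ : Measurable φ) {V W : List E} (h : V.Perm W) :
    coneLIntegral φ V = coneLIntegral φ W := by
  induction h with
  | nil => rfl
  | cons v _ ih => funext x; simp only [coneLIntegral_cons, ih]
  | swap v w V =>
    funext x
    simp only [coneLIntegral_cons]
    rw [lintegral_lintegral_swap]
    · simp only [add_right_comm]
    · exact ((measurable_coneLIntegral hφ V).comp
        (by fun_prop : Measurable fun z : ℝ × ℝ => x + z.1 • w + z.2 • v)).aemeasurable
  | trans _ _ ih₁ ih₂ => exact ih₁.trans ih₂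

/-- A cone is cut in two by a hyperplane through a point in the interior of the face spanned by two
of its generators, and through all the other generators. -/
theorem coneLIntegral_split {φ : E → ℝ≥0∞} (hφ : Measurable φ) {a b c : ℝ} (ha : 0 < a)
    (hb : 0 < b) (hc : 0 < c) {p q w : E} (hw : c • w = a • p + b • q) (V : List E) (x : E) :
    ENNReal.ofReal c * coneLIntegral φ (p :: q :: V) x =
      ENNReal.ofReal b * coneLIntegral φ (p :: w :: V) x +
      ENNReal.ofReal a * coneLIntegral φ (w :: q :: V) x := by
  have hV := measurable_coneLIntegral hφ V
  -- Replacing `w` by `c • w = a • p + b • q` reduces to the cut of a quadrant by the ray through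
  -- `(a, b)`.
  have h1 : coneLIntegral φ (p :: w :: V) x =
      ENNReal.ofReal c * coneLIntegral φ (p :: (c • w) :: V) x := by
    rw [coneLIntegral_perm hφ (List.Perm.swap w p V), coneLIntegral_smul_cons φ hc,
      coneLIntegral_perm hφ (List.Perm.swap p (c • w) V)]
  rw [h1, coneLIntegral_smul_cons φ hc w (q :: V), mul_left_comm _ (ENNReal.ofReal c),
    mul_left_comm _ (ENNReal.ofReal c), ← mul_add]
  congr 1
  simp only [coneLIntegral_cons, hw]
  rw [setLIntegral_quadrant_split (F := fun s t => coneLIntegral φ V (x + s • p + t • q)) _ ha hb]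
  · congr 2
    · refine lintegral_congr fun s => lintegral_congr fun r => ?_
      congr 1
      module
    · refine lintegral_congr fun s => lintegral_congr fun r => ?_
      congr 1
      module
  · exact hV.comp (by fun_prop : Measurable fun z : ℝ × ℝ => x + z.1 • p + z.2 • q)

end coneIntegral

/-! ### Integer arithmetic with weighted cones, written with recursors and `Nat` primitives for
evaluation in the kernel. -/

/-- A point of `ℝ⁵` with natural coordinates. -/
structure NatPoint where
  x₀ : ℕ
  x₁ : ℕ
  x₂ : ℕ
  x₃ : ℕ
  x₄ : ℕ

namespace NatPoint

/-- The value of a linear form with natural coefficients. -/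
def dot (f v : NatPoint) : ℕ :=
  Nat.add (Nat.mul f.x₀ v.x₀) (Nat.add (Nat.mul f.x₁ v.x₁) (Nat.add (Nat.mul f.x₂ v.x₂)
    (Nat.add (Nat.mul f.x₃ v.x₃) (Nat.mul f.x₄ v.x₄))))

/-- The combination `(a * p + b * q) / c`, rounded down. -/
def combine (a b c : ℕ) (p q : NatPoint) : NatPoint where
  x₀ := Nat.div (Nat.add (Nat.mul a p.x₀) (Nat.mul b q.x₀)) c
  x₁ := Nat.div (Nat.add (Nat.mul a p.x₁) (Nat.mul b q.x₁)) c
  x₂ := Nat.div (Nat.add (Nat.mul a p.x₂) (Nat.mul b q.x₂)) c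
  x₃ := Nat.div (Nat.add (Nat.mul a p.x₃) (Nat.mul b q.x₃)) c
  x₄ := Nat.div (Nat.add (Nat.mul a p.x₄) (Nat.mul b q.x₄)) c

/-- Whether `c * w = a * p + b * q`. -/
def isCombination (a b c : ℕ) (p q w : NatPoint) : Bool :=
  and (Nat.beq (Nat.mul c w.x₀) (Nat.add (Nat.mul a p.x₀) (Nat.mul b q.x₀)))
  (and (Nat.beq (Nat.mul c w.x₁) (Nat.add (Nat.mul a p.x₁) (Nat.mul b q.x₁)))
  (and (Nat.beq (Nat.mul c w.x₂) (Nat.add (Nat.mul a p.x₂) (Nat.mul b q.x₂)))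
  (and (Nat.beq (Nat.mul c w.x₃) (Nat.add (Nat.mul a p.x₃) (Nat.mul b q.x₃)))
  (Nat.beq (Nat.mul c w.x₄) (Nat.add (Nat.mul a p.x₄) (Nat.mul b q.x₄))))))

end NatPoint

/-- A linear form on `ℝ⁵` with integer coefficients, as a difference of two forms with natural
coefficients. -/
structure FormPair where
  pos : NatPoint
  neg : NatPoint

/-- A simplicial cone, given by its generators, with a weight. -/
structure WeightedCone where
  weight : ℕ
  gens : List NatPoint

namespace FormPair

/-- The generators of a cone on which a form is positive, with the values of the form. -/
noncomputable def positives (f : FormPair) (V : List NatPoint) : List (NatPoint × ℕ) :=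
  V.rec [] fun v _ ih => (Nat.ble (f.pos.dot v) (f.neg.dot v)).rec
    ((v, Nat.sub (f.pos.dot v) (f.neg.dot v)) :: ih) ih

/-- The generators of a cone on which a form is negative, with the absolute values of the form. -/
noncomputable def negatives (f : FormPair) (V : List NatPoint) : List (NatPoint × ℕ) :=
  positives ⟨f.neg, f.pos⟩ V

/-- The generators of a cone on which a form vanishes. -/
noncomputable def zeros (f : FormPair) (V : List NatPoint) : List NatPoint :=
  V.rec [] fun v _ ih => (Nat.beq (f.pos.dot v) (f.neg.dot v)).rec ih (v :: ih)

end FormPair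

/-- Concatenation of two optional lists. -/
noncomputable def optionAppend {α : Type} (l₁ l₂ : Option (List α)) : Option (List α) :=
  l₁.rec none fun a => l₂.rec none fun b => some (a.rec b fun x _ ih => x :: ih)

/-- Cut a simplicial cone along a hyperplane into simplicial cones. The generators on the positive
side and on the negative side come with their distance to the hyperplane, and the new generators
are scaled so that their zeroth coordinate is `N`, if possible. The cones on the negative side are
kept if `keep` is true. The result is `none` if some new generator or weight is not integral. -/
noncomputable def cutCone (N : ℕ) (keep : Bool) (P : List (NatPoint × ℕ)) :
    List (NatPoint × ℕ) → List NatPoint → ℕ → Option (List WeightedCone) :=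
  P.rec (fun M Z d => keep.rec (some []) (some [⟨d, M.map Prod.fst ++ Z⟩])) fun p P ihP M =>
    M.rec (fun Z d => some [⟨d, (p :: P).map Prod.fst ++ Z⟩]) fun q M ihM Z d =>
      -- The edge from `p` to `q` meets the hyperplane in the direction of `q.2 * p + p.2 * q`, and
      -- `w` is this vector divided by `c`. The weight follows the absolute determinant of the
      -- generators: replacing `q` by `w` multiplies it by `p.2 / c`, and replacing `p` by `w`
      -- multiplies it by `q.2 / c`. Exactness of all divisions is tested, so rounding can only lead
      -- to `none`.
      (fun c => (fun w d₁ d₂ =>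
        (and (Nat.beq (Nat.mul c d₁) (Nat.mul d p.2)) (and (Nat.beq (Nat.mul c d₂) (Nat.mul d q.2))
          (NatPoint.isCombination q.2 p.2 c p.1 q.1 w))).rec none
          (optionAppend (ihM (w :: Z) d₁) (ihP (q :: M) (w :: Z) d₂)))
        (NatPoint.combine q.2 p.2 c p.1 q.1) (Nat.div (Nat.mul d p.2) c) (Nat.div (Nat.mul d q.2) c))
      -- With truncated subtraction this is the maximum of 1 and the quotient, so `c` is positive
      -- even when both zeroth coordinates vanish.
      (Nat.add (Nat.sub 1 (Nat.div (Nat.add (Nat.mul q.2 p.1.x₀) (Nat.mul p.2 q.1.x₀)) N))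
        (Nat.div (Nat.add (Nat.mul q.2 p.1.x₀) (Nat.mul p.2 q.1.x₀)) N))

/-- Cut each of several simplicial cones along a hyperplane. -/
noncomputable def cutCones (N : ℕ) (keep : Bool) (f : FormPair) (L : List WeightedCone) :
    Option (List WeightedCone) :=
  L.rec (some []) fun S _ ih => optionAppend
    (cutCone N keep (f.positives S.gens) (f.negatives S.gens) (f.zeros S.gens) S.weight) ih

/-- Intersect simplicial cones with several half-spaces. -/
noncomputable def restrictCones (N : ℕ) (cuts : List FormPair) (L : Option (List WeightedCone)) :
    Option (List WeightedCone) :=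
  cuts.rec (fun L => L) (fun f _ ih L => ih (L.rec none (cutCones N false f))) L

/-- One step of the recursion for the complete homogeneous polynomials in two variables: the
coefficients of `1 / ∏ (1 - a i * X - b i * Y)` are updated for one more factor, and passed on. -/
def homogeneousStep (a b : ℕ) (k : ℕ → ℕ → ℕ → ℕ → ℕ → ℕ → ℕ → ℕ → ℕ)
    (h01 h02 h10 h11 h12 h20 h21 h22 : ℕ) : ℕ :=
  -- Each binder shadows an old coefficient by its new value `h'`, where `h'ᵢⱼ = hᵢⱼ + a * h'ᵢ₋₁ⱼ +
  -- b * h'ᵢⱼ₋₁` and `h₀₀ = 1`: this is division of the series by `1 - a * X - b * Y`.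
  (fun h01 => (fun h02 => (fun h10 => (fun h11 => (fun h12 => (fun h20 => (fun h21 =>
    k h01 h02 h10 h11 h12 h20 h21 (Nat.add h22 (Nat.add (Nat.mul a h12) (Nat.mul b h21))))
    (Nat.add h21 (Nat.add (Nat.mul a h11) (Nat.mul b h20))))
    (Nat.add h20 (Nat.mul a h10)))
    (Nat.add h12 (Nat.add (Nat.mul a h02) (Nat.mul b h11))))
    (Nat.add h11 (Nat.add (Nat.mul a h01) (Nat.mul b h10))))
    (Nat.add h10 a))
    (Nat.add h02 (Nat.mul b h01)))
    (Nat.add h01 b)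

/-- The coefficient of `X ^ 2 * Y ^ 2` in `∏ 1 / (1 - f v * X - g v * Y)`, over the generators `v`
of a cone. -/
noncomputable def homogeneousCoeff (f g : FormPair) (V : List NatPoint) : ℕ :=
  V.rec (motive := fun _ => ℕ → ℕ → ℕ → ℕ → ℕ → ℕ → ℕ → ℕ → ℕ) (fun _ _ _ _ _ _ _ h22 => h22)
    (fun v _ ih => homogeneousStep (Nat.sub (f.pos.dot v) (f.neg.dot v))
      (Nat.sub (g.pos.dot v) (g.neg.dot v)) ih) 0 0 0 0 0 0 0 0

/-- Whether all the generators have zeroth coordinate `N`, and two forms are nonnegative on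
them. -/
noncomputable def isAdmissible (N : ℕ) (f g : FormPair) (V : List NatPoint) : Bool :=
  V.rec true fun v _ ih => and (Nat.beq v.x₀ N) (and (Nat.ble (f.neg.dot v) (f.pos.dot v))
    (and (Nat.ble (g.neg.dot v) (g.pos.dot v)) ih))

/-- The sum of the weighted homogeneous coefficients of several cones. -/
noncomputable def coeffSum (N : ℕ) (f g : FormPair) (L : List WeightedCone) : Option ℕ :=
  L.rec (some 0) fun S _ ih => (isAdmissible N f g S.gens).rec none
    (ih.rec none fun s => some (Nat.add (Nat.mul S.weight (homogeneousCoeff f g S.gens)) s))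

/-- The function `coeff * form ^ 2` restricted to the region where the forms of a list are
positive. -/
structure TruncatedSquare where
  coeff : ℤ
  cuts : List FormPair
  form : FormPair

/-- The integral of a product of two truncated squares over several cones, up to normalization. -/
noncomputable def pairValue (N : ℕ) (L : Option (List WeightedCone)) (s t : TruncatedSquare) :
    Option ℕ :=
  (restrictCones N t.cuts L).rec none (coeffSum N s.form t.form)

/-- The integral of a truncated square times a sum of truncated squares. -/
noncomputable def rowValue (N : ℕ) (L : Option (List WeightedCone)) (s : TruncatedSquare)
    (T : List TruncatedSquare) : Option ℤ :=
  T.rec (some 0) fun t _ ih => (pairValue N L s t).rec none fun a => ih.rec none fun b =>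
    some (t.coeff * a + b)

/-- The integral of the square of a sum of truncated squares. -/
noncomputable def squareValue (N : ℕ) (L : List WeightedCone) (T : List TruncatedSquare) :
    Option ℤ :=
  T.rec (some 0) fun t T ih =>
    (rowValue N (restrictCones N t.cuts (some L)) t [t]).rec none fun a =>
      (rowValue N (restrictCones N t.cuts (some L)) t T).rec none fun b => ih.rec none fun c =>
        -- `a` is the diagonal term; the products with the later terms, collected in `b`, occur
        -- twice by symmetry.
        some (t.coeff * (a + 2 * b) + c)

/-! ### Soundness of the cutting procedure. -/

namespace NatPoint

/-- A point with natural coordinates as a vector. -/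
def toVec (v : NatPoint) : Fin 5 → ℝ := ![v.x₀, v.x₁, v.x₂, v.x₃, v.x₄]

theorem isCombination_iff {a b c : ℕ} {p q w : NatPoint} (h : isCombination a b c p q w = true) :
    (c : ℝ) • w.toVec = (a : ℝ) • p.toVec + (b : ℝ) • q.toVec := by
  simp only [isCombination, Bool.and_eq_true, Nat.beq_eq, Nat.mul_eq, Nat.add_eq] at h
  obtain ⟨h0, h1, h2, h3, h4⟩ := h
  ext i
  fin_cases i <;> simp [toVec] <;> exact_mod_cast ‹_›

end NatPoint

namespace FormPair

/-- The linear form on `ℝ⁵`. -/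
noncomputable def toLin (f : FormPair) : (Fin 5 → ℝ) →ₗ[ℝ] ℝ :=
  ((f.pos.x₀ : ℝ) - f.neg.x₀) • LinearMap.proj 0 + ((f.pos.x₁ : ℝ) - f.neg.x₁) • LinearMap.proj 1 +
  ((f.pos.x₂ : ℝ) - f.neg.x₂) • LinearMap.proj 2 + ((f.pos.x₃ : ℝ) - f.neg.x₃) • LinearMap.proj 3 +
  ((f.pos.x₄ : ℝ) - f.neg.x₄) • LinearMap.proj 4

theorem toLin_apply (f : FormPair) (y : Fin 5 → ℝ) : f.toLin y =
    ((f.pos.x₀ : ℝ) - f.neg.x₀) * y 0 + ((f.pos.x₁ : ℝ) - f.neg.x₁) * y 1 +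
    ((f.pos.x₂ : ℝ) - f.neg.x₂) * y 2 + ((f.pos.x₃ : ℝ) - f.neg.x₃) * y 3 +
    ((f.pos.x₄ : ℝ) - f.neg.x₄) * y 4 := by
  simp [toLin]

theorem measurable_toLin (f : FormPair) : Measurable f.toLin := by
  have : (f.toLin : (Fin 5 → ℝ) → ℝ) = fun y => _ := funext f.toLin_apply
  rw [this]
  fun_prop

theorem toLin_toVec (f : FormPair) (v : NatPoint) :
    f.toLin v.toVec = (f.pos.dot v : ℝ) - f.neg.dot v := by
  simp only [toLin_apply, NatPoint.dot, NatPoint.toVec, Nat.add_eq, Nat.mul_eq]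
  push_cast
  ring

theorem mem_positives {f : FormPair} {V : List NatPoint} {p : NatPoint × ℕ}
    (h : p ∈ f.positives V) : 0 < p.2 ∧ f.toLin p.1.toVec = p.2 := by
  induction V with
  | nil => simp [positives] at h
  | cons v V ih =>
    have e : f.positives (v :: V) = (Nat.ble (f.pos.dot v) (f.neg.dot v)).rec
      ((v, Nat.sub (f.pos.dot v) (f.neg.dot v)) :: f.positives V) (f.positives V) := rfl
    rw [e] at h
    cases hb : Nat.ble (f.pos.dot v) (f.neg.dot v) with
    | true => rw [hb] at h; exact ih h
    | false =>
      rw [hb] at h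
      rcases List.mem_cons.1 h with rfl | h
      · have hlt : f.neg.dot v < f.pos.dot v := by
          by_contra hc
          rw [Nat.ble_eq_true_of_le (not_lt.1 hc)] at hb
          cases hb
        refine ⟨Nat.sub_pos_of_lt hlt, ?_⟩
        rw [toLin_toVec]
        simp only [Nat.sub_eq, Nat.cast_sub hlt.le]
      · exact ih h

theorem mem_negatives {f : FormPair} {V : List NatPoint} {p : NatPoint × ℕ}
    (h : p ∈ f.negatives V) : 0 < p.2 ∧ f.toLin p.1.toVec = -p.2 := by
  obtain ⟨h1, h2⟩ := mem_positives h
  refine ⟨h1, ?_⟩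
  rw [toLin_toVec] at h2 ⊢
  linarith

theorem mem_zeros {f : FormPair} {V : List NatPoint} {v : NatPoint}
    (h : v ∈ f.zeros V) : f.toLin v.toVec = 0 := by
  induction V with
  | nil => simp [zeros] at h
  | cons u V ih =>
    have e : f.zeros (u :: V) = (Nat.beq (f.pos.dot u) (f.neg.dot u)).rec
      (f.zeros V) (u :: f.zeros V) := rfl
    rw [e] at h
    cases hb : Nat.beq (f.pos.dot u) (f.neg.dot u) with
    | false => rw [hb] at h; exact ih h
    | true =>
      rw [hb] at h
      rcases List.mem_cons.1 h with rfl | h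
      · rw [toLin_toVec, Nat.eq_of_beq_eq_true hb, sub_self]
      · exact ih h

/-- Sorting by the sign of the form loses no generator, so it leaves the cone integral unchanged. -/
theorem perm_sort (f : FormPair) (V : List NatPoint) :
    (f.positives V).map Prod.fst ++ ((f.negatives V).map Prod.fst ++ f.zeros V) |>.Perm V := by
  induction V with
  | nil => simp [positives, negatives, zeros]
  | cons v V ih =>
    have e1 : f.positives (v :: V) = (Nat.ble (f.pos.dot v) (f.neg.dot v)).rec
      ((v, Nat.sub (f.pos.dot v) (f.neg.dot v)) :: f.positives V) (f.positives V) := rfl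
    have e2 : f.negatives (v :: V) = (Nat.ble (f.neg.dot v) (f.pos.dot v)).rec
      ((v, Nat.sub (f.neg.dot v) (f.pos.dot v)) :: f.negatives V) (f.negatives V) := rfl
    have e3 : f.zeros (v :: V) = (Nat.beq (f.pos.dot v) (f.neg.dot v)).rec
      (f.zeros V) (v :: f.zeros V) := rfl
    rcases lt_trichotomy (f.pos.dot v) (f.neg.dot v) with h | h | h
    · have h1 : Nat.ble (f.pos.dot v) (f.neg.dot v) = true := Nat.ble_eq_true_of_le h.le
      have h2 : Nat.ble (f.neg.dot v) (f.pos.dot v) = false := by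
        rw [← Bool.not_eq_true, Nat.ble_eq]; omega
      have h3 : Nat.beq (f.pos.dot v) (f.neg.dot v) = false := by
        rw [← Bool.not_eq_true, Nat.beq_eq]; omega
      rw [e1, e2, e3, h1, h2, h3]
      exact List.perm_middle.trans (ih.cons v)
    · have h1 : Nat.ble (f.pos.dot v) (f.neg.dot v) = true := Nat.ble_eq_true_of_le h.le
      have h2 : Nat.ble (f.neg.dot v) (f.pos.dot v) = true := Nat.ble_eq_true_of_le h.ge
      have h3 : Nat.beq (f.pos.dot v) (f.neg.dot v) = true := by rw [Nat.beq_eq]; exact h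
      rw [e1, e2, e3, h1, h2, h3]
      exact ((List.perm_middle.append_left _).trans List.perm_middle).trans (ih.cons v)
    · have h1 : Nat.ble (f.pos.dot v) (f.neg.dot v) = false := by
        rw [← Bool.not_eq_true, Nat.ble_eq]; omega
      have h2 : Nat.ble (f.neg.dot v) (f.pos.dot v) = true := Nat.ble_eq_true_of_le h.le
      have h3 : Nat.beq (f.pos.dot v) (f.neg.dot v) = false := by
        rw [← Bool.not_eq_true, Nat.beq_eq]; omega
      rw [e1, e2, e3, h1, h2, h3]
      exact ih.cons v

end FormPair

theorem optionAppend_eq_some {α : Type} {l₁ l₂ : Option (List α)} {l : List α}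
    (h : optionAppend l₁ l₂ = some l) : ∃ a b, l₁ = some a ∧ l₂ = some b ∧ l = a ++ b := by
  have key : ∀ a b : List α, (a.rec b fun x _ ih => x :: ih : List α) = a ++ b := by
    intro a b
    induction a with
    | nil => rfl
    | cons x a ih => exact congrArg (x :: ·) ih
  cases l₁ with
  | none => cases h
  | some a =>
    cases l₂ with
    | none => cases h
    | some b => exact ⟨a, b, rfl, rfl, (Option.some.inj h).symm.trans (key a b)⟩

/-- The weighted sum of the integrals of a function over several cones. -/
noncomputable def conesLIntegral (φ : (Fin 5 → ℝ) → ℝ≥0∞) (L : List WeightedCone) : ℝ≥0∞ :=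
  (L.map fun S => (S.weight : ℝ≥0∞) * coneLIntegral φ (S.gens.map NatPoint.toVec) 0).sum

theorem conesLIntegral_append (φ : (Fin 5 → ℝ) → ℝ≥0∞) (L M : List WeightedCone) :
    conesLIntegral φ (L ++ M) = conesLIntegral φ L + conesLIntegral φ M := by
  simp [conesLIntegral]

/-- What a successful step certifies. The tests inside `cutCone` turn the rounded quotients into
exact equations. -/
theorem cutCone_cons_cons {N : ℕ} {keep : Bool} {p q : NatPoint × ℕ} {P M : List (NatPoint × ℕ)}
    {Z : List NatPoint} {d : ℕ} {L : List WeightedCone}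
    (h : cutCone N keep (p :: P) (q :: M) Z d = some L) :
    ∃ (c : ℕ) (w : NatPoint) (d₁ d₂ : ℕ) (L₁ L₂ : List WeightedCone),
      0 < c ∧ c * d₁ = d * p.2 ∧ c * d₂ = d * q.2 ∧
      (c : ℝ) • w.toVec = (q.2 : ℝ) • p.1.toVec + (p.2 : ℝ) • q.1.toVec ∧
      cutCone N keep (p :: P) M (w :: Z) d₁ = some L₁ ∧
      cutCone N keep P (q :: M) (w :: Z) d₂ = some L₂ ∧ L = L₁ ++ L₂ := by
  set e := Nat.div (Nat.add (Nat.mul q.2 p.1.x₀) (Nat.mul p.2 q.1.x₀)) N with he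
  set c := Nat.add (Nat.sub 1 e) e with hc
  set w := NatPoint.combine q.2 p.2 c p.1 q.1 with hw
  set d₁ := Nat.div (Nat.mul d p.2) c with hd₁
  set d₂ := Nat.div (Nat.mul d q.2) c with hd₂
  have h' : (and (Nat.beq (Nat.mul c d₁) (Nat.mul d p.2))
      (and (Nat.beq (Nat.mul c d₂) (Nat.mul d q.2))
        (NatPoint.isCombination q.2 p.2 c p.1 q.1 w))).rec none
      (optionAppend (cutCone N keep (p :: P) M (w :: Z) d₁)
        (cutCone N keep P (q :: M) (w :: Z) d₂)) = some L := h
  cases hb : and (Nat.beq (Nat.mul c d₁) (Nat.mul d p.2))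
      (and (Nat.beq (Nat.mul c d₂) (Nat.mul d q.2))
        (NatPoint.isCombination q.2 p.2 c p.1 q.1 w)) with
  | false => rw [hb] at h'; cases h'
  | true =>
    rw [hb] at h'
    simp only [Bool.and_eq_true, Nat.beq_eq] at hb
    obtain ⟨L₁, L₂, h₁, h₂, h₃⟩ := optionAppend_eq_some h'
    refine ⟨c, w, d₁, d₂, L₁, L₂, ?_, hb.1, hb.2.1, NatPoint.isCombination_iff hb.2.2, h₁, h₂, h₃⟩
    simp only [hc, Nat.add_eq, Nat.sub_eq]
    omega

/-- Each step cuts the edge from a positive generator `p` to a negative one `q` at a point `w` of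
the hyperplane. Both halves have fewer generators off the hyperplane, and the weights match the
coefficients in `coneLIntegral_split`. When no positive generator is left, the cone lies in the
closed negative half-space: it is kept, or contributes nothing because `φ` vanishes there. -/
theorem conesLIntegral_cutCone {φ : (Fin 5 → ℝ) → ℝ≥0∞} (hφ : Measurable φ)
    {f : (Fin 5 → ℝ) →ₗ[ℝ] ℝ} {N : ℕ} {keep : Bool} (hk : keep = true ∨ ∀ y, f y ≤ 0 → φ y = 0)
    {P M : List (NatPoint × ℕ)} {Z : List NatPoint} {d : ℕ} {L : List WeightedCone}
    (hP : ∀ p ∈ P, 0 < p.2 ∧ f p.1.toVec = p.2) (hM : ∀ p ∈ M, 0 < p.2 ∧ f p.1.toVec = -p.2)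
    (hZ : ∀ v ∈ Z, f v.toVec = 0) (h : cutCone N keep P M Z d = some L) :
    conesLIntegral φ L = d * coneLIntegral φ
      ((P.map Prod.fst ++ (M.map Prod.fst ++ Z)).map NatPoint.toVec) 0 := by
  induction P generalizing M Z d L with
  | nil =>
    cases keep with
    | true =>
      obtain rfl := Option.some.inj (h : some [(⟨d, M.map Prod.fst ++ Z⟩ : WeightedCone)] = some L)
      simp [conesLIntegral]
    | false =>
      obtain rfl := Option.some.inj (h : some [] = some L)
      rw [coneLIntegral_eq_zero (hk.resolve_left (by simp)) _ (by simp)]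
      · simp [conesLIntegral]
      · intro v hv
        simp only [List.map_nil, List.nil_append, List.mem_map, List.mem_append] at hv
        obtain ⟨u, hu, rfl⟩ := hv
        rcases hu with ⟨p, hp, rfl⟩ | hu
        · rw [(hM p hp).2]; simp
        · exact (hZ u hu).le
  | cons p P ihP =>
    induction M generalizing Z d L with
    | nil =>
      obtain rfl := Option.some.inj
        (h : some [(⟨d, (p :: P).map Prod.fst ++ Z⟩ : WeightedCone)] = some L)
      simp [conesLIntegral]
    | cons q M ihM =>
      obtain ⟨c, w, d₁, d₂, L₁, L₂, hc, h₁, h₂, hw, e₁, e₂, rfl⟩ := cutCone_cons_cons h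
      obtain ⟨hp0, hp⟩ := hP p (by simp)
      obtain ⟨hq0, hq⟩ := hM q (by simp)
      have hc' : (0 : ℝ) < c := by exact_mod_cast hc
      have hw0 : f w.toVec = 0 := by
        have := congrArg f hw
        simp only [map_add, map_smul, hp, hq, smul_eq_mul] at this
        have h3 : (c : ℝ) * f w.toVec = 0 := by rw [this]; ring
        exact (mul_eq_zero.1 h3).resolve_left hc'.ne'
      have hZ' : ∀ v ∈ w :: Z, f v.toVec = 0 := by
        intro v hv
        rcases List.mem_cons.1 hv with rfl | hv
        exacts [hw0, hZ v hv]
      rw [conesLIntegral_append, ihM (fun x hx => hM x (by simp [hx])) hZ' e₁,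
        ihP (fun x hx => hP x (by simp [hx])) hM hZ' e₂]
      set V := P.map Prod.fst ++ (M.map Prod.fst ++ Z) with hV
      have p₁ : ((p :: P).map Prod.fst ++ (M.map Prod.fst ++ w :: Z)).Perm (p.1 :: w :: V) := by
        refine List.Perm.cons _ ?_
        refine (List.Perm.append_left _ List.perm_middle).trans List.perm_middle
      have p₂ : (P.map Prod.fst ++ ((q :: M).map Prod.fst ++ w :: Z)).Perm (w :: q.1 :: V) := by
        refine (List.Perm.append_left _ (List.Perm.cons _ List.perm_middle)).trans ?_
        refine List.perm_middle.trans ((List.Perm.cons _ List.perm_middle).trans ?_)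
        exact List.Perm.swap _ _ _
      have p₃ : ((p :: P).map Prod.fst ++ ((q :: M).map Prod.fst ++ Z)).Perm
          (p.1 :: q.1 :: V) := List.Perm.cons _ List.perm_middle
      rw [coneLIntegral_perm hφ (p₁.map _), coneLIntegral_perm hφ (p₂.map _),
        coneLIntegral_perm hφ (p₃.map _)]
      have key := coneLIntegral_split hφ (a := q.2) (b := p.2) (c := c) (by exact_mod_cast hq0)
        (by exact_mod_cast hp0) hc' hw (V.map NatPoint.toVec) 0
      simp only [ENNReal.ofReal_natCast] at key
      simp only [List.map_cons]
      have hcE : (c : ℝ≥0∞) ≠ 0 := by exact_mod_cast hc.ne'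
      -- Both sides are multiplied by `c`, since only `c * d₁` and `c * d₂` are known without
      -- division.
      refine (ENNReal.mul_right_inj hcE (ENNReal.natCast_ne_top c)).1 ?_
      have h₁' : (c : ℝ≥0∞) * d₁ = d * p.2 := by exact_mod_cast h₁
      have h₂' : (c : ℝ≥0∞) * d₂ = d * q.2 := by exact_mod_cast h₂
      rw [mul_add, ← mul_assoc, ← mul_assoc, h₁', h₂', mul_left_comm, key, mul_add, mul_assoc,
        mul_assoc]

/-- A surviving cone lies on the nonnegative side and has a generator off the hyperplane. Hence the
form is positive throughout the open cone, as `coneLIntegral_congr_of_pos` requires. -/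
theorem gens_cutCone {f : (Fin 5 → ℝ) →ₗ[ℝ] ℝ} {N : ℕ}
    {P M : List (NatPoint × ℕ)} {Z : List NatPoint} {d : ℕ} {L : List WeightedCone}
    (hP : ∀ p ∈ P, 0 < p.2 ∧ f p.1.toVec = p.2) (hM : ∀ p ∈ M, 0 < p.2 ∧ f p.1.toVec = -p.2)
    (hZ : ∀ v ∈ Z, f v.toVec = 0) (h : cutCone N false P M Z d = some L) :
    ∀ S ∈ L, (∀ v ∈ S.gens, 0 ≤ f v.toVec) ∧ ∃ v ∈ S.gens, 0 < f v.toVec := by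
  induction P generalizing M Z d L with
  | nil =>
    obtain rfl := Option.some.inj (h : some [] = some L)
    simp
  | cons p P ihP =>
    induction M generalizing Z d L with
    | nil =>
      obtain rfl := Option.some.inj
        (h : some [(⟨d, (p :: P).map Prod.fst ++ Z⟩ : WeightedCone)] = some L)
      intro S hS
      obtain rfl := List.mem_singleton.1 hS
      refine ⟨fun v hv => ?_, p.1, by simp, ?_⟩
      · rcases List.mem_append.1 hv with hv | hv
        · obtain ⟨x, hx, rfl⟩ := List.mem_map.1 hv
          rw [(hP x hx).2]
          positivity
        · exact (hZ v hv).ge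
      · rw [(hP p (by simp)).2]
        exact_mod_cast (hP p (by simp)).1
    | cons q M ihM =>
      obtain ⟨c, w, d₁, d₂, L₁, L₂, hc, h₁, h₂, hw, e₁, e₂, rfl⟩ := cutCone_cons_cons h
      obtain ⟨hp0, hp⟩ := hP p (by simp)
      obtain ⟨hq0, hq⟩ := hM q (by simp)
      have hc' : (0 : ℝ) < c := by exact_mod_cast hc
      have hw0 : f w.toVec = 0 := by
        have := congrArg f hw
        simp only [map_add, map_smul, hp, hq, smul_eq_mul] at this
        have h3 : (c : ℝ) * f w.toVec = 0 := by rw [this]; ring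
        exact (mul_eq_zero.1 h3).resolve_left hc'.ne'
      have hZ' : ∀ v ∈ w :: Z, f v.toVec = 0 := by
        intro v hv
        rcases List.mem_cons.1 hv with rfl | hv
        exacts [hw0, hZ v hv]
      intro S hS
      rcases List.mem_append.1 hS with hS | hS
      · exact ihM (fun x hx => hM x (by simp [hx])) hZ' e₁ S hS
      · exact ihP (fun x hx => hP x (by simp [hx])) hM hZ' e₂ S hS

theorem conesLIntegral_cutCones {φ : (Fin 5 → ℝ) → ℝ≥0∞} (hφ : Measurable φ)
    {f : FormPair} {N : ℕ} {keep : Bool} (hk : keep = true ∨ ∀ y, f.toLin y ≤ 0 → φ y = 0)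
    {L L' : List WeightedCone} (h : cutCones N keep f L = some L') :
    conesLIntegral φ L' = conesLIntegral φ L := by
  induction L generalizing L' with
  | nil => obtain rfl := Option.some.inj (h : some [] = some L'); rfl
  | cons S L ih =>
    obtain ⟨a, b, ha, hb, rfl⟩ := optionAppend_eq_some (h : optionAppend
      (cutCone N keep (f.positives S.gens) (f.negatives S.gens) (f.zeros S.gens) S.weight)
      (cutCones N keep f L) = some L')
    rw [conesLIntegral_append, ih hb, conesLIntegral_cutCone hφ hk
      (fun p hp => FormPair.mem_positives hp) (fun p hp => FormPair.mem_negatives hp)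
      (fun p hp => FormPair.mem_zeros hp) ha,
      coneLIntegral_perm hφ ((f.perm_sort S.gens).map _)]
    simp [conesLIntegral]

theorem gens_cutCones {f : FormPair} {N : ℕ} {L L' : List WeightedCone}
    (h : cutCones N false f L = some L') :
    ∀ S ∈ L', (∀ v ∈ S.gens, 0 ≤ f.toLin v.toVec) ∧ ∃ v ∈ S.gens, 0 < f.toLin v.toVec := by
  induction L generalizing L' with
  | nil => obtain rfl := Option.some.inj (h : some [] = some L'); simp
  | cons S L ih =>
    obtain ⟨a, b, ha, hb, rfl⟩ := optionAppend_eq_some (h : optionAppend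
      (cutCone N false (f.positives S.gens) (f.negatives S.gens) (f.zeros S.gens) S.weight)
      (cutCones N false f L) = some L')
    intro T hT
    rcases List.mem_append.1 hT with hT | hT
    · exact gens_cutCone (fun p hp => FormPair.mem_positives hp)
        (fun p hp => FormPair.mem_negatives hp) (fun p hp => FormPair.mem_zeros hp) ha T hT
    · exact ih hb T hT

/-- The restriction of a function to the region where a form is positive. -/
noncomputable def restrictPos (f : FormPair) (φ : (Fin 5 → ℝ) → ℝ≥0∞) : (Fin 5 → ℝ) → ℝ≥0∞ :=
  {y | 0 < f.toLin y}.indicator φ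

theorem measurable_restrictPos (f : FormPair) {φ : (Fin 5 → ℝ) → ℝ≥0∞} (hφ : Measurable φ) :
    Measurable (restrictPos f φ) :=
  hφ.indicator (measurableSet_lt measurable_const f.measurable_toLin)

/-- The truncated function vanishes on the discarded pieces, and the truncation has no effect on the
pieces that are kept. -/
theorem conesLIntegral_restrictPos {φ : (Fin 5 → ℝ) → ℝ≥0∞} (hφ : Measurable φ) {f : FormPair}
    {N : ℕ} {L L' : List WeightedCone} (h : cutCones N false f L = some L') :
    conesLIntegral (restrictPos f φ) L = conesLIntegral φ L' := by
  rw [← conesLIntegral_cutCones (measurable_restrictPos f hφ) (f := f) (Or.inr _) h]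
  · unfold conesLIntegral
    congr 1
    refine List.map_congr_left fun S hS => ?_
    obtain ⟨h1, v, hv, h2⟩ := gens_cutCones h S hS
    congr 1
    refine coneLIntegral_congr_of_pos (f := f.toLin) (fun y hy => ?_) ?_ (by simp)
      (Or.inr ⟨_, List.mem_map_of_mem hv, h2⟩)
    · simp [restrictPos, hy]
    · intro u hu
      obtain ⟨x, hx, rfl⟩ := List.mem_map.1 hu
      exact h1 x hx
  · intro y hy
    simp [restrictPos, hy]

/-- The restriction of a function to the region where several forms are positive. -/
noncomputable def restrictAllPos (cuts : List FormPair) (φ : (Fin 5 → ℝ) → ℝ≥0∞) :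
    (Fin 5 → ℝ) → ℝ≥0∞ :=
  cuts.foldr restrictPos φ

theorem measurable_restrictAllPos (cuts : List FormPair) {φ : (Fin 5 → ℝ) → ℝ≥0∞}
    (hφ : Measurable φ) : Measurable (restrictAllPos cuts φ) := by
  induction cuts with
  | nil => exact hφ
  | cons f cuts ih => exact measurable_restrictPos f ih

theorem restrictCones_none (N : ℕ) (cuts : List FormPair) : restrictCones N cuts none = none := by
  induction cuts with
  | nil => rfl
  | cons f cuts ih => exact ih

theorem conesLIntegral_restrictAllPos {φ : (Fin 5 → ℝ) → ℝ≥0∞} (hφ : Measurable φ)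
    {cuts : List FormPair} {N : ℕ} {L L' : List WeightedCone}
    (h : restrictCones N cuts (some L) = some L') :
    conesLIntegral (restrictAllPos cuts φ) L = conesLIntegral φ L' := by
  induction cuts generalizing L with
  | nil => obtain rfl := Option.some.inj (h : some L = some L'); rfl
  | cons f cuts ih =>
    have h' : restrictCones N cuts (cutCones N false f L) = some L' := h
    cases hc : cutCones N false f L with
    | none => rw [hc, restrictCones_none] at h'; cases h'
    | some M =>
      rw [hc] at h'
      rw [← ih h']
      exact conesLIntegral_restrictPos (measurable_restrictAllPos cuts hφ) hc

/-! ### Integrals of products of squares over a simplicial cone with exponential weight. -/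

theorem integrableOn_pow_mul_exp_neg (k : ℕ) :
    IntegrableOn (fun t : ℝ => t ^ k * Real.exp (-t)) (Set.Ioi 0) := by
  have h := Real.GammaIntegral_convergent (s := k + 1) (by positivity)
  refine h.congr_fun (fun t ht => ?_) measurableSet_Ioi
  simp [mul_comm]

theorem integral_pow_mul_exp_neg (k : ℕ) :
    ∫ t in Set.Ioi (0 : ℝ), t ^ k * Real.exp (-t) = k.factorial := by
  rw [← Real.Gamma_nat_eq_factorial, Real.Gamma_eq_integral (by positivity)]
  refine setIntegral_congr_fun measurableSet_Ioi fun t ht => ?_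
  simp [mul_comm]

/-- Termwise Gamma integrals. Single coefficients may be negative; nonnegativity of the whole
polynomial is what allows the passage between Lebesgue and Bochner integrals. -/
theorem setLIntegral_polynomial_mul_exp_neg {n : ℕ} (c : Fin n → ℝ)
    (hc : ∀ t : ℝ, 0 < t → 0 ≤ ∑ k, c k * t ^ (k : ℕ)) :
    ∫⁻ t in Set.Ioi (0 : ℝ), ENNReal.ofReal ((∑ k, c k * t ^ (k : ℕ)) * Real.exp (-t)) =
      ENNReal.ofReal (∑ k, c k * (k : ℕ).factorial) := by
  have h1 : ∀ k ∈ (Finset.univ : Finset (Fin n)), IntegrableOn (fun t : ℝ => c k * (t ^ (k : ℕ) * Real.exp (-t)))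
      (Set.Ioi 0) := fun k _ => (integrableOn_pow_mul_exp_neg k).const_mul _
  have h2 : (fun t : ℝ => (∑ k, c k * t ^ (k : ℕ)) * Real.exp (-t)) =
      fun t => ∑ k, c k * (t ^ (k : ℕ) * Real.exp (-t)) := by
    funext t
    simp only [Finset.sum_mul, mul_assoc]
  rw [← ofReal_integral_eq_lintegral_ofReal]
  · rw [h2, integral_finsetSum _ h1]
    simp only [integral_const_mul, integral_pow_mul_exp_neg]
  · rw [h2]
    exact integrable_finsetSum _ h1
  · filter_upwards [ae_restrict_mem measurableSet_Ioi] with t ht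
    exact mul_nonneg (hc t ht) (Real.exp_pos _).le

section

variable {E : Type*} [AddCommGroup E] [Module ℝ E]

/-- The integral over a cone only depends on the values of the function on a region that is closed
under adding positive multiples of the generators. -/
theorem coneLIntegral_congr_of_mem {φ ψ : E → ℝ≥0∞} {R : Set E} (h : ∀ y ∈ R, φ y = ψ y)
    {V : List E} (hV : ∀ v ∈ V, ∀ y ∈ R, ∀ t : ℝ, 0 < t → y + t • v ∈ R) {x : E} (hx : x ∈ R) :
    coneLIntegral φ V x = coneLIntegral ψ V x := by
  induction V generalizing x with
  | nil => exact h x hx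
  | cons v V ih =>
    exact setLIntegral_congr_fun measurableSet_Ioi fun t ht =>
      ih (fun w hw => hV w (by simp [hw])) (hV v (by simp) x hx t ht)

theorem coneLIntegral_append (φ : E → ℝ≥0∞) (V W : List E) :
    coneLIntegral φ (V ++ W) = coneLIntegral (coneLIntegral φ W) V := by
  induction V with
  | nil => rfl
  | cons v V ih => funext x; simp only [List.cons_append, coneLIntegral_cons, ih]

/-- Moves the first generator to the innermost integral, so that an induction on the generators can
integrate them out one at a time. -/
theorem coneLIntegral_cons_eq [MeasurableSpace E] [MeasurableAdd₂ E] [MeasurableSMul₂ ℝ E]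
    {φ : E → ℝ≥0∞} (hφ : Measurable φ) (v : E) (V : List E) :
    coneLIntegral φ (v :: V) = coneLIntegral (coneLIntegral φ [v]) V := by
  rw [← coneLIntegral_append, coneLIntegral_perm hφ List.perm_append_comm]
  rfl

end

/-- The polynomial that is integrated by the recursion for the homogeneous coefficients. -/
def homogeneousPoly (h01 h02 h10 h11 h12 h20 h21 h22 X Y : ℝ) : ℝ :=
  X ^ 2 * Y ^ 2 + 2 * h01 * X ^ 2 * Y + 2 * h02 * X ^ 2 + 2 * h10 * X * Y ^ 2 + 4 * h11 * X * Y +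
    4 * h12 * X + 2 * h20 * Y ^ 2 + 4 * h21 * Y + 4 * h22

theorem homogeneousPoly_nonneg {h01 h02 h10 h11 h12 h20 h21 h22 X Y : ℝ} (_ : 0 ≤ h01)
    (_ : 0 ≤ h02) (_ : 0 ≤ h10) (_ : 0 ≤ h11) (_ : 0 ≤ h12) (_ : 0 ≤ h20) (_ : 0 ≤ h21)
    (_ : 0 ≤ h22) (_ : 0 ≤ X) (_ : 0 ≤ Y) :
    0 ≤ homogeneousPoly h01 h02 h10 h11 h12 h20 h21 h22 X Y := by
  unfold homogeneousPoly
  positivity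

/-- Let `H(u, v) = ∑ hᵢⱼ uⁱ vʲ` with `h₀₀ = 1`. Then `homogeneousPoly` is `2! * 2!` times the
coefficient of `u² v²` in `exp(u X + v Y) * H(u, v)`. Integrating `exp(-t) * exp(u (X + t a) + v (Y
+ t b))` over `t` gives `exp(u X + v Y) / (1 - a u - b v)`, so `H` is divided by `1 - a u - b v`,
which is the update of `homogeneousStep`. -/
theorem setLIntegral_homogeneousPoly {h01 h02 h10 h11 h12 h20 h21 h22 X Y a b : ℝ} (h1 : 0 ≤ h01)
    (h2 : 0 ≤ h02) (h3 : 0 ≤ h10) (h4 : 0 ≤ h11) (h5 : 0 ≤ h12) (h6 : 0 ≤ h20) (h7 : 0 ≤ h21)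
    (h8 : 0 ≤ h22) (hX : 0 ≤ X) (hY : 0 ≤ Y) (ha : 0 ≤ a) (hb : 0 ≤ b) (s : ℝ) :
    ∫⁻ t in Set.Ioi (0 : ℝ), ENNReal.ofReal (Real.exp (-(s + t)) *
        homogeneousPoly h01 h02 h10 h11 h12 h20 h21 h22 (X + t * a) (Y + t * b)) =
      ENNReal.ofReal (Real.exp (-s) * homogeneousPoly (h01 + b) (h02 + b * (h01 + b)) (h10 + a)
        (h11 + (a * (h01 + b) + b * (h10 + a)))
        (h12 + (a * (h02 + b * (h01 + b)) + b * (h11 + (a * (h01 + b) + b * (h10 + a)))))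
        (h20 + a * (h10 + a))
        (h21 + (a * (h11 + (a * (h01 + b) + b * (h10 + a))) + b * (h20 + a * (h10 + a))))
        (h22 + (a * (h12 + (a * (h02 + b * (h01 + b)) +
          b * (h11 + (a * (h01 + b) + b * (h10 + a))))) +
          b * (h21 + (a * (h11 + (a * (h01 + b) + b * (h10 + a))) + b * (h20 + a * (h10 + a))))))
        X Y) := by
  -- The coefficients of the powers of `t` in the expansion of the integrand.
  set c : Fin 5 → ℝ := ![homogeneousPoly h01 h02 h10 h11 h12 h20 h21 h22 X Y,
    2 * X * a * Y ^ 2 + 2 * X ^ 2 * Y * b + 2 * h01 * (2 * X * a * Y + X ^ 2 * b) +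
      4 * h02 * X * a + 2 * h10 * (a * Y ^ 2 + 2 * X * Y * b) + 4 * h11 * (a * Y + X * b) +
      4 * h12 * a + 4 * h20 * Y * b + 4 * h21 * b,
    a ^ 2 * Y ^ 2 + 4 * X * a * Y * b + X ^ 2 * b ^ 2 + 2 * h01 * (a ^ 2 * Y + 2 * X * a * b) +
      2 * h02 * a ^ 2 + 2 * h10 * (2 * a * Y * b + X * b ^ 2) + 4 * h11 * a * b +
      2 * h20 * b ^ 2,
    2 * a ^ 2 * Y * b + 2 * X * a * b ^ 2 + 2 * h01 * a ^ 2 * b + 2 * h10 * a * b ^ 2,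
    a ^ 2 * b ^ 2] with hc
  have e : ∀ t : ℝ, homogeneousPoly h01 h02 h10 h11 h12 h20 h21 h22 (X + t * a) (Y + t * b) =
      ∑ k, c k * t ^ (k : ℕ) := by
    intro t
    simp [Fin.sum_univ_succ, hc, homogeneousPoly]
    ring
  have e2 : ∀ t : ℝ, ENNReal.ofReal (Real.exp (-(s + t)) *
      homogeneousPoly h01 h02 h10 h11 h12 h20 h21 h22 (X + t * a) (Y + t * b)) =
      ENNReal.ofReal (Real.exp (-s)) *
        ENNReal.ofReal ((∑ k, c k * t ^ (k : ℕ)) * Real.exp (-t)) := by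
    intro t
    rw [← ENNReal.ofReal_mul (Real.exp_pos _).le, e t, neg_add, Real.exp_add]
    congr 1
    ring
  simp only [e2]
  rw [lintegral_const_mul' _ _ ENNReal.ofReal_ne_top, setLIntegral_polynomial_mul_exp_neg,
    ← ENNReal.ofReal_mul (Real.exp_pos _).le]
  · congr 2
    simp [Fin.sum_univ_succ, hc, homogeneousPoly, Nat.factorial]
    ring
  · intro t ht
    rw [← e t]
    exact homogeneousPoly_nonneg h1 h2 h3 h4 h5 h6 h7 h8 (by positivity) (by positivity)

theorem isAdmissible_cons {N : ℕ} {f g : FormPair} {v : NatPoint} {V : List NatPoint}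
    (h : isAdmissible N f g (v :: V) = true) : v.x₀ = N ∧ f.neg.dot v ≤ f.pos.dot v ∧
      g.neg.dot v ≤ g.pos.dot v ∧ isAdmissible N f g V = true := by
  have h' : and (Nat.beq v.x₀ N) (and (Nat.ble (f.neg.dot v) (f.pos.dot v))
    (and (Nat.ble (g.neg.dot v) (g.pos.dot v)) (isAdmissible N f g V))) = true := h
  simpa only [Bool.and_eq_true, Nat.beq_eq, Nat.ble_eq] using h'

theorem dot_le_of_isAdmissible {N : ℕ} {f g : FormPair} {u : NatPoint} {V : List NatPoint}
    (h : isAdmissible N f g V = true) (hu : u ∈ V) :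
    f.neg.dot u ≤ f.pos.dot u ∧ g.neg.dot u ≤ g.pos.dot u := by
  induction V with
  | nil => simp at hu
  | cons v V ih =>
    obtain ⟨-, h1, h2, h3⟩ := isAdmissible_cons h
    rcases List.mem_cons.1 hu with rfl | hu
    exacts [⟨h1, h2⟩, ih h3 hu]

/-- All generators have zeroth coordinate `N`, so `y 0 / N` is the sum of the cone coordinates and
the weight factorizes. Integrating out one generator updates the coefficients, and at the apex only
`4 * h22` is left. -/
theorem coneLIntegral_eq_homogeneousCoeff {N : ℕ} (hN : 0 < N) {f g : FormPair}
    {V : List NatPoint} (hV : isAdmissible N f g V = true) :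
    coneLIntegral (fun y => ENNReal.ofReal (Real.exp (-(y 0 / N)) * (f.toLin y ^ 2 * g.toLin y ^ 2)))
      (V.map NatPoint.toVec) 0 = 4 * homogeneousCoeff f g V := by
  have key : ∀ h01 h02 h10 h11 h12 h20 h21 h22 : ℕ,
      coneLIntegral (fun y => ENNReal.ofReal (Real.exp (-(y 0 / N)) *
        homogeneousPoly h01 h02 h10 h11 h12 h20 h21 h22 (f.toLin y) (g.toLin y)))
        (V.map NatPoint.toVec) 0 =
      4 * (V.rec (motive := fun _ => ℕ → ℕ → ℕ → ℕ → ℕ → ℕ → ℕ → ℕ → ℕ)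
        (fun _ _ _ _ _ _ _ h22 => h22)
        (fun v _ ih => homogeneousStep (Nat.sub (f.pos.dot v) (f.neg.dot v))
          (Nat.sub (g.pos.dot v) (g.neg.dot v)) ih) h01 h02 h10 h11 h12 h20 h21 h22 : ℕ) := by
    induction V with
    | nil =>
      intro h01 h02 h10 h11 h12 h20 h21 h22
      simp [coneLIntegral, homogeneousPoly]
    | cons v V ih =>
      intro h01 h02 h10 h11 h12 h20 h21 h22
      obtain ⟨hv0, hf, hg, hV'⟩ := isAdmissible_cons hV
      have hf' : f.toLin v.toVec = (f.pos.dot v - f.neg.dot v : ℕ) := by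
        rw [f.toLin_toVec, Nat.cast_sub hf]
      have hg' : g.toLin v.toVec = (g.pos.dot v - g.neg.dot v : ℕ) := by
        rw [g.toLin_toVec, Nat.cast_sub hg]
      set a := f.pos.dot v - f.neg.dot v with ha
      set b := g.pos.dot v - g.neg.dot v with hb
      refine Eq.trans ?_ (ih hV' (h01 + b) (h02 + b * (h01 + b)) (h10 + a)
        (h11 + (a * (h01 + b) + b * (h10 + a)))
        (h12 + (a * (h02 + b * (h01 + b)) + b * (h11 + (a * (h01 + b) + b * (h10 + a)))))
        (h20 + a * (h10 + a))
        (h21 + (a * (h11 + (a * (h01 + b) + b * (h10 + a))) + b * (h20 + a * (h10 + a))))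
        (h22 + (a * (h12 + (a * (h02 + b * (h01 + b)) +
          b * (h11 + (a * (h01 + b) + b * (h10 + a))))) +
          b * (h21 + (a * (h11 + (a * (h01 + b) + b * (h10 + a))) + b * (h20 + a * (h10 + a)))))))
      rw [List.map_cons, coneLIntegral_cons_eq]
      -- The formula for one generator needs nonnegative values of both forms; admissible generators
      -- preserve the region where this holds.
      · refine coneLIntegral_congr_of_mem (R := {y | 0 ≤ f.toLin y ∧ 0 ≤ g.toLin y}) ?_ ?_
          (by simp)
        · rintro y ⟨hfy, hgy⟩
          rw [coneLIntegral_cons]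
          have h0 : (v.toVec 0 : ℝ) / N = 1 := by
            simp only [NatPoint.toVec, Matrix.cons_val_zero, hv0]
            have : (N : ℝ) ≠ 0 := by positivity
            field_simp
          have e : ∀ t : ℝ, (y + t • v.toVec) 0 / N = y 0 / N + t := by
            intro t
            simp only [Pi.add_apply, Pi.smul_apply, smul_eq_mul, add_div, mul_div_assoc, h0, mul_one]
          simp only [coneLIntegral, e, map_add, map_smul, smul_eq_mul, hf', hg']
          rw [setLIntegral_homogeneousPoly] <;> first | positivity | assumption | skip
          push_cast
          rfl
        · intro w hw y hy t ht
          obtain ⟨u, hu, rfl⟩ := List.mem_map.1 hw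
          have hu' := dot_le_of_isAdmissible hV' hu
          simp only [Set.mem_ofPred_eq, map_add, map_smul, smul_eq_mul, FormPair.toLin_toVec] at hy ⊢
          have h1 : (0 : ℝ) ≤ f.pos.dot u - f.neg.dot u := sub_nonneg.2 (by exact_mod_cast hu'.1)
          have h2 : (0 : ℝ) ≤ g.pos.dot u - g.neg.dot u := sub_nonneg.2 (by exact_mod_cast hu'.2)
          exact ⟨by nlinarith [hy.1], by nlinarith [hy.2]⟩
      · have := f.measurable_toLin
        have := g.measurable_toLin
        unfold homogeneousPoly
        fun_prop
  have := key 0 0 0 0 0 0 0 0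
  simp only [homogeneousPoly, Nat.cast_zero, mul_zero, zero_mul, add_zero] at this
  exact this

theorem conesLIntegral_eq_coeffSum {N : ℕ} (hN : 0 < N) {f g : FormPair}
    {L : List WeightedCone} {n : ℕ} (h : coeffSum N f g L = some n) :
    conesLIntegral (fun y => ENNReal.ofReal (Real.exp (-(y 0 / N)) *
      (f.toLin y ^ 2 * g.toLin y ^ 2))) L = 4 * n := by
  induction L generalizing n with
  | nil => obtain rfl := Option.some.inj (h : some 0 = some n); simp [conesLIntegral]
  | cons S L ih =>
    have h' : (isAdmissible N f g S.gens).rec none ((coeffSum N f g L).rec none fun s =>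
      some (Nat.add (Nat.mul S.weight (homogeneousCoeff f g S.gens)) s)) = some n := h
    cases hS : isAdmissible N f g S.gens with
    | false => rw [hS] at h'; cases h'
    | true =>
      cases hL : coeffSum N f g L with
      | none => rw [hS, hL] at h'; cases h'
      | some s =>
        rw [hS, hL] at h'
        obtain rfl := Option.some.inj h'
        have e := coneLIntegral_eq_homogeneousCoeff hN hS
        have e' := ih hL
        simp only [conesLIntegral, List.map_cons, List.sum_cons] at e' ⊢
        rw [e, e']
        simp only [Nat.add_eq, Nat.mul_eq]
        push_cast
        ring

/-! ### Products and sums of truncated squares. -/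

namespace TruncatedSquare

/-- The value of the square of the form, if all the cuts are positive. -/
noncomputable def truncated (t : TruncatedSquare) (y : Fin 5 → ℝ) : ℝ :=
  open Classical in if ∀ f ∈ t.cuts, 0 < f.toLin y then t.form.toLin y ^ 2 else 0

theorem truncated_nonneg (t : TruncatedSquare) (y : Fin 5 → ℝ) : 0 ≤ t.truncated y := by
  unfold truncated
  split_ifs <;> positivity

theorem measurable_truncated (t : TruncatedSquare) : Measurable t.truncated := by
  unfold truncated
  refine Measurable.ite ?_ (t.form.measurable_toLin.pow_const 2) measurable_const
  have : {y | ∀ f ∈ t.cuts, 0 < f.toLin y} = ⋂ f ∈ {f | f ∈ t.cuts}, {y | 0 < f.toLin y} := by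
    ext; simp
  rw [this]
  exact MeasurableSet.biInter (List.finite_toSet t.cuts).countable fun f _ =>
    measurableSet_lt measurable_const f.measurable_toLin

/-- The value of the sum of several truncated squares. -/
noncomputable def eval (T : List TruncatedSquare) (y : Fin 5 → ℝ) : ℝ :=
  (T.map fun t => (t.coeff : ℝ) * t.truncated y).sum

end TruncatedSquare

theorem restrictAllPos_apply (cuts : List FormPair) (φ : (Fin 5 → ℝ) → ℝ≥0∞) (y : Fin 5 → ℝ) :
    restrictAllPos cuts φ y = open Classical in if ∀ f ∈ cuts, 0 < f.toLin y then φ y else 0 := by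
  induction cuts with
  | nil => simp [restrictAllPos]
  | cons f cuts ih =>
    have : restrictAllPos (f :: cuts) φ y = restrictPos f (restrictAllPos cuts φ) y := rfl
    rw [this]
    unfold restrictPos
    by_cases hf : 0 < f.toLin y <;> simp [Set.indicator, hf, ih]

/-- The product of two truncated squares, with an exponential weight. -/
noncomputable def weightedProduct (N : ℕ) (s t : TruncatedSquare) (y : Fin 5 → ℝ) : ℝ≥0∞ :=
  ENNReal.ofReal (Real.exp (-(y 0 / N)) * (s.truncated y * t.truncated y))

theorem measurable_weightedProduct (N : ℕ) (s t : TruncatedSquare) :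
    Measurable (weightedProduct N s t) := by
  have := s.measurable_truncated
  have := t.measurable_truncated
  unfold weightedProduct
  fun_prop

theorem weightedProduct_comm (N : ℕ) (s t : TruncatedSquare) :
    weightedProduct N s t = weightedProduct N t s := by
  funext y
  rw [weightedProduct, weightedProduct, mul_comm (s.truncated y)]

theorem weightedProduct_eq (N : ℕ) (s t : TruncatedSquare) :
    weightedProduct N s t = restrictAllPos s.cuts (restrictAllPos t.cuts fun y =>
      ENNReal.ofReal (Real.exp (-(y 0 / N)) * (s.form.toLin y ^ 2 * t.form.toLin y ^ 2))) := by
  funext y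
  rw [restrictAllPos_apply, restrictAllPos_apply, weightedProduct, TruncatedSquare.truncated,
    TruncatedSquare.truncated]
  split_ifs <;> simp

/-- The cuts of `s` come first, so that one restricted list of cones serves a whole row of products;
then the cuts of `t` are applied. -/
theorem conesLIntegral_eq_pairValue {N : ℕ} (hN : 0 < N) {s t : TruncatedSquare}
    {L : List WeightedCone} {n : ℕ}
    (h : pairValue N (restrictCones N s.cuts (some L)) s t = some n) :
    conesLIntegral (weightedProduct N s t) L = 4 * n := by
  have hm : Measurable fun y : Fin 5 → ℝ =>
      ENNReal.ofReal (Real.exp (-(y 0 / N)) * (s.form.toLin y ^ 2 * t.form.toLin y ^ 2)) := by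
    have := s.form.measurable_toLin
    have := t.form.measurable_toLin
    fun_prop
  rw [weightedProduct_eq]
  cases h1 : restrictCones N s.cuts (some L) with
  | none =>
    rw [h1] at h
    have h' : (restrictCones N t.cuts none).rec none (coeffSum N s.form t.form) = some n := h
    rw [restrictCones_none] at h'
    cases h'
  | some M =>
    rw [h1] at h
    have h' : (restrictCones N t.cuts (some M)).rec none (coeffSum N s.form t.form) = some n := h
    rw [conesLIntegral_restrictAllPos (measurable_restrictAllPos _ hm) h1]
    cases h2 : restrictCones N t.cuts (some M) with
    | none => rw [h2] at h'; cases h'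
    | some M' =>
      rw [h2] at h'
      rw [conesLIntegral_restrictAllPos hm h2]
      exact conesLIntegral_eq_coeffSum hN h'

theorem rowValue_eq {N : ℕ} (hN : 0 < N) {s : TruncatedSquare} {T : List TruncatedSquare}
    {L : List WeightedCone} {z : ℤ}
    (h : rowValue N (restrictCones N s.cuts (some L)) s T = some z) :
    (∀ t ∈ T, conesLIntegral (weightedProduct N s t) L ≠ ∞) ∧ (4 * z : ℝ) =
      (T.map fun t => (t.coeff : ℝ) * (conesLIntegral (weightedProduct N s t) L).toReal).sum := by
  induction T generalizing z with
  | nil =>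
    obtain rfl := Option.some.inj (h : some 0 = some z)
    simp
  | cons t T ih =>
    have h' : ((pairValue N (restrictCones N s.cuts (some L)) s t).rec none fun a =>
      (rowValue N (restrictCones N s.cuts (some L)) s T).rec none fun b =>
        some (t.coeff * a + b) : Option ℤ) = some z := h
    cases h1 : pairValue N (restrictCones N s.cuts (some L)) s t with
    | none => rw [h1] at h'; cases h'
    | some a =>
      cases h2 : rowValue N (restrictCones N s.cuts (some L)) s T with
      | none => rw [h1, h2] at h'; cases h'
      | some b =>
        rw [h1, h2] at h'
        obtain rfl := Option.some.inj h'
        obtain ⟨h3, h4⟩ := ih h2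
        have h5 := conesLIntegral_eq_pairValue hN h1
        constructor
        · intro u hu
          rcases List.mem_cons.1 hu with rfl | hu
          · rw [h5]; finiteness
          · exact h3 u hu
        · rw [List.map_cons, List.sum_cons, ← h4, h5]
          simp
          ring

/-- Finiteness is carried along because the identity uses `toReal`; it later provides integrability.
-/
theorem squareValue_eq {N : ℕ} (hN : 0 < N) {T : List TruncatedSquare} {L : List WeightedCone}
    {z : ℤ} (h : squareValue N L T = some z) :
    (∀ s ∈ T, ∀ t ∈ T, conesLIntegral (weightedProduct N s t) L ≠ ∞) ∧ (4 * z : ℝ) =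
      (T.map fun s => (T.map fun t => (s.coeff : ℝ) * t.coeff *
        (conesLIntegral (weightedProduct N s t) L).toReal).sum).sum := by
  induction T generalizing z with
  | nil =>
    obtain rfl := Option.some.inj (h : some 0 = some z)
    simp
  | cons t T ih =>
    have h' : ((rowValue N (restrictCones N t.cuts (some L)) t [t]).rec none fun a =>
      (rowValue N (restrictCones N t.cuts (some L)) t T).rec none fun b =>
        (squareValue N L T).rec none fun c => some (t.coeff * (a + 2 * b) + c) : Option ℤ) =
          some z := h
    cases h1 : rowValue N (restrictCones N t.cuts (some L)) t [t] with
    | none => rw [h1] at h'; cases h'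
    | some a =>
      cases h2 : rowValue N (restrictCones N t.cuts (some L)) t T with
      | none => rw [h1, h2] at h'; cases h'
      | some b =>
        cases h3 : squareValue N L T with
        | none => rw [h1, h2, h3] at h'; cases h'
        | some c =>
          rw [h1, h2, h3] at h'
          obtain rfl := Option.some.inj h'
          obtain ⟨f1, e1⟩ := rowValue_eq hN h1
          obtain ⟨f2, e2⟩ := rowValue_eq hN h2
          obtain ⟨f3, e3⟩ := ih h3
          constructor
          · intro u hu w hw
            rcases List.mem_cons.1 hu with hu | hu <;> rcases List.mem_cons.1 hw with hw | hw
            · rw [hu, hw]; exact f1 _ (by simp)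
            · rw [hu]; exact f2 _ hw
            · rw [hw, weightedProduct_comm]; exact f2 _ hu
            · exact f3 _ hu _ hw
          · simp only [List.map_cons, List.sum_cons, List.sum_map_add, List.map_nil, List.sum_nil]
              at e1 ⊢
            rw [← e3]
            have e4 : (T.map fun u => (t.coeff : ℝ) * u.coeff *
                (conesLIntegral (weightedProduct N t u) L).toReal).sum = t.coeff * (4 * b) := by
              rw [e2, ← List.sum_map_mul_left]
              simp only [mul_assoc]
            have e5 : (T.map fun u => (u.coeff : ℝ) * t.coeff *
                (conesLIntegral (weightedProduct N u t) L).toReal).sum = t.coeff * (4 * b) := by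
              rw [← e4]
              simp only [weightedProduct_comm N _ t, mul_comm (t.coeff : ℝ)]
            rw [e4, e5]
            have e6 : (t.coeff : ℝ) * t.coeff * (conesLIntegral (weightedProduct N t t) L).toReal =
                t.coeff * (4 * a) := by rw [e1]; ring
            rw [e6]
            push_cast
            ring

/-! ### From integrals over regions of ℝ⁴ to integrals over cones in ℝ⁵. -/

/-- The open cone in the plane that is bounded by the rays through `(1, 2)` and `(2, 1)`. -/
def planeCone : Set (ℝ × ℝ) := {z | z.1 < 2 * z.2 ∧ z.2 < 2 * z.1}

theorem measurableSet_planeCone : MeasurableSet planeCone :=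
  (measurableSet_lt (f := fun z : ℝ × ℝ => z.1) (g := fun z => 2 * z.2) (by fun_prop)
    (by fun_prop)).inter (measurableSet_lt (f := fun z : ℝ × ℝ => z.2) (g := fun z => 2 * z.1)
    (by fun_prop) (by fun_prop))

/-- Linear change of variables to the generators `N * (1, 2)` and `N * (2, 1)`, whose determinant
has absolute value `3 * N ^ 2`. -/
theorem setLIntegral_planeCone (f : ℝ × ℝ → ℝ≥0∞) (hf : Measurable f) {N : ℝ} (hN : 0 < N) :
    ∫⁻ z in planeCone, f z = ENNReal.ofReal (3 * N ^ 2) * ∫⁻ s in Set.Ioi (0 : ℝ),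
      ∫⁻ t in Set.Ioi (0 : ℝ), f (s * N + t * (2 * N), s * (2 * N) + t * N) := by
  set A : ℝ × ℝ →L[ℝ] ℝ × ℝ := LinearMap.toContinuousLinearMap
    (Matrix.toLin (Module.Basis.finTwoProd ℝ) (Module.Basis.finTwoProd ℝ) !![N, 2 * N; 2 * N, N])
    with hA
  have hAa : ∀ z, A z = (z.1 * N + z.2 * (2 * N), z.1 * (2 * N) + z.2 * N) := by
    intro z
    simp [hA, Matrix.toLin_finTwoProd_apply, mul_comm]
  have hdet : |A.det| = 3 * N ^ 2 := by
    have : A.det = -(3 * N ^ 2) := by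
      simp only [hA, LinearMap.det_toContinuousLinearMap, LinearMap.det_toLin, Matrix.det_fin_two_of]
      ring
    rw [this, abs_neg, abs_of_pos (by positivity)]
  have himg : A '' (Set.Ioi 0 ×ˢ Set.Ioi 0) = planeCone := by
    ext z
    simp only [Set.mem_image, Set.mem_prod, Set.mem_Ioi, planeCone, Set.mem_ofPred_eq]
    constructor
    · rintro ⟨w, ⟨h1, h2⟩, rfl⟩
      rw [hAa]
      have := mul_pos h1 hN
      have := mul_pos h2 hN
      constructor <;> dsimp only <;> nlinarith
    · rintro ⟨h1, h2⟩
      refine ⟨((2 * z.2 - z.1) / (3 * N), (2 * z.1 - z.2) / (3 * N)), ⟨?_, ?_⟩, ?_⟩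
      · exact div_pos (by linarith) (by positivity)
      · exact div_pos (by linarith) (by positivity)
      · rw [hAa]
        ext <;> dsimp only <;> field_simp <;> ring
  have hinj : Set.InjOn A (Set.Ioi 0 ×ˢ Set.Ioi 0) := by
    intro z _ w _ h
    rw [hAa, hAa] at h
    obtain ⟨h1, h2⟩ := Prod.mk.inj h
    have h3 : N * (z.1 - w.1) = 0 := by linarith
    have h4 : N * (z.2 - w.2) = 0 := by linarith
    ext
    · linarith [(mul_eq_zero.1 h3).resolve_left hN.ne']
    · linarith [(mul_eq_zero.1 h4).resolve_left hN.ne']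
  rw [← himg, lintegral_image_eq_lintegral_abs_det_fderiv_mul volume
    (measurableSet_Ioi.prod measurableSet_Ioi) (fun z _ => A.hasFDerivWithinAt) hinj, hdet,
    lintegral_const_mul' _ _ ENNReal.ofReal_ne_top, Measure.volume_eq_prod,
    ← Measure.prod_restrict, lintegral_prod]
  · simp only [hAa]
  · exact (hf.comp A.continuous.measurable).aemeasurable

theorem setLIntegral_planeCone_smul (f : ℝ × ℝ → ℝ≥0∞) {x : ℝ} (hx : 0 < x) :
    ∫⁻ z in planeCone, f z = ENNReal.ofReal (x ^ 2) * ∫⁻ z in planeCone, f (x • z) := by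
  rw [← lintegral_indicator measurableSet_planeCone, ← lintegral_indicator measurableSet_planeCone]
  have h := Measure.map_addHaar_smul (volume : Measure (ℝ × ℝ)) hx.ne'
  have hfr : Module.finrank ℝ (ℝ × ℝ) = 2 := by simp
  have h2 := lintegral_map_equiv (μ := (volume : Measure (ℝ × ℝ))) (planeCone.indicator f)
    (Homeomorph.smulOfNeZero x hx.ne').toMeasurableEquiv
  have h3 : (⇑(Homeomorph.smulOfNeZero x hx.ne' : ℝ × ℝ ≃ₜ ℝ × ℝ).toMeasurableEquiv) =
    (fun z => x • z) := by ext z <;> simp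
  rw [h3, h, lintegral_smul_measure, hfr, abs_of_pos (by positivity)] at h2
  have h4 : ∀ z, planeCone.indicator f (x • z) = planeCone.indicator (fun z => f (x • z)) z := by
    intro z
    have : x • z ∈ planeCone ↔ z ∈ planeCone := by
      simp only [planeCone, Set.mem_ofPred_eq, Prod.smul_fst, Prod.smul_snd, smul_eq_mul,
        mul_left_comm _ x, mul_lt_mul_iff_right₀ hx]
    by_cases hz : z ∈ planeCone <;> simp [Set.indicator, this, hz]
  simp only [h4] at h2
  rw [← h2, smul_eq_mul, ← mul_assoc, ← ENNReal.ofReal_mul (by positivity),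
    mul_inv_cancel₀ (by positivity), ENNReal.ofReal_one, one_mul]

/-- Two points of the plane, as a point of the affine chart of `ℝ⁵` where the zeroth coordinate
is `1`. -/
def affinePoint (a c : ℝ × ℝ) : Fin 5 → ℝ := ![1, a.1, a.2, c.1, c.2]

theorem measurable_affinePoint : Measurable fun z : (ℝ × ℝ) × (ℝ × ℝ) => affinePoint z.1 z.2 := by
  rw [measurable_pi_iff]
  intro i
  fin_cases i <;> simp [affinePoint] <;> fun_prop

theorem TruncatedSquare.truncated_smul (t : TruncatedSquare) {x : ℝ} (hx : 0 < x)
    (y : Fin 5 → ℝ) : t.truncated (x • y) = x ^ 2 * t.truncated y := by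
  unfold truncated
  simp only [map_smul, smul_eq_mul, mul_pos_iff_of_pos_left hx]
  split_ifs
  · ring
  · simp

/-- The cone over the product of two plane cones, with a weight. -/
def startCone (N : ℕ) : WeightedCone where
  -- The absolute determinant of the generators, `N * (3 * N ^ 2) ^ 2`.
  weight := 9 * N ^ 5
  gens := [⟨N, 0, 0, 0, 0⟩, ⟨0, N, 2 * N, 0, 0⟩, ⟨0, 2 * N, N, 0, 0⟩, ⟨0, 0, 0, N, 2 * N⟩,
    ⟨0, 0, 0, 2 * N, N⟩]

/-- The slice at zeroth coordinate `t * N` is the unit slice scaled by `t * N`. The two plane cones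
contribute the Jacobian `(t * N) ^ 4` and `W` contributes another `(t * N) ^ 4`, so the integral
over `t` is `N ^ 8 * 8!`. The ninth factor `N` comes from the generator in the zeroth direction. -/
theorem conesLIntegral_startCone {N : ℕ} (hN : 0 < N) {W : (Fin 5 → ℝ) → ℝ≥0∞} (hW : Measurable W)
    (hhom : ∀ x : ℝ, 0 < x → ∀ y, W (x • y) = ENNReal.ofReal (x ^ 4) * W y) :
    conesLIntegral (fun y => ENNReal.ofReal (Real.exp (-(y 0 / N))) * W y) [startCone N] =
      ENNReal.ofReal (N ^ 9 * (8).factorial) *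
        ∫⁻ a in planeCone, ∫⁻ c in planeCone, W (affinePoint a c) := by
  have hN' : (0 : ℝ) < N := by exact_mod_cast hN
  set φ : (Fin 5 → ℝ) → ℝ≥0∞ := fun y => ENNReal.ofReal (Real.exp (-(y 0 / N))) * W y with hφ
  have hφm : Measurable φ := by fun_prop
  have hpt : Measurable fun z : ℝ × (ℝ × ℝ) × (ℝ × ℝ) =>
      (![z.1, z.2.1.1, z.2.1.2, z.2.2.1, z.2.2.2] : Fin 5 → ℝ) := by
    rw [measurable_pi_iff]
    intro i
    fin_cases i <;> simp <;> fun_prop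
  set C := ENNReal.ofReal (3 * (N : ℝ) ^ 2) with hC
  have hC0 : C ≠ 0 := by rw [hC]; simp only [ne_eq, ENNReal.ofReal_eq_zero, not_le]; positivity
  have hCt : C ≠ ∞ := ENNReal.ofReal_ne_top
  have step1 : C * (C * coneLIntegral φ ((startCone N).gens.map NatPoint.toVec) 0) =
      ∫⁻ t in Set.Ioi (0 : ℝ), ∫⁻ a in planeCone, ∫⁻ c in planeCone,
        φ ![t * N, a.1, a.2, c.1, c.2] := by
    have inner : ∀ (x : ℝ) (a : ℝ × ℝ), ∫⁻ c in planeCone, φ ![x, a.1, a.2, c.1, c.2] =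
        C * ∫⁻ s in Set.Ioi (0 : ℝ), ∫⁻ t in Set.Ioi (0 : ℝ),
          φ ![x, a.1, a.2, s * N + t * (2 * N), s * (2 * N) + t * N] := fun x a =>
      setLIntegral_planeCone (fun c => φ ![x, a.1, a.2, c.1, c.2]) (hφm.comp (hpt.comp
        (by fun_prop : Measurable fun c : ℝ × ℝ => (x, a, c)))) hN'
    have outer : ∀ x : ℝ, ∫⁻ a in planeCone, ∫⁻ c in planeCone, φ ![x, a.1, a.2, c.1, c.2] =
        C * ∫⁻ s in Set.Ioi (0 : ℝ), ∫⁻ t in Set.Ioi (0 : ℝ), ∫⁻ c in planeCone,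
          φ ![x, s * N + t * (2 * N), s * (2 * N) + t * N, c.1, c.2] := by
      intro x
      refine setLIntegral_planeCone (fun a => ∫⁻ c in planeCone, φ ![x, a.1, a.2, c.1, c.2]) ?_ hN'
      have : Measurable (Function.uncurry fun a c : ℝ × ℝ => φ ![x, a.1, a.2, c.1, c.2]) :=
        hφm.comp (hpt.comp (by fun_prop : Measurable fun z : (ℝ × ℝ) × (ℝ × ℝ) => (x, z.1, z.2)))
      exact Measurable.lintegral_prod_right this
    have inner' : ∀ x p q : ℝ, ∫⁻ c in planeCone, φ ![x, p, q, c.1, c.2] =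
        C * ∫⁻ s in Set.Ioi (0 : ℝ), ∫⁻ t in Set.Ioi (0 : ℝ),
          φ ![x, p, q, s * N + t * (2 * N), s * (2 * N) + t * N] := fun x p q => inner x (p, q)
    simp only [outer]
    simp only [inner', lintegral_const_mul' C _ hCt]
    congr 2
    simp only [startCone, List.map_cons, List.map_nil, coneLIntegral]
    refine lintegral_congr fun t0 => lintegral_congr fun t1 => lintegral_congr fun t2 =>
      lintegral_congr fun t3 => lintegral_congr fun t4 => congrArg φ ?_
    ext i
    fin_cases i <;> simp [NatPoint.toVec]
  have step2 : ∀ t ∈ Set.Ioi (0 : ℝ), ∫⁻ a in planeCone, ∫⁻ c in planeCone,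
        φ ![t * N, a.1, a.2, c.1, c.2] = ENNReal.ofReal (N ^ 8) *
        (ENNReal.ofReal (t ^ 8 * Real.exp (-t)) *
          ∫⁻ a in planeCone, ∫⁻ c in planeCone, W (affinePoint a c)) := by
    intro t ht
    have ht' : 0 < t := ht
    have hx : 0 < t * N := by positivity
    rw [setLIntegral_planeCone_smul _ hx]
    have e : ∀ a : ℝ × ℝ, ∫⁻ c in planeCone,
        φ ![t * N, ((t * N) • a).1, ((t * N) • a).2, c.1, c.2] =
        ENNReal.ofReal ((t * N) ^ 2) * (ENNReal.ofReal (Real.exp (-t) * (t * N) ^ 4) *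
          ∫⁻ c in planeCone, W (affinePoint a c)) := by
      intro a
      rw [setLIntegral_planeCone_smul _ hx]
      congr 1
      rw [← lintegral_const_mul' _ _ ENNReal.ofReal_ne_top]
      refine lintegral_congr fun c => ?_
      have e1 : (![t * N, ((t * N) • a).1, ((t * N) • a).2, ((t * N) • c).1,
          ((t * N) • c).2] : Fin 5 → ℝ) = (t * N) • affinePoint a c := by
        ext i
        fin_cases i <;> simp [affinePoint]
      have e2 : ((t * N) • affinePoint a c) 0 / N = t := by
        simp [affinePoint, hN'.ne']
      rw [e1, hφ]
      dsimp only
      rw [e2, hhom _ hx, ← mul_assoc, ENNReal.ofReal_mul (Real.exp_pos _).le]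
    simp only [e, lintegral_const_mul' _ _ ENNReal.ofReal_ne_top]
    rw [← mul_assoc, ← mul_assoc, ← mul_assoc, ← ENNReal.ofReal_mul (by positivity),
      ← ENNReal.ofReal_mul (by positivity), ← ENNReal.ofReal_mul (by positivity)]
    congr 2
    ring
  have step3 : ∫⁻ t in Set.Ioi (0 : ℝ), ENNReal.ofReal (t ^ 8 * Real.exp (-t)) =
      ENNReal.ofReal ((8).factorial) := by
    rw [← ofReal_integral_eq_lintegral_ofReal (integrableOn_pow_mul_exp_neg 8),
      integral_pow_mul_exp_neg]
    filter_upwards [ae_restrict_mem measurableSet_Ioi] with t ht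
    have : (0 : ℝ) < t := ht
    positivity
  rw [setLIntegral_congr_fun measurableSet_Ioi step2, lintegral_const_mul' _ _ ENNReal.ofReal_ne_top,
    lintegral_mul_const _ (by fun_prop), step3] at step1
  refine (ENNReal.mul_right_inj hC0 hCt).1 ((ENNReal.mul_right_inj hC0 hCt).1 ?_)
  simp only [conesLIntegral, List.map_cons, List.map_nil, List.sum_cons, List.sum_nil, add_zero]
  rw [mul_left_comm C ((startCone N).weight : ℝ≥0∞), mul_left_comm C ((startCone N).weight : ℝ≥0∞),
    step1, ← mul_assoc, ← mul_assoc, ← mul_assoc, ← mul_assoc]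
  congr 1
  rw [hC, ← ENNReal.ofReal_natCast, ← ENNReal.ofReal_mul (by positivity),
    ← ENNReal.ofReal_mul (by positivity), ← ENNReal.ofReal_mul (by positivity),
    ← ENNReal.ofReal_mul (by positivity)]
  congr 1
  simp only [startCone]
  push_cast
  ring

/-- Subdivide simplicial cones along several hyperplanes. -/
noncomputable def refineCones (N : ℕ) (fs : List FormPair) (L : Option (List WeightedCone)) :
    Option (List WeightedCone) :=
  fs.rec (fun L => L) (fun f _ ih L => ih (L.rec none (cutCones N true f))) L

theorem refineCones_none (N : ℕ) (fs : List FormPair) : refineCones N fs none = none := by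
  induction fs with
  | nil => rfl
  | cons f fs ih => exact ih

theorem conesLIntegral_refineCones {φ : (Fin 5 → ℝ) → ℝ≥0∞} (hφ : Measurable φ)
    {fs : List FormPair} {N : ℕ} {L L' : List WeightedCone}
    (h : refineCones N fs (some L) = some L') : conesLIntegral φ L = conesLIntegral φ L' := by
  induction fs generalizing L with
  | nil => obtain rfl := Option.some.inj (h : some L = some L'); rfl
  | cons f fs ih =>
    have h' : refineCones N fs (cutCones N true f L) = some L' := h
    cases hc : cutCones N true f L with
    | none => rw [hc, refineCones_none] at h'; cases h'
    | some M =>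
      rw [hc] at h'
      rw [← ih h', conesLIntegral_cutCones hφ (Or.inl rfl) hc]

/-- The pairs of points in a plane cone such that several affine functions are positive. -/
def pairRegion (cuts : List FormPair) : Set ((ℝ × ℝ) × (ℝ × ℝ)) :=
  {p | (p.1 ∈ planeCone ∧ p.2 ∈ planeCone) ∧ ∀ f ∈ cuts, 0 < f.toLin (affinePoint p.1 p.2)}

theorem measurableSet_pairRegion (cuts : List FormPair) : MeasurableSet (pairRegion cuts) := by
  have h2 : MeasurableSet {p : (ℝ × ℝ) × (ℝ × ℝ) |
      ∀ f ∈ cuts, 0 < f.toLin (affinePoint p.1 p.2)} := by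
    have : {p : (ℝ × ℝ) × (ℝ × ℝ) | ∀ f ∈ cuts, 0 < f.toLin (affinePoint p.1 p.2)} =
        ⋂ f ∈ {f | f ∈ cuts}, {p | 0 < f.toLin (affinePoint p.1 p.2)} := by
      ext; simp
    rw [this]
    exact MeasurableSet.biInter (List.finite_toSet cuts).countable fun f _ =>
      measurableSet_lt measurable_const (f.measurable_toLin.comp measurable_affinePoint)
  exact ((measurable_fst measurableSet_planeCone).inter
    (measurable_snd measurableSet_planeCone)).inter h2

/-- The cuts are absorbed into the integrand. It stays homogeneous of degree 4, since the sign of a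
linear form is unchanged by positive scaling. -/
theorem conesLIntegral_weightedProduct {N : ℕ} (hN : 0 < N) {fs cuts : List FormPair}
    {L : List WeightedCone}
    (h : restrictCones N cuts (refineCones N fs (some [startCone N])) = some L)
    (s t : TruncatedSquare) :
    conesLIntegral (weightedProduct N s t) L = ENNReal.ofReal (N ^ 9 * (8).factorial) *
      ∫⁻ p in pairRegion cuts, ENNReal.ofReal
        (s.truncated (affinePoint p.1 p.2) * t.truncated (affinePoint p.1 p.2)) := by
  set V : (Fin 5 → ℝ) → ℝ≥0∞ := fun y => ENNReal.ofReal (s.truncated y * t.truncated y) with hV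
  have hVm : Measurable V := by
    have := s.measurable_truncated
    have := t.measurable_truncated
    fun_prop
  set W : (Fin 5 → ℝ) → ℝ≥0∞ := restrictAllPos cuts V with hW
  have hWm : Measurable W := measurable_restrictAllPos cuts hVm
  have hwp := measurable_weightedProduct N s t
  cases hM : refineCones N fs (some [startCone N]) with
  | none => rw [hM, restrictCones_none] at h; cases h
  | some M =>
    rw [hM] at h
    rw [← conesLIntegral_restrictAllPos hwp h,
      ← conesLIntegral_refineCones (measurable_restrictAllPos cuts hwp) hM]
    have e : restrictAllPos cuts (weightedProduct N s t) =
        fun y => ENNReal.ofReal (Real.exp (-(y 0 / N))) * W y := by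
      funext y
      rw [hW, restrictAllPos_apply, restrictAllPos_apply]
      split_ifs
      · rw [weightedProduct, ENNReal.ofReal_mul (Real.exp_pos _).le]
      · simp
    have hhom : ∀ x : ℝ, 0 < x → ∀ y, W (x • y) = ENNReal.ofReal (x ^ 4) * W y := by
      intro x hx y
      rw [hW, restrictAllPos_apply, restrictAllPos_apply]
      simp only [map_smul, smul_eq_mul, mul_pos_iff_of_pos_left hx, hV,
        TruncatedSquare.truncated_smul _ hx]
      split_ifs
      · rw [← ENNReal.ofReal_mul (by positivity)]
        congr 1
        ring
      · simp
    rw [e, conesLIntegral_startCone hN hWm hhom]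
    congr 1
    have hWa : Measurable fun p : (ℝ × ℝ) × (ℝ × ℝ) => W (affinePoint p.1 p.2) :=
      hWm.comp measurable_affinePoint
    rw [← lintegral_indicator (measurableSet_pairRegion cuts), Measure.volume_eq_prod,
      ← lintegral_prod (fun p : (ℝ × ℝ) × (ℝ × ℝ) => W (affinePoint p.1 p.2)) hWa.aemeasurable,
      Measure.prod_restrict, ← lintegral_indicator
        (measurableSet_planeCone.prod measurableSet_planeCone)]
    refine lintegral_congr fun p => ?_
    by_cases hp : p ∈ planeCone ×ˢ planeCone
    · have hp' : p.1 ∈ planeCone ∧ p.2 ∈ planeCone := hp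
      rw [Set.indicator_of_mem hp, hW, restrictAllPos_apply]
      by_cases hc : ∀ f ∈ cuts, 0 < f.toLin (affinePoint p.1 p.2)
      · rw [if_pos hc, Set.indicator_of_mem (show p ∈ pairRegion cuts from ⟨hp', hc⟩)]
      · rw [if_neg hc, Set.indicator_of_notMem (show p ∉ pairRegion cuts from fun h => hc h.2)]
    · rw [Set.indicator_of_notMem hp, Set.indicator_of_notMem
        (show p ∉ pairRegion cuts from fun h => hp h.1)]

theorem integral_list_sum {α ι : Type*} [MeasurableSpace α] {μ : Measure α} {f : ι → α → ℝ}
    {l : List ι} (h : ∀ i ∈ l, Integrable (f i) μ) :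
    Integrable (fun x => (l.map fun i => f i x).sum) μ ∧
      ∫ x, (l.map fun i => f i x).sum ∂μ = (l.map fun i => ∫ x, f i x ∂μ).sum := by
  induction l with
  | nil => simp
  | cons i l ih =>
    obtain ⟨h1, h2⟩ := ih fun j hj => h j (by simp [hj])
    have hi := h i (by simp)
    simp only [List.map_cons, List.sum_cons]
    exact ⟨hi.add h1, by rw [integral_add hi h1, h2]⟩

/-- The integral of the square of a sum of truncated squares, with a certificate that is found by
evaluating `squareValue`. -/
theorem integral_eval_sq {N : ℕ} (hN : 0 < N) {fs cuts : List FormPair} {T : List TruncatedSquare}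
    {z : ℤ} (h : ((restrictCones N cuts (refineCones N fs (some [startCone N]))).rec none fun L =>
      squareValue N L T : Option ℤ) = some z) :
    IntegrableOn (fun p => TruncatedSquare.eval T (affinePoint p.1 p.2) ^ 2) (pairRegion cuts) ∧
    ∫ p in pairRegion cuts, TruncatedSquare.eval T (affinePoint p.1 p.2) ^ 2 =
      4 * z / (N ^ 9 * (8).factorial) := by
  cases hL : restrictCones N cuts (refineCones N fs (some [startCone N])) with
  | none => rw [hL] at h; cases h
  | some L =>
    rw [hL] at h
    obtain ⟨hfin, hz⟩ := squareValue_eq hN (h : squareValue N L T = some z)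
    have hc : (0 : ℝ) < N ^ 9 * (8).factorial := by positivity
    set τ : TruncatedSquare → (ℝ × ℝ) × (ℝ × ℝ) → ℝ :=
      fun t p => t.truncated (affinePoint p.1 p.2) with hτ
    have hτm : ∀ t, Measurable (τ t) := fun t => t.measurable_truncated.comp measurable_affinePoint
    have hτ0 : ∀ t p, 0 ≤ τ t p := fun t p => t.truncated_nonneg _
    have hw : ∀ s t, conesLIntegral (weightedProduct N s t) L =
        ENNReal.ofReal (N ^ 9 * (8).factorial) *
          ∫⁻ p in pairRegion cuts, ENNReal.ofReal (τ s p * τ t p) :=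
      conesLIntegral_weightedProduct hN hL
    -- Integrability needs no separate bound: the evaluated cone integrals are finite.
    have hint : ∀ s ∈ T, ∀ t ∈ T, IntegrableOn (fun p => τ s p * τ t p) (pairRegion cuts) := by
      intro s hs t ht
      refine (lintegral_ofReal_ne_top_iff_integrable
        ((hτm s).mul (hτm t)).aestronglyMeasurable
        (Filter.Eventually.of_forall fun p => mul_nonneg (hτ0 s p) (hτ0 t p))).1 fun hi => ?_
      refine hfin s hs t ht ?_
      have hi' : ∫⁻ p in pairRegion cuts, ENNReal.ofReal (τ s p * τ t p) = ∞ := hi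
      rw [hw, hi', ENNReal.mul_top (ENNReal.ofReal_pos.2 hc).ne']
    have hI : ∀ s ∈ T, ∀ t ∈ T, (conesLIntegral (weightedProduct N s t) L).toReal =
        N ^ 9 * (8).factorial * ∫ p in pairRegion cuts, τ s p * τ t p := by
      intro s hs t ht
      rw [hw, ENNReal.toReal_mul, ENNReal.toReal_ofReal hc.le,
        integral_eq_lintegral_of_nonneg_ae
          (Filter.Eventually.of_forall fun p => mul_nonneg (hτ0 s p) (hτ0 t p))
          ((hτm s).mul (hτm t)).aestronglyMeasurable]
    have hsq : (fun p : (ℝ × ℝ) × (ℝ × ℝ) => TruncatedSquare.eval T (affinePoint p.1 p.2) ^ 2) =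
        fun p => (T.map fun s => (T.map fun t =>
          (s.coeff : ℝ) * t.coeff * (τ s p * τ t p)).sum).sum := by
      funext p
      have e : ∀ s : TruncatedSquare, (T.map fun t =>
          (s.coeff : ℝ) * t.coeff * (τ s p * τ t p)).sum = (s.coeff * τ s p) *
            TruncatedSquare.eval T (affinePoint p.1 p.2) := by
        intro s
        rw [TruncatedSquare.eval, ← List.sum_map_mul_left]
        congr 1
        refine List.map_congr_left fun t _ => ?_
        simp only [hτ]
        ring
      simp only [e]
      rw [List.sum_map_mul_right, sq]
      rfl
    have h1 : ∀ s ∈ T, Integrable (fun p => (T.map fun t =>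
          (s.coeff : ℝ) * t.coeff * (τ s p * τ t p)).sum) (volume.restrict (pairRegion cuts)) ∧
        ∫ p in pairRegion cuts, (T.map fun t =>
          (s.coeff : ℝ) * t.coeff * (τ s p * τ t p)).sum =
        (T.map fun t => ∫ p in pairRegion cuts, (s.coeff : ℝ) * t.coeff * (τ s p * τ t p)).sum :=
      fun s hs => integral_list_sum fun t ht => (hint s hs t ht).const_mul _
    have h2 := integral_list_sum fun s hs => (h1 s hs).1
    rw [hsq]
    refine ⟨h2.1, h2.2.trans ?_⟩
    rw [eq_div_iff hc.ne', hz, ← List.sum_map_mul_right]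
    congr 1
    refine List.map_congr_left fun s hs => ?_
    rw [(h1 s hs).2, ← List.sum_map_mul_right]
    congr 1
    refine List.map_congr_left fun t ht => ?_
    rw [hI s hs t ht, integral_const_mul]
    ring

/-! ### The truncated squares of the problem and their exact evaluation. -/

/-- The bounds `P < 1` and `Q < 1` for two points `(P, Q)`, as affine functions. -/
def unitCuts : List FormPair := [
  ⟨⟨1, 0, 0, 0, 0⟩, ⟨0, 0, 1, 0, 0⟩⟩,
  ⟨⟨1, 0, 0, 0, 0⟩, ⟨0, 0, 0, 1, 0⟩⟩,
  ⟨⟨1, 0, 0, 0, 0⟩, ⟨0, 1, 0, 0, 0⟩⟩,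
  ⟨⟨1, 0, 0, 0, 0⟩, ⟨0, 0, 0, 0, 1⟩⟩]

/-- The function `Q - P` for the second and for the first of two points `(P, Q)`. -/
def diagonalForms : List FormPair := [
  ⟨⟨0, 0, 0, 0, 1⟩, ⟨0, 0, 0, 1, 0⟩⟩,
  ⟨⟨0, 0, 1, 0, 0⟩, ⟨0, 1, 0, 0, 0⟩⟩]

/-- The difference of the values of `Q - P` at two points `(P, Q)`. -/
def diagonalCut : FormPair := ⟨⟨0, 0, 1, 1, 0⟩, ⟨0, 1, 0, 0, 1⟩⟩

/-- Twice the conditional probability that two dice dominate a third one, as a sum of truncated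
squares, where the first of the two dice has the smaller median. -/
def commonDominanceTerms : List TruncatedSquare := [
  ⟨-3, [⟨⟨0, 1, 0, 0, 0⟩, ⟨0, 0, 0, 1, 0⟩⟩], ⟨⟨0, 1, 0, 0, 0⟩, ⟨0, 0, 0, 0, 0⟩⟩⟩,
  ⟨1, [⟨⟨0, 2, 0, 0, 0⟩, ⟨1, 0, 0, 0, 0⟩⟩, ⟨⟨0, 1, 0, 0, 0⟩, ⟨0, 0, 0, 1, 0⟩⟩], ⟨⟨0, 2, 0, 0, 0⟩, ⟨1, 0, 0, 0, 0⟩⟩⟩,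
  ⟨-3, [⟨⟨0, 0, 0, 1, 0⟩, ⟨0, 1, 0, 0, 0⟩⟩], ⟨⟨0, 0, 0, 1, 0⟩, ⟨0, 0, 0, 0, 0⟩⟩⟩,
  ⟨1, [⟨⟨0, 0, 0, 2, 0⟩, ⟨1, 0, 0, 0, 0⟩⟩, ⟨⟨0, 0, 0, 1, 0⟩, ⟨0, 1, 0, 0, 0⟩⟩], ⟨⟨0, 0, 0, 2, 0⟩, ⟨1, 0, 0, 0, 0⟩⟩⟩,
  -- This term and the next one come from the distribution of the median difference for the first
  -- die alone: with the assumed order of the medians, the corresponding term of the second die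
  -- cancels against the joint one.
  ⟨1, [], ⟨⟨1, 2, 0, 0, 0⟩, ⟨0, 0, 2, 0, 0⟩⟩⟩,
  ⟨-8, [⟨⟨0, 1, 0, 0, 0⟩, ⟨0, 0, 1, 0, 0⟩⟩], ⟨⟨0, 1, 0, 0, 0⟩, ⟨0, 0, 1, 0, 0⟩⟩⟩,
  ⟨3, [⟨⟨0, 0, 0, 0, 1⟩, ⟨0, 0, 1, 0, 0⟩⟩], ⟨⟨0, 0, 1, 0, 0⟩, ⟨0, 0, 0, 0, 0⟩⟩⟩,
  ⟨-1, [⟨⟨0, 0, 2, 0, 0⟩, ⟨1, 0, 0, 0, 0⟩⟩, ⟨⟨0, 0, 0, 0, 1⟩, ⟨0, 0, 1, 0, 0⟩⟩], ⟨⟨0, 0, 2, 0, 0⟩, ⟨1, 0, 0, 0, 0⟩⟩⟩,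
  ⟨3, [⟨⟨0, 0, 1, 0, 0⟩, ⟨0, 0, 0, 0, 1⟩⟩], ⟨⟨0, 0, 0, 0, 1⟩, ⟨0, 0, 0, 0, 0⟩⟩⟩,
  ⟨-1, [⟨⟨0, 0, 0, 0, 2⟩, ⟨1, 0, 0, 0, 0⟩⟩, ⟨⟨0, 0, 1, 0, 0⟩, ⟨0, 0, 0, 0, 1⟩⟩], ⟨⟨0, 0, 0, 0, 2⟩, ⟨1, 0, 0, 0, 0⟩⟩⟩,
  ⟨1, [⟨⟨0, 1, 0, 0, 2⟩, ⟨0, 0, 0, 2, 0⟩⟩], ⟨⟨0, 1, 0, 0, 2⟩, ⟨0, 0, 0, 2, 0⟩⟩⟩,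
  ⟨2, [⟨⟨0, 0, 0, 0, 1⟩, ⟨0, 1, 0, 1, 0⟩⟩], ⟨⟨0, 0, 0, 0, 1⟩, ⟨0, 1, 0, 1, 0⟩⟩⟩,
  ⟨-2, [⟨⟨0, 1, 0, 0, 1⟩, ⟨1, 0, 0, 1, 0⟩⟩], ⟨⟨0, 1, 0, 0, 1⟩, ⟨1, 0, 0, 1, 0⟩⟩⟩,
  ⟨1, [⟨⟨0, 0, 2, 1, 0⟩, ⟨0, 2, 0, 0, 0⟩⟩], ⟨⟨0, 0, 2, 1, 0⟩, ⟨0, 2, 0, 0, 0⟩⟩⟩,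
  ⟨2, [⟨⟨0, 0, 1, 0, 0⟩, ⟨0, 1, 0, 1, 0⟩⟩], ⟨⟨0, 0, 1, 0, 0⟩, ⟨0, 1, 0, 1, 0⟩⟩⟩,
  ⟨-2, [⟨⟨0, 0, 1, 1, 0⟩, ⟨1, 1, 0, 0, 0⟩⟩], ⟨⟨0, 0, 1, 1, 0⟩, ⟨1, 1, 0, 0, 0⟩⟩⟩,
  ⟨1, [⟨⟨0, 0, 1, 2, 0⟩, ⟨0, 0, 0, 0, 2⟩⟩], ⟨⟨0, 0, 1, 2, 0⟩, ⟨0, 0, 0, 0, 2⟩⟩⟩,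
  ⟨2, [⟨⟨0, 0, 0, 1, 0⟩, ⟨0, 0, 1, 0, 1⟩⟩], ⟨⟨0, 0, 0, 1, 0⟩, ⟨0, 0, 1, 0, 1⟩⟩⟩,
  ⟨-2, [⟨⟨0, 0, 1, 1, 0⟩, ⟨1, 0, 0, 0, 1⟩⟩], ⟨⟨0, 0, 1, 1, 0⟩, ⟨1, 0, 0, 0, 1⟩⟩⟩,
  ⟨1, [⟨⟨0, 2, 0, 0, 1⟩, ⟨0, 0, 2, 0, 0⟩⟩], ⟨⟨0, 2, 0, 0, 1⟩, ⟨0, 0, 2, 0, 0⟩⟩⟩,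
  ⟨2, [⟨⟨0, 1, 0, 0, 0⟩, ⟨0, 0, 1, 0, 1⟩⟩], ⟨⟨0, 1, 0, 0, 0⟩, ⟨0, 0, 1, 0, 1⟩⟩⟩,
  ⟨-2, [⟨⟨0, 1, 0, 0, 1⟩, ⟨1, 0, 1, 0, 0⟩⟩], ⟨⟨0, 1, 0, 0, 1⟩, ⟨1, 0, 1, 0, 0⟩⟩⟩,
  ⟨-1, [⟨⟨0, 0, 0, 0, 1⟩, ⟨0, 2, 0, 0, 0⟩⟩], ⟨⟨0, 0, 0, 0, 1⟩, ⟨0, 2, 0, 0, 0⟩⟩⟩,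
  ⟨-1, [⟨⟨0, 1, 0, 0, 0⟩, ⟨0, 0, 0, 0, 2⟩⟩], ⟨⟨0, 1, 0, 0, 0⟩, ⟨0, 0, 0, 0, 2⟩⟩⟩,
  ⟨-1, [⟨⟨0, 0, 1, 0, 0⟩, ⟨0, 0, 0, 2, 0⟩⟩], ⟨⟨0, 0, 1, 0, 0⟩, ⟨0, 0, 0, 2, 0⟩⟩⟩,
  ⟨-1, [⟨⟨0, 0, 0, 1, 0⟩, ⟨0, 0, 2, 0, 0⟩⟩], ⟨⟨0, 0, 0, 1, 0⟩, ⟨0, 0, 2, 0, 0⟩⟩⟩,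
  -- The remaining quadratic part is not truncated. Its mixed products are polarized into squares of
  -- sums, which changes the coefficients of the pure squares.
  ⟨-9, [], ⟨⟨0, 1, 0, 0, 0⟩, ⟨0, 0, 0, 0, 0⟩⟩⟩,
  ⟨-9, [], ⟨⟨0, 0, 1, 0, 0⟩, ⟨0, 0, 0, 0, 0⟩⟩⟩,
  ⟨-9, [], ⟨⟨0, 0, 0, 1, 0⟩, ⟨0, 0, 0, 0, 0⟩⟩⟩,
  ⟨-9, [], ⟨⟨0, 0, 0, 0, 1⟩, ⟨0, 0, 0, 0, 0⟩⟩⟩,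
  ⟨6, [], ⟨⟨0, 1, 1, 0, 0⟩, ⟨0, 0, 0, 0, 0⟩⟩⟩,
  ⟨6, [], ⟨⟨0, 0, 0, 1, 1⟩, ⟨0, 0, 0, 0, 0⟩⟩⟩,
  ⟨-2, [], ⟨⟨0, 1, 0, 0, 1⟩, ⟨0, 0, 0, 0, 0⟩⟩⟩,
  ⟨-2, [], ⟨⟨0, 0, 1, 1, 0⟩, ⟨0, 0, 0, 0, 0⟩⟩⟩]

/-- Twice the conditional probability that a die dominates another one, as a sum of truncated
squares. -/
def dominanceTerms : List TruncatedSquare := [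
  ⟨1, [], ⟨⟨1, 2, 0, 0, 0⟩, ⟨0, 0, 2, 0, 0⟩⟩⟩,
  ⟨-8, [⟨⟨0, 1, 0, 0, 0⟩, ⟨0, 0, 1, 0, 0⟩⟩], ⟨⟨0, 1, 0, 0, 0⟩, ⟨0, 0, 1, 0, 0⟩⟩⟩,
  ⟨-3, [], ⟨⟨0, 1, 0, 0, 0⟩, ⟨0, 0, 0, 0, 0⟩⟩⟩,
  ⟨1, [⟨⟨0, 2, 0, 0, 0⟩, ⟨1, 0, 0, 0, 0⟩⟩], ⟨⟨0, 2, 0, 0, 0⟩, ⟨1, 0, 0, 0, 0⟩⟩⟩,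
  ⟨3, [], ⟨⟨0, 0, 1, 0, 0⟩, ⟨0, 0, 0, 0, 0⟩⟩⟩,
  ⟨-1, [⟨⟨0, 0, 2, 0, 0⟩, ⟨1, 0, 0, 0, 0⟩⟩], ⟨⟨0, 0, 2, 0, 0⟩, ⟨1, 0, 0, 0, 0⟩⟩⟩]

theorem integral_commonDominanceTerms_sq :
    IntegrableOn (fun p => TruncatedSquare.eval commonDominanceTerms (affinePoint p.1 p.2) ^ 2)
      (pairRegion (diagonalCut :: unitCuts)) ∧
    ∫ p in pairRegion (diagonalCut :: unitCuts),
      TruncatedSquare.eval commonDominanceTerms (affinePoint p.1 p.2) ^ 2 =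
        110413771 / 258048000 / 12 := by
  -- `N = 2⁵ * 3² * 5 * 7 * 11 * 13 * 17` makes all the divisions of the cutting procedure exact,
  -- and `z` is the integral times `N ^ 9 * 8! / 4`. The preliminary subdivision along
  -- `diagonalForms` discards nothing.
  obtain ⟨h1, h2⟩ := integral_eval_sq (N := 24504480) (fs := diagonalForms)
    (cuts := diagonalCut :: unitCuts) (T := commonDominanceTerms)
    (z := 1145015722067896137266914418447251588596105617280176559583395840000000)
    (by norm_num) (by decide +kernel)
  exact ⟨h1, h2.trans (by norm_num [Nat.factorial])⟩

theorem integral_dominanceTerms_sq :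
    ∫ p in pairRegion unitCuts, TruncatedSquare.eval dominanceTerms (affinePoint p.1 p.2) ^ 2 =
      973 / 3840 := by
  have h := (integral_eval_sq (N := 24504480) (fs := diagonalForms)
    (cuts := unitCuts) (T := dominanceTerms)
    (z := 8136761128846070804651303076913253525737421660843524214489088000000000)
    (by norm_num) (by decide +kernel)).2
  exact h.trans (by norm_num [Nat.factorial])

/-! ### The uniform law on the kite and its distribution functions. -/

/-- The kite with vertices `(0, 0)`, `(1, 1 / 2)`, `(1, 1)` and `(1 / 2, 1)`. -/
def kite : Set (ℝ × ℝ) := {z | z ∈ planeCone ∧ z.1 < 1 ∧ z.2 < 1}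

theorem measurableSet_kite : MeasurableSet kite :=
  measurableSet_planeCone.inter
    ((measurableSet_lt measurable_fst measurable_const).inter
      (measurableSet_lt measurable_snd measurable_const))

/-- The normalized area on the kite. -/
noncomputable def kiteMeasure : Measure (ℝ × ℝ) := (2 : ℝ≥0∞) • volume.restrict kite

theorem mem_kite_bounds {z : ℝ × ℝ} (hz : z ∈ kite) : 0 < z.1 ∧ z.1 < 1 ∧ 0 < z.2 ∧ z.2 < 1 ∧
    z.1 < 2 * z.2 ∧ z.2 < 2 * z.1 := by
  obtain ⟨⟨h1, h2⟩, h3, h4⟩ := hz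
  exact ⟨by linarith, h3, by linarith, h4, h1, h2⟩

/-- Squares of positive parts are differentiable at the kink as well, so piecewise quadratic
distribution functions can be differentiated everywhere without splitting the interval. -/
theorem hasDerivAt_posPart_sq (x : ℝ) : HasDerivAt (fun x : ℝ => max x 0 ^ 2) (2 * max x 0) x := by
  rcases lt_trichotomy x 0 with h | rfl | h
  · rw [max_eq_right h.le, mul_zero]
    refine (hasDerivAt_const x (0 : ℝ)).congr_of_eventuallyEq ?_
    filter_upwards [Iio_mem_nhds h] with y hy
    rw [max_eq_right (le_of_lt hy)]
    simp
  · rw [max_self, mul_zero, hasDerivAt_iff_isLittleO]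
    simp only [max_self, sub_zero, smul_zero, ne_eq, OfNat.ofNat_ne_zero, not_false_eq_true,
      zero_pow]
    refine (Asymptotics.IsBigO.of_bound 1 (g := fun x : ℝ => x ^ 2)
      (Filter.Eventually.of_forall fun y => ?_)).trans_isLittleO (Asymptotics.isLittleO_pow_id one_lt_two)
    rw [one_mul, norm_pow, norm_pow]
    refine pow_le_pow_left₀ (norm_nonneg _) ?_ 2
    rw [Real.norm_eq_abs, Real.norm_eq_abs, abs_of_nonneg (le_max_right _ _)]
    exact max_le (le_abs_self y) (abs_nonneg y)
  · rw [max_eq_left h.le]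
    have : HasDerivAt (fun x : ℝ => x ^ 2) (2 * x) x := by simpa using hasDerivAt_pow 2 x
    refine this.congr_of_eventuallyEq ?_
    filter_upwards [Ioi_mem_nhds h] with y hy
    rw [max_eq_left (le_of_lt hy)]

theorem hasDerivAt_posPart_affine_sq (m b x : ℝ) :
    HasDerivAt (fun x : ℝ => max (m * x + b) 0 ^ 2) (2 * max (m * x + b) 0 * m) x := by
  have h : HasDerivAt (fun x : ℝ => m * x + b) m x := by
    simpa using ((hasDerivAt_id x).const_mul m).add_const b
  exact (hasDerivAt_posPart_sq (m * x + b)).comp x h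

/-- The measure of a subset of the kite between the ray through `(2, 1)` and a graph. -/
theorem kiteMeasure_real_eq {α : ℝ} (hα : 0 ≤ α) {u Φ : ℝ → ℝ} (hu : Continuous u)
    {S : Set (ℝ × ℝ)} (hS : MeasurableSet S)
    (hSu : S ∩ kite = regionBetween (fun x => x / 2) u (Set.Ioo 0 α))
    (hle : ∀ x ∈ Set.Icc 0 α, x / 2 ≤ u x)
    (hΦ : ∀ x ∈ Set.Icc 0 α, HasDerivAt Φ (2 * (u x - x / 2)) x) :
    kiteMeasure.real S = Φ α - Φ 0 := by
  have hcont : Continuous fun x => 2 * (u x - x / 2) := by fun_prop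
  have hftc := intervalIntegral.integral_eq_sub_of_hasDerivAt (a := 0) (b := α)
    (by rwa [Set.uIcc_of_le hα]) (hcont.intervalIntegrable 0 α)
  have hint : ∀ g : ℝ → ℝ, Continuous g → IntegrableOn g (Set.Ioo 0 α) := fun g hg =>
    (hg.integrableOn_Icc (a := 0) (b := α)).mono_set Set.Ioo_subset_Icc_self
  have hvol : volume (S ∩ kite) = ENNReal.ofReal (∫ x in Set.Ioo 0 α, (u x - x / 2)) := by
    rw [hSu, Measure.volume_eq_prod, volume_regionBetween_eq_integral (hint _ (by fun_prop))
      (hint _ hu) measurableSet_Ioo fun x hx => hle x (Set.Ioo_subset_Icc_self hx)]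
    rfl
  have hnn : 0 ≤ ∫ x in Set.Ioo 0 α, (u x - x / 2) :=
    setIntegral_nonneg measurableSet_Ioo fun x hx =>
      sub_nonneg.2 (hle x (Set.Ioo_subset_Icc_self hx))
  rw [← hftc, intervalIntegral.integral_const_mul, intervalIntegral.integral_of_le hα,
    integral_Ioc_eq_integral_Ioo, kiteMeasure, measureReal_ennreal_smul_apply, measureReal_def,
    Measure.restrict_apply hS, hvol, ENNReal.toReal_ofReal hnn]
  simp

/-- The joint distribution function of the coordinates of a uniform point of the kite. -/
noncomputable def kiteCdf (α β : ℝ) : ℝ :=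
  2 * α * β - (α ^ 2 + β ^ 2) / 2 + max (β - 2 * α) 0 ^ 2 / 2 + max (α - 2 * β) 0 ^ 2 / 2

/-- The joint distribution function of the first coordinate of a uniform point of the kite and of
the difference of the coordinates. -/
noncomputable def kiteDiagCdf (α ρ : ℝ) : ℝ :=
  max (α + 2 * ρ) 0 ^ 2 / 2 - 3 * max ρ 0 ^ 2 + max (ρ - α) 0 ^ 2 - max (α + ρ - 1) 0 ^ 2

theorem measurableSet_fst_lt (α : ℝ) : MeasurableSet {z : ℝ × ℝ | z.1 < α} :=
  measurableSet_lt measurable_fst measurable_const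

theorem measurableSet_snd_lt (α : ℝ) : MeasurableSet {z : ℝ × ℝ | z.2 < α} :=
  measurableSet_lt measurable_snd measurable_const

theorem measurableSet_diag_lt (ρ : ℝ) : MeasurableSet {z : ℝ × ℝ | z.2 - z.1 < ρ} :=
  measurableSet_lt (measurable_snd.sub measurable_fst) measurable_const

theorem kiteMeasure_fst_lt_inter_snd_lt {α β : ℝ} (hα : 0 ≤ α) (hα' : α ≤ 1) (hβ : 0 ≤ β)
    (hβ' : β ≤ 1) : kiteMeasure.real ({z | z.1 < α} ∩ {z | z.2 < β}) = kiteCdf α β := by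
  have h0 : kiteCdf 0 β = 0 := by
    have h1 : max (β - 2 * 0) 0 = β := by rw [mul_zero, sub_zero, max_eq_left hβ]
    have h2 : max (0 - 2 * β) 0 = 0 := max_eq_right (by linarith)
    rw [kiteCdf, h1, h2]
    ring
  -- The section at `x` reaches from `x / 2` to the smaller of `2 * x` and `β`; the outer maximum
  -- makes it empty when `β` is below `x / 2`.
  rw [kiteMeasure_real_eq hα (u := fun x => max (x / 2) (min (2 * x) β))
    (Φ := fun x => kiteCdf x β) (by fun_prop)
    ((measurableSet_fst_lt α).inter (measurableSet_snd_lt β)), h0, sub_zero]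
  · ext z
    simp only [kite, planeCone, regionBetween, Set.mem_inter_iff, Set.mem_ofPred_eq, Set.mem_Ioo,
      lt_max_iff, lt_min_iff]
    constructor
    · rintro ⟨⟨h1, h2⟩, ⟨h3, h4⟩, h5, h6⟩
      exact ⟨⟨by linarith, h1⟩, by linarith, Or.inr ⟨h4, h2⟩⟩
    · rintro ⟨⟨h1, h2⟩, h3, h4 | ⟨h4, h5⟩⟩
      · exact absurd h3 (not_lt.2 h4.le)
      · exact ⟨⟨h2, h5⟩, ⟨by linarith, h4⟩, by linarith, by linarith⟩
  · intro x _
    exact le_max_left _ _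
  · intro x hx
    have e : (fun x => kiteCdf x β) = fun x => 2 * x * β - (x ^ 2 + β ^ 2) / 2 +
        max (-2 * x + β) 0 ^ 2 / 2 + max (1 * x + -2 * β) 0 ^ 2 / 2 := by
      funext x
      rw [kiteCdf]
      ring_nf
    rw [e]
    have h1 : HasDerivAt (fun x : ℝ => 2 * x * β - (x ^ 2 + β ^ 2) / 2) (2 * β - x) x := by
      have := (((hasDerivAt_id x).const_mul 2).mul_const β).sub
        (((hasDerivAt_pow 2 x).add_const (β ^ 2)).div_const 2)
      refine this.congr_deriv ?_
      simp
    refine ((h1.add ((hasDerivAt_posPart_affine_sq (-2) β x).div_const 2)).add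
      ((hasDerivAt_posPart_affine_sq 1 (-2 * β) x).div_const 2)).congr_deriv ?_
    obtain ⟨hx0, hx1⟩ := hx
    have hx2 : x ≤ 1 := hx1.trans hα'
    clear h0 e h1
    simp only [max_def, min_def]
    grind

theorem kiteMeasure_fst_lt_inter_diag_lt {α ρ : ℝ} (hα : 0 ≤ α) (hα' : α ≤ 1) (hρ : ρ ≤ 1 / 2) :
    kiteMeasure.real ({z | z.1 < α} ∩ {z | z.2 - z.1 < ρ}) = kiteDiagCdf α ρ := by
  have h0 : kiteDiagCdf 0 ρ = 0 := by
    rw [kiteDiagCdf]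
    rcases le_total ρ 0 with h | h
    · rw [max_eq_right (by linarith), max_eq_right h, max_eq_right (by linarith),
        max_eq_right (by linarith)]
      ring
    · rw [max_eq_left (by linarith), max_eq_left h, max_eq_left (by linarith),
        max_eq_right (by linarith)]
      ring
  rw [kiteMeasure_real_eq hα (u := fun x => max (x / 2) (min (2 * x) (min 1 (x + ρ))))
    (Φ := fun x => kiteDiagCdf x ρ) (by fun_prop)
    ((measurableSet_fst_lt α).inter (measurableSet_diag_lt ρ)), h0, sub_zero]
  · ext z
    simp only [kite, planeCone, regionBetween, Set.mem_inter_iff, Set.mem_ofPred_eq, Set.mem_Ioo,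
      lt_max_iff, lt_min_iff]
    constructor
    · rintro ⟨⟨h1, h2⟩, ⟨h3, h4⟩, h5, h6⟩
      exact ⟨⟨by linarith, h1⟩, by linarith, Or.inr ⟨h4, h6, by linarith⟩⟩
    · rintro ⟨⟨h1, h2⟩, h3, h4 | ⟨h4, h5, h6⟩⟩
      · exact absurd h3 (not_lt.2 h4.le)
      · exact ⟨⟨h2, by linarith⟩, ⟨by linarith, h4⟩, by linarith, h5⟩
  · intro x _
    exact le_max_left _ _
  · intro x hx
    have e : (fun x => kiteDiagCdf x ρ) = fun x => max (1 * x + 2 * ρ) 0 ^ 2 / 2 -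
        3 * max ρ 0 ^ 2 + max (-1 * x + ρ) 0 ^ 2 - max (1 * x + (ρ - 1)) 0 ^ 2 := by
      funext x
      rw [kiteDiagCdf]
      ring_nf
    rw [e]
    refine (((((hasDerivAt_posPart_affine_sq 1 (2 * ρ) x).div_const 2).sub_const
      (3 * max ρ 0 ^ 2)).add (hasDerivAt_posPart_affine_sq (-1) ρ x)).sub
      (hasDerivAt_posPart_affine_sq 1 (ρ - 1) x)).congr_deriv ?_
    obtain ⟨hx0, hx1⟩ := hx
    have hx2 : x ≤ 1 := hx1.trans hα'
    clear h0 e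
    simp only [max_def, min_def]
    grind

instance : IsProbabilityMeasure kiteMeasure := by
  have h1 : kiteMeasure Set.univ = kiteMeasure ({z | z.1 < 1} ∩ {z | z.2 < 1}) := by
    rw [kiteMeasure, Measure.smul_apply, Measure.smul_apply, Measure.restrict_apply MeasurableSet.univ,
      Measure.restrict_apply ((measurableSet_fst_lt 1).inter (measurableSet_snd_lt 1)), Set.univ_inter,
      Set.inter_eq_right.2 (fun z hz => hz.2)]
  have h2 := kiteMeasure_fst_lt_inter_snd_lt (α := 1) (β := 1) zero_le_one le_rfl zero_le_one le_rfl
  have h3 : kiteCdf 1 1 = 1 := by norm_num [kiteCdf]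
  rw [h3, measureReal_def] at h2
  constructor
  rw [h1, ← ENNReal.toReal_eq_one_iff]
  exact h2

theorem ae_mem_kite : ∀ᵐ z ∂kiteMeasure, z ∈ kite :=
  Measure.ae_smul_measure (ae_restrict_mem measurableSet_kite) _

theorem kiteMeasure_absolutelyContinuous : kiteMeasure ≪ volume :=
  Measure.smul_absolutelyContinuous.trans Measure.restrict_le_self.absolutelyContinuous

theorem measurePreserving_swap_kiteMeasure :
    MeasurePreserving (Prod.swap : ℝ × ℝ → ℝ × ℝ) kiteMeasure kiteMeasure := by
  have h1 : MeasurePreserving (Prod.swap : ℝ × ℝ → ℝ × ℝ) volume volume :=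
    ⟨measurable_swap, by rw [Measure.volume_eq_prod, Measure.prod_swap]⟩
  have h2 : (Prod.swap : ℝ × ℝ → ℝ × ℝ) ⁻¹' kite = kite := by
    ext z
    simp only [kite, planeCone, Set.mem_preimage, Set.mem_ofPred_eq, Prod.fst_swap, Prod.snd_swap]
    tauto
  have h3 := h1.restrict_preimage measurableSet_kite
  rw [h2] at h3
  exact h3.smul_measure _

theorem volume_ae_fst_ne (x : ℝ) : ∀ᵐ z : ℝ × ℝ, z.1 ≠ x :=
  Measure.quasiMeasurePreserving_fst.ae ((Set.countable_singleton x).ae_notMem volume)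

theorem volume_ae_snd_ne (x : ℝ) : ∀ᵐ z : ℝ × ℝ, z.2 ≠ x :=
  Measure.quasiMeasurePreserving_snd.ae ((Set.countable_singleton x).ae_notMem volume)

theorem ae_fst_ne (x : ℝ) : ∀ᵐ z ∂kiteMeasure, z.1 ≠ x :=
  kiteMeasure_absolutelyContinuous.ae_le (volume_ae_fst_ne x)

theorem ae_snd_ne (x : ℝ) : ∀ᵐ z ∂kiteMeasure, z.2 ≠ x :=
  kiteMeasure_absolutelyContinuous.ae_le (volume_ae_snd_ne x)

theorem ae_diag_ne (x : ℝ) : ∀ᵐ z ∂kiteMeasure, z.2 - z.1 ≠ x := by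
  refine kiteMeasure_absolutelyContinuous.ae_le ?_
  change volume {z : ℝ × ℝ | z.2 - z.1 ≠ x}ᶜ = 0
  rw [Measure.volume_eq_prod, Measure.measure_prod_null]
  · filter_upwards with y
    have : Prod.mk y ⁻¹' {z : ℝ × ℝ | z.2 - z.1 ≠ x}ᶜ = {x + y} := by
      ext z
      simp [sub_eq_iff_eq_add]
    rw [this, Real.volume_singleton, Pi.zero_apply]
  · exact (measurableSet_eq_fun (by fun_prop) (by fun_prop)).compl.compl

theorem kiteMeasure_fst_lt {α : ℝ} (h0 : 0 ≤ α) (h1 : α ≤ 1) :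
    kiteMeasure.real {z | z.1 < α} = 3 * α ^ 2 / 2 - max (2 * α - 1) 0 ^ 2 / 2 := by
  have h := kiteMeasure_fst_lt_inter_snd_lt h0 h1 zero_le_one le_rfl
  have e : kiteMeasure.real {z | z.1 < α} = kiteMeasure.real ({z | z.1 < α} ∩ {z | z.2 < 1}) := by
    refine measureReal_congr ?_
    filter_upwards [ae_mem_kite] with z hz
    exact propext ⟨fun h => ⟨h, hz.2.2⟩, fun h => h.1⟩
  rw [e, h, kiteCdf, max_eq_right (by linarith : α - 2 * 1 ≤ 0)]
  rcases le_total (2 * α) 1 with h | h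
  · rw [max_eq_left (by linarith), max_eq_right (by linarith)]
    ring
  · rw [max_eq_right (by linarith), max_eq_left (by linarith)]
    ring

theorem kiteMeasure_swap_preimage (S : Set (ℝ × ℝ)) (hS : MeasurableSet S) :
    kiteMeasure.real (Prod.swap ⁻¹' S) = kiteMeasure.real S :=
  measurePreserving_swap_kiteMeasure.measureReal_preimage hS.nullMeasurableSet

theorem kiteMeasure_snd_lt {α : ℝ} (h0 : 0 ≤ α) (h1 : α ≤ 1) :
    kiteMeasure.real {z | z.2 < α} = 3 * α ^ 2 / 2 - max (2 * α - 1) 0 ^ 2 / 2 := by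
  rw [← kiteMeasure_fst_lt h0 h1, ← kiteMeasure_swap_preimage _ (measurableSet_fst_lt α)]
  rfl

theorem kiteMeasure_diag_lt {ρ : ℝ} (hρ' : -(1 / 2) ≤ ρ) (hρ : ρ ≤ 1 / 2) :
    kiteMeasure.real {z | z.2 - z.1 < ρ} = 1 - (1 - 2 * ρ) ^ 2 / 2 + 4 * max (-ρ) 0 ^ 2 := by
  have h := kiteMeasure_fst_lt_inter_diag_lt zero_le_one le_rfl hρ
  have e : kiteMeasure.real {z | z.2 - z.1 < ρ} =
      kiteMeasure.real ({z | z.1 < 1} ∩ {z | z.2 - z.1 < ρ}) := by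
    refine measureReal_congr ?_
    filter_upwards [ae_mem_kite] with z hz
    exact propext ⟨fun h => ⟨hz.2.1, h⟩, fun h => h.2⟩
  rw [e, h, kiteDiagCdf, max_eq_right (by linarith : ρ - 1 ≤ 0),
    (by ring : 1 + ρ - 1 = ρ), max_eq_left (by linarith : 0 ≤ 1 + 2 * ρ)]
  rcases le_total ρ 0 with h | h
  · rw [max_eq_right h, max_eq_left (by linarith)]
    ring
  · rw [max_eq_left h, max_eq_right (by linarith)]
    ring

/-- Exchanging the coordinates turns `Q - P < ρ` into `Q - P > -ρ`, which up to a null set is the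
complement of an event with known joint distribution. -/
theorem kiteMeasure_snd_lt_inter_diag_lt {β ρ : ℝ} (hβ : 0 ≤ β) (hβ' : β ≤ 1)
    (hρ : -(1 / 2) ≤ ρ) :
    kiteMeasure.real ({z | z.2 < β} ∩ {z | z.2 - z.1 < ρ}) =
      3 * β ^ 2 / 2 - max (2 * β - 1) 0 ^ 2 / 2 - kiteDiagCdf β (-ρ) := by
  rw [← kiteMeasure_fst_lt hβ hβ', ← kiteMeasure_fst_lt_inter_diag_lt hβ hβ' (by linarith),
    ← kiteMeasure_swap_preimage _ ((measurableSet_snd_lt β).inter (measurableSet_diag_lt ρ)),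
    ← measureReal_sdiff Set.inter_subset_left
      ((measurableSet_fst_lt β).inter (measurableSet_diag_lt (-ρ)))]
  refine measureReal_congr ?_
  filter_upwards [ae_diag_ne (-ρ)] with z hz
  refine propext ⟨fun h => ⟨h.1, fun h' => ?_⟩, fun h => ⟨h.1, ?_⟩⟩
  · have h1 : z.1 - z.2 < ρ := h.2
    have h2 : z.2 - z.1 < -ρ := h'.2
    linarith
  · change z.1 - z.2 < ρ
    have h1 : ¬ z.2 - z.1 < -ρ := fun h' => h.2 ⟨h.1, h'⟩
    have := lt_of_le_of_ne (not_lt.1 h1) hz.symm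
    linarith

/-! ### Dominance in terms of points of the kite. -/

/-- Dominance between two dice, in terms of the points `(P, Q)` for which the smallest face of the
die is `(1 - P) / 2` and the largest one is `(1 + Q) / 2`: at least two of the smallest, the middle
and the largest face are larger. -/
def Beats (a b : ℝ × ℝ) : Prop :=
  (a.1 < b.1 ∧ a.2 - a.1 < b.2 - b.1) ∨ (a.1 < b.1 ∧ b.2 < a.2) ∨
    (a.2 - a.1 < b.2 - b.1 ∧ b.2 < a.2)

theorem measurableSet_beats : MeasurableSet {z : (ℝ × ℝ) × (ℝ × ℝ) | Beats z.1 z.2} := by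
  have h1 : MeasurableSet {z : (ℝ × ℝ) × (ℝ × ℝ) | z.1.1 < z.2.1} :=
    measurableSet_lt (by fun_prop) (by fun_prop)
  have h2 : MeasurableSet {z : (ℝ × ℝ) × (ℝ × ℝ) | z.1.2 - z.1.1 < z.2.2 - z.2.1} :=
    measurableSet_lt (by fun_prop) (by fun_prop)
  have h3 : MeasurableSet {z : (ℝ × ℝ) × (ℝ × ℝ) | z.2.2 < z.1.2} :=
    measurableSet_lt (by fun_prop) (by fun_prop)
  exact (h1.inter h2).union ((h1.inter h3).union (h2.inter h3))

/-- Exchanging `P` and `Q` is the reflection x ↦ 1 - x of the faces, which reverses dominance. -/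
theorem beats_swap (a b : ℝ × ℝ) : Beats a.swap b.swap ↔ Beats b a := by
  simp only [Beats, Prod.fst_swap, Prod.snd_swap, lt_sub_iff_add_lt]
  grind

theorem not_beats_iff {a b : ℝ × ℝ} (h1 : a.1 ≠ b.1) (h2 : a.2 ≠ b.2)
    (h3 : a.2 - a.1 ≠ b.2 - b.1) : ¬ Beats a b ↔ Beats b a := by
  unfold Beats
  rcases lt_or_gt_of_ne h1 with h1 | h1 <;> rcases lt_or_gt_of_ne h2 with h2 | h2 <;>
    rcases lt_or_gt_of_ne h3 with h3 | h3 <;> simp [h1, h2, h3, h1.not_gt, h2.not_gt, h3.not_gt]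

/-- The four events that determine dominance by a die. -/
def beatsEvent (a : ℝ × ℝ) : Fin 4 → Set (ℝ × ℝ) :=
  ![Set.univ, {z | z.1 < a.1}, {z | z.2 - z.1 < a.2 - a.1}, {z | z.2 < a.2}]

/-- The signs with which the events of `beatsEvent` contribute to dominance. -/
def beatsSign : Fin 4 → ℝ := ![1, -1, -1, 1]

theorem measurableSet_beatsEvent (a : ℝ × ℝ) (i : Fin 4) : MeasurableSet (beatsEvent a i) := by
  fin_cases i
  · exact MeasurableSet.univ
  · exact measurableSet_fst_lt a.1
  · exact measurableSet_diag_lt (a.2 - a.1)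
  · exact measurableSet_snd_lt a.2

/-- Since `Q` is the sum of `P` and `Q - P`, the three comparisons that favour `a` can neither all
hold nor, without these two ties, all fail. So one or two of them hold, and the indicator of a
majority is their number minus 1. The first two comparisons are the complements of the events used
here. -/
theorem indicator_beats_eq {a b : ℝ × ℝ} (h1 : b.1 ≠ a.1)
    (h2 : b.2 - b.1 ≠ a.2 - a.1) : {b | Beats a b}.indicator (1 : ℝ × ℝ → ℝ) b =
      ∑ i, beatsSign i * (beatsEvent a i).indicator 1 b := by
  classical
  simp only [Fin.sum_univ_four, beatsSign, beatsEvent, Set.indicator_apply, Set.mem_ofPred_eq,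
    Beats, Pi.one_apply, Matrix.cons_val_zero, Matrix.cons_val_one, Matrix.cons_val, Set.mem_univ]
  grind

theorem integral_signedIndicator_mul {α ι : Type*} [MeasurableSpace α] [Fintype ι] (μ : Measure α)
    [IsFiniteMeasure μ] (ε : ι → ℝ) {S T : ι → Set α} (hS : ∀ i, MeasurableSet (S i))
    (hT : ∀ i, MeasurableSet (T i)) :
    ∫ x, (∑ i, ε i * (S i).indicator 1 x) * (∑ j, ε j * (T j).indicator 1 x) ∂μ =
      ∑ i, ∑ j, ε i * ε j * μ.real (S i ∩ T j) := by
  have e (x : α) : (∑ i, ε i * (S i).indicator 1 x) * (∑ j, ε j * (T j).indicator 1 x) =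
      ∑ i, ∑ j, ε i * ε j * (S i ∩ T j).indicator (1 : α → ℝ) x := by
    rw [Finset.sum_mul_sum]
    refine Finset.sum_congr rfl fun i _ => Finset.sum_congr rfl fun j _ => ?_
    rw [Set.inter_indicator_one, Pi.mul_apply]
    ring
  have hi (i j : ι) : Integrable (fun x => ε i * ε j * (S i ∩ T j).indicator (1 : α → ℝ) x) μ :=
    ((integrable_const (1 : ℝ)).indicator ((hS i).inter (hT j))).const_mul _
  simp only [e]
  rw [integral_finsetSum _ fun i _ => integrable_finsetSum _ fun j _ => hi i j]
  refine Finset.sum_congr rfl fun i _ => ?_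
  rw [integral_finsetSum _ fun j _ => hi i j]
  refine Finset.sum_congr rfl fun j _ => ?_
  rw [integral_const_mul, integral_indicator_one ((hS i).inter (hT j))]

/-- The probability that a die dominates a random die. -/
noncomputable def dominance (a : ℝ × ℝ) : ℝ := kiteMeasure.real {b | Beats a b}

/-- The probability that two dice both dominate a random die. -/
noncomputable def commonDominance (a c : ℝ × ℝ) : ℝ := kiteMeasure.real {b | Beats a b ∧ Beats c b}

theorem measurableSet_beats_left (a : ℝ × ℝ) : MeasurableSet {b | Beats a b} :=
  measurable_prodMk_left measurableSet_beats

/-- Multiplying the two linear expressions for the indicators leaves only probabilities of pairwise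
intersections, that is, joint distribution functions. -/
theorem commonDominance_eq_sum (a c : ℝ × ℝ) : commonDominance a c =
    ∑ i, ∑ j, beatsSign i * beatsSign j * kiteMeasure.real (beatsEvent a i ∩ beatsEvent c j) := by
  rw [← integral_signedIndicator_mul _ _ (measurableSet_beatsEvent a) (measurableSet_beatsEvent c),
    commonDominance, Set.ofPred_and, ← integral_indicator_one
      ((measurableSet_beats_left a).inter (measurableSet_beats_left c))]
  refine integral_congr_ae ?_
  filter_upwards [ae_fst_ne a.1, ae_diag_ne (a.2 - a.1), ae_fst_ne c.1,
    ae_diag_ne (c.2 - c.1)] with b h1 h2 h3 h4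
  rw [← indicator_beats_eq h1 h2, ← indicator_beats_eq h3 h4, ← Pi.mul_apply,
    ← Set.inter_indicator_one]

theorem dominance_eq_sum (a : ℝ × ℝ) : dominance a =
    ∑ i, beatsSign i * kiteMeasure.real (beatsEvent a i) := by
  have hi (i : Fin 4) : Integrable (fun x => beatsSign i *
      (beatsEvent a i).indicator (1 : ℝ × ℝ → ℝ) x) kiteMeasure :=
    ((integrable_const (1 : ℝ)).indicator (measurableSet_beatsEvent a i)).const_mul _
  simp only [← integral_indicator_one (measurableSet_beatsEvent a _), ← integral_const_mul]
  rw [← integral_finsetSum _ fun i _ => hi i, dominance,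
    ← integral_indicator_one (measurableSet_beats_left a)]
  refine integral_congr_ae ?_
  filter_upwards [ae_fst_ne a.1, ae_diag_ne (a.2 - a.1)] with b h1 h2
  exact indicator_beats_eq h1 h2

/-! ### Conditional probabilities as truncated squares, and their second moments. -/

namespace TruncatedSquare

theorem truncated_nil (c : ℤ) (f : FormPair) (y : Fin 5 → ℝ) :
    truncated ⟨c, [], f⟩ y = f.toLin y ^ 2 := by
  simp [truncated]

theorem truncated_singleton (c : ℤ) (f g : FormPair) (y : Fin 5 → ℝ) :
    truncated ⟨c, [g], f⟩ y = if 0 < g.toLin y then f.toLin y ^ 2 else 0 := by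
  simp [truncated]

theorem truncated_self (c : ℤ) (f : FormPair) (y : Fin 5 → ℝ) :
    truncated ⟨c, [f], f⟩ y = max (f.toLin y) 0 ^ 2 := by
  rw [truncated_singleton]
  split_ifs with h
  · rw [max_eq_left h.le]
  · rw [max_eq_right (not_lt.1 h), zero_pow two_ne_zero]

theorem truncated_self_cons (c : ℤ) (f g : FormPair) (y : Fin 5 → ℝ) :
    truncated ⟨c, [f, g], f⟩ y = if 0 < g.toLin y then max (f.toLin y) 0 ^ 2 else 0 := by
  rw [← truncated_self 0, truncated_singleton]
  simp only [truncated, List.mem_cons, List.not_mem_nil, or_false, forall_eq_or_imp, forall_eq]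
  split_ifs <;> tauto

end TruncatedSquare

theorem max_neg_zero_sq (x : ℝ) : max (-x) 0 ^ 2 = x ^ 2 - max x 0 ^ 2 := by
  rcases le_total x 0 with h | h
  · rw [max_eq_right h, max_eq_left (by linarith)]
    ring
  · rw [max_eq_left h, max_eq_right (by linarith)]
    ring

theorem two_mul_dominance {a : ℝ × ℝ} (ha : a ∈ kite) (c : ℝ × ℝ) :
    2 * dominance a = TruncatedSquare.eval dominanceTerms (affinePoint a c) := by
  obtain ⟨h1, h2, h3, h4, h5, h6⟩ := mem_kite_bounds ha
  rw [dominance_eq_sum]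
  simp only [Fin.sum_univ_four, beatsSign, beatsEvent, Matrix.cons_val_zero, Matrix.cons_val_one,
    Matrix.cons_val]
  rw [kiteMeasure_fst_lt h1.le h2.le, kiteMeasure_snd_lt h3.le h4.le,
    kiteMeasure_diag_lt (by linarith) (by linarith), probReal_univ]
  simp only [TruncatedSquare.eval, dominanceTerms, List.map_cons, List.map_nil, List.sum_cons,
    List.sum_nil, TruncatedSquare.truncated_self, TruncatedSquare.truncated_nil,
    FormPair.toLin_apply, affinePoint]
  simp
  ring_nf

theorem setOf_lt_inter_setOf_lt {α : Type*} (f : α → ℝ) (x y : ℝ) :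
    {z | f z < x} ∩ {z | f z < y} = {z | f z < min x y} := by
  ext z
  simp

/-- The hypothesis on `Q - P` decides which median event is contained in the other. The orders of
the values of `P` and of `Q` leave four cases, each a polynomial identity in positive parts.
Equality is excluded because the terms truncated by these comparisons vanish there. -/
theorem two_mul_commonDominance {a c : ℝ × ℝ} (ha : a ∈ kite) (hc : c ∈ kite)
    (hR : c.2 - c.1 < a.2 - a.1) (hP : a.1 ≠ c.1) (hQ : a.2 ≠ c.2) :
    2 * commonDominance a c = TruncatedSquare.eval commonDominanceTerms (affinePoint a c) := by
  obtain ⟨h1, h2, h3, h4, h5, h6⟩ := mem_kite_bounds ha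
  obtain ⟨k1, k2, k3, k4, k5, k6⟩ := mem_kite_bounds hc
  have ha' : -(1 / 2) ≤ a.2 - a.1 ∧ a.2 - a.1 ≤ 1 / 2 := ⟨by linarith, by linarith⟩
  have hc' : -(1 / 2) ≤ c.2 - c.1 ∧ c.2 - c.1 ≤ 1 / 2 := ⟨by linarith, by linarith⟩
  have hmP : 0 ≤ min a.1 c.1 ∧ min a.1 c.1 ≤ 1 :=
    ⟨le_min h1.le k1.le, (min_le_left _ _).trans h2.le⟩
  have hmQ : 0 ≤ min a.2 c.2 ∧ min a.2 c.2 ≤ 1 :=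
    ⟨le_min h3.le k3.le, (min_le_left _ _).trans h4.le⟩
  rw [commonDominance_eq_sum]
  simp only [Fin.sum_univ_four, beatsSign, beatsEvent, Matrix.cons_val_zero, Matrix.cons_val_one,
    Matrix.cons_val, Set.univ_inter, Set.inter_univ, setOf_lt_inter_setOf_lt]
  rw [Set.inter_comm {z : ℝ × ℝ | z.2 - z.1 < a.2 - a.1} {z : ℝ × ℝ | z.1 < c.1},
    Set.inter_comm {z : ℝ × ℝ | z.2 - z.1 < a.2 - a.1} {z : ℝ × ℝ | z.2 < c.2},
    Set.inter_comm {z : ℝ × ℝ | z.2 < a.2} {z : ℝ × ℝ | z.1 < c.1},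
    min_eq_right hR.le,
    kiteMeasure_fst_lt_inter_snd_lt h1.le h2.le k3.le k4.le,
    kiteMeasure_fst_lt_inter_snd_lt k1.le k2.le h3.le h4.le,
    kiteMeasure_fst_lt_inter_diag_lt h1.le h2.le hc'.2,
    kiteMeasure_fst_lt_inter_diag_lt k1.le k2.le ha'.2,
    kiteMeasure_snd_lt_inter_diag_lt h3.le h4.le hc'.1,
    kiteMeasure_snd_lt_inter_diag_lt k3.le k4.le ha'.1,
    kiteMeasure_fst_lt h1.le h2.le, kiteMeasure_snd_lt h3.le h4.le,
    kiteMeasure_fst_lt k1.le k2.le, kiteMeasure_snd_lt k3.le k4.le,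
    kiteMeasure_fst_lt hmP.1 hmP.2, kiteMeasure_snd_lt hmQ.1 hmQ.2,
    kiteMeasure_diag_lt ha'.1 ha'.2, kiteMeasure_diag_lt hc'.1 hc'.2, probReal_univ]
  simp only [TruncatedSquare.eval, commonDominanceTerms, List.map_cons, List.map_nil, List.sum_cons,
    List.sum_nil, TruncatedSquare.truncated_self, TruncatedSquare.truncated_nil,
    TruncatedSquare.truncated_self_cons, TruncatedSquare.truncated_singleton,
    FormPair.toLin_apply, affinePoint, kiteCdf, kiteDiagCdf, max_neg_zero_sq]
  simp only [Matrix.cons_val_zero, Matrix.cons_val_one, Matrix.cons_val, Nat.cast_zero, Nat.cast_one,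
    Nat.cast_ofNat, sub_zero, zero_sub, sub_self, zero_mul, one_mul, mul_one, add_zero, zero_add,
    neg_mul, ← sub_eq_add_neg, sub_pos, neg_add_eq_sub]
  -- The positive parts of `Q - P` and of its negative both occur for `a`; the second is expressed
  -- by the first.
  have hm : max (a.1 - a.2) 0 ^ 2 = (a.1 - a.2) ^ 2 - max (-a.1 + a.2) 0 ^ 2 := by
    have h := max_neg_zero_sq (a.2 - a.1)
    rw [neg_sub] at h
    rw [h]
    ring_nf
  rcases lt_or_gt_of_ne hP with hP | hP <;> rcases lt_or_gt_of_ne hQ with hQ | hQ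
  · rw [min_eq_left hP.le, min_eq_left hQ.le]
    simp only [hP, hQ, hP.not_gt, hQ.not_gt, if_true, if_false]
    ring_nf
    rw [hm]
    ring
  · rw [min_eq_left hP.le, min_eq_right hQ.le]
    simp only [hP, hQ, hP.not_gt, hQ.not_gt, if_true, if_false]
    ring_nf
    rw [hm]
    ring
  · rw [min_eq_right hP.le, min_eq_left hQ.le]
    simp only [hP, hQ, hP.not_gt, hQ.not_gt, if_true, if_false]
    ring_nf
    rw [hm]
    ring
  · rw [min_eq_right hP.le, min_eq_right hQ.le]
    simp only [hP, hQ, hP.not_gt, hQ.not_gt, if_true, if_false]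
    ring_nf
    rw [hm]
    ring

theorem pairRegion_unitCuts : pairRegion unitCuts = kite ×ˢ kite := by
  ext p
  simp only [pairRegion, unitCuts, kite, affinePoint, List.forall_mem_cons, FormPair.toLin_apply,
    Set.mem_ofPred_eq, Set.mem_prod]
  simp
  tauto

theorem pairRegion_diagonalCut : pairRegion (diagonalCut :: unitCuts) =
    kite ×ˢ kite ∩ {p | p.2.2 - p.2.1 < p.1.2 - p.1.1} := by
  rw [← pairRegion_unitCuts]
  ext p
  have h : 0 < diagonalCut.toLin (affinePoint p.1 p.2) ↔ p.2.2 - p.2.1 < p.1.2 - p.1.1 := by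
    have e : diagonalCut.toLin (affinePoint p.1 p.2) = p.1.2 - p.1.1 - (p.2.2 - p.2.1) := by
      rw [FormPair.toLin_apply]
      simp [diagonalCut, affinePoint]
      ring
    rw [e, sub_pos]
  simp only [pairRegion, List.forall_mem_cons, h, Set.mem_ofPred_eq, Set.mem_inter_iff]
  tauto

theorem kiteMeasure_prod : kiteMeasure.prod kiteMeasure =
    (4 : ℝ≥0∞) • (volume : Measure ((ℝ × ℝ) × (ℝ × ℝ))).restrict (kite ×ˢ kite) := by
  rw [kiteMeasure, Measure.prod_smul_left, Measure.prod_smul_right, Measure.prod_restrict, smul_smul,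
    Measure.volume_eq_prod (ℝ × ℝ)]
  norm_num

/-- The square of `2 * dominance` brings in a factor 4, which is exactly the density of the product
law on the product of kites. -/
theorem integral_dominance_sq : ∫ a, dominance a ^ 2 ∂kiteMeasure = 973 / 3840 := by
  have h1 : ∫ p, dominance p.1 ^ 2 ∂(kiteMeasure.prod kiteMeasure) =
      ∫ a, dominance a ^ 2 ∂kiteMeasure := by
    rw [integral_fun_fst (fun a => dominance a ^ 2), probReal_univ, one_smul]
  rw [← h1, kiteMeasure_prod, integral_smul_measure, ← pairRegion_unitCuts,
    ← integral_dominanceTerms_sq, ENNReal.toReal_ofNat, ← integral_smul]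
  refine setIntegral_congr_fun (measurableSet_pairRegion _) fun p hp => ?_
  rw [pairRegion_unitCuts] at hp
  simp only [← two_mul_dominance hp.1 p.2, smul_eq_mul]
  ring

theorem ae_prod_ne {f g : (ℝ × ℝ) × (ℝ × ℝ) → ℝ} (hf : Measurable f) (hg : Measurable g)
    (h : ∀ a, ∀ᵐ c ∂kiteMeasure, f (a, c) ≠ g (a, c)) :
    ∀ᵐ p ∂(kiteMeasure.prod kiteMeasure), f p ≠ g p :=
  (Measure.ae_prod_iff_ae_ae (measurableSet_eq_fun hf hg).compl).2 (Filter.Eventually.of_forall h)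

theorem ae_prod_fst_ne : ∀ᵐ p ∂(kiteMeasure.prod kiteMeasure), p.2.1 ≠ p.1.1 :=
  ae_prod_ne (by fun_prop) (by fun_prop) fun a => ae_fst_ne a.1

theorem ae_prod_snd_ne : ∀ᵐ p ∂(kiteMeasure.prod kiteMeasure), p.2.2 ≠ p.1.2 :=
  ae_prod_ne (by fun_prop) (by fun_prop) fun a => ae_snd_ne a.2

theorem ae_prod_diag_ne : ∀ᵐ p ∂(kiteMeasure.prod kiteMeasure), p.2.2 - p.2.1 ≠ p.1.2 - p.1.1 :=
  ae_prod_ne (f := fun p => p.2.2 - p.2.1) (g := fun p => p.1.2 - p.1.1) (by fun_prop)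
    (by fun_prop) fun a => ae_diag_ne (a.2 - a.1)

theorem commonDominance_comm (a c : ℝ × ℝ) : commonDominance a c = commonDominance c a := by
  simp only [commonDominance, and_comm]

/-- The formula by truncated squares is available on the half `H` with ordered medians. Exchanging
the two dice maps `H` to its complement up to a null set and preserves the integrand, so the total
is twice the integral over `H`. -/
theorem integral_commonDominance_sq :
    ∫ p, commonDominance p.1 p.2 ^ 2 ∂(kiteMeasure.prod kiteMeasure) =
      110413771 / 258048000 / 6 := by
  set H : Set ((ℝ × ℝ) × (ℝ × ℝ)) := {p | p.2.2 - p.2.1 < p.1.2 - p.1.1}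
  have hH : MeasurableSet H := measurableSet_lt (by fun_prop) (by fun_prop)
  obtain ⟨hi, hv⟩ := integral_commonDominanceTerms_sq
  rw [pairRegion_diagonalCut] at hi hv
  have hk : ∀ᵐ p ∂(kiteMeasure.prod kiteMeasure), p ∈ kite ×ˢ kite := by
    rw [kiteMeasure_prod]
    exact Measure.ae_smul_measure (ae_restrict_mem (measurableSet_kite.prod measurableSet_kite)) _
  have hres : (kiteMeasure.prod kiteMeasure).restrict H =
      (4 : ℝ≥0∞) • volume.restrict (kite ×ˢ kite ∩ H) := by
    rw [kiteMeasure_prod, Measure.restrict_smul, Measure.restrict_restrict hH, Set.inter_comm]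
  have heq : ∀ᵐ p ∂(kiteMeasure.prod kiteMeasure).restrict H, commonDominance p.1 p.2 ^ 2 =
      TruncatedSquare.eval commonDominanceTerms (affinePoint p.1 p.2) ^ 2 / 4 := by
    filter_upwards [ae_restrict_mem hH, ae_restrict_of_ae ae_prod_fst_ne,
      ae_restrict_of_ae ae_prod_snd_ne, ae_restrict_of_ae hk] with p h1 h2 h3 h4
    rw [← two_mul_commonDominance h4.1 h4.2 h1 h2.symm h3.symm]
    ring
  have hhalf : ∫ p in H, commonDominance p.1 p.2 ^ 2 ∂(kiteMeasure.prod kiteMeasure) =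
      110413771 / 258048000 / 12 := by
    rw [integral_congr_ae heq, hres, integral_smul_measure, integral_div, hv]
    norm_num
  have hint : IntegrableOn (fun p => commonDominance p.1 p.2 ^ 2) H
      (kiteMeasure.prod kiteMeasure) := by
    refine (Integrable.congr ?_ (heq.mono fun _ => Eq.symm))
    rw [hres]
    exact (hi.div_const 4).smul_measure (by simp)
  have hsw : MeasurePreserving (Prod.swap : (ℝ × ℝ) × (ℝ × ℝ) → _)
      (kiteMeasure.prod kiteMeasure) (kiteMeasure.prod kiteMeasure) :=
    Measure.measurePreserving_swap
  have hpre : (Prod.swap : (ℝ × ℝ) × (ℝ × ℝ) → _) ⁻¹' H =ᵐ[kiteMeasure.prod kiteMeasure]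
      (Hᶜ : Set ((ℝ × ℝ) × (ℝ × ℝ))) := by
    filter_upwards [ae_prod_diag_ne] with p hp
    change (p.1.2 - p.1.1 < p.2.2 - p.2.1) = (¬ p.2.2 - p.2.1 < p.1.2 - p.1.1)
    rw [not_lt, hp.symm.le_iff_lt]
  have hemb : MeasurableEmbedding (Prod.swap : (ℝ × ℝ) × (ℝ × ℝ) → _) :=
    MeasurableEquiv.prodComm.measurableEmbedding
  have hfun : (fun p : (ℝ × ℝ) × (ℝ × ℝ) => commonDominance p.1 p.2 ^ 2) =
      (fun p => commonDominance p.1 p.2 ^ 2) ∘ Prod.swap := by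
    funext p
    simp only [Function.comp, Prod.fst_swap, Prod.snd_swap, commonDominance_comm p.1]
  have hhalf' : ∫ p in Hᶜ, commonDominance p.1 p.2 ^ 2 ∂(kiteMeasure.prod kiteMeasure) =
      110413771 / 258048000 / 12 := by
    rw [← hhalf, ← Measure.restrict_congr_set hpre]
    refine Eq.trans ?_ (hsw.setIntegral_preimage_emb hemb _ H)
    rw [hfun]
    rfl
  have hint' : IntegrableOn (fun p => commonDominance p.1 p.2 ^ 2) Hᶜ
      (kiteMeasure.prod kiteMeasure) := by
    refine IntegrableOn.congr_set_ae ?_ hpre.symm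
    rw [hfun]
    exact (hsw.integrableOn_comp_preimage hemb).2 hint
  rw [← integral_add_compl₀ hH.nullMeasurableSet, hhalf, hhalf']
  · norm_num
  · rw [← integrableOn_univ, ← Set.union_compl_self H]
    exact hint.union hint'

/-! ### The law of the extremes of a balanced die. -/

/-- The point `(P, Q)` for which the smallest face of a die is `(1 - P) / 2` and the largest one is
`(1 + Q) / 2`. -/
noncomputable def extremes (a : Die 3) : ℝ × ℝ := (1 - 2 * ⨅ i, a i, 2 * (⨆ i, a i) - 1)

theorem measurable_extremes : Measurable extremes := by
  have h (i : Fin 3) : Measurable fun a : Die 3 => a i := by fun_prop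
  have h1 : Measurable fun a : Die 3 => ⨅ i, a i := Measurable.iInf h
  have h2 : Measurable fun a : Die 3 => ⨆ i, a i := Measurable.iSup h
  exact (measurable_const.sub (h1.const_mul 2)).prodMk ((h2.const_mul 2).sub_const 1)

theorem extremes_of_monotone {a : Die 3} {σ : Equiv.Perm (Fin 3)} (h : Monotone (a ∘ σ)) :
    extremes a = (1 - 2 * a (σ 0), 2 * a (σ 2) - 1) := by
  have h1 : ⨅ i, a i = a (σ 0) := by
    rw [← σ.iInf_comp]
    refine IsLeast.csInf_eq ⟨⟨0, rfl⟩, ?_⟩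
    rintro _ ⟨i, rfl⟩
    exact h (Fin.zero_le i)
  have h2 : ⨆ i, a i = a (σ 2) := by
    rw [← σ.iSup_comp]
    refine IsGreatest.csSup_eq ⟨⟨2, rfl⟩, ?_⟩
    rintro _ ⟨i, rfl⟩
    exact h (Fin.le_last i)
  rw [extremes, h1, h2]

/-- The sorted balanced die with given extremes. -/
noncomputable def ofExtremes (z : ℝ × ℝ) : Die 3 :=
  !₂[(1 - z.1) / 2, (1 + z.1 - z.2) / 2, (1 + z.2) / 2]

/-- The linear part of `ofExtremes`. -/
noncomputable def ofExtremesLinear : WithLp 2 (ℝ × ℝ) →ₗ[ℝ] Die 3 where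
  toFun z := !₂[-z.fst / 2, (z.fst - z.snd) / 2, z.snd / 2]
  map_add' y z := by
    ext i
    fin_cases i <;> simp <;> ring
  map_smul' c z := by
    ext i
    fin_cases i <;> simp <;> ring

theorem ofExtremesLinear_injective : Function.Injective ofExtremesLinear := by
  rw [← LinearMap.ker_eq_bot, LinearMap.ker_eq_bot']
  intro z hz
  have h0 : -z.fst / 2 = 0 := congrArg (fun a : Die 3 => a 0) hz
  have h2 : z.snd / 2 = 0 := congrArg (fun a : Die 3 => a 2) hz
  apply WithLp.ofLp_injective
  refine Prod.ext ?_ ?_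
  · change z.fst = 0
    linarith
  · change z.snd = 0
    linarith

/-- An injective affine map scales two-dimensional Hausdorff measure by a constant. Its value is
irrelevant, because conditioning cancels it. -/
theorem exists_measure_image_ofExtremes : ∃ c : ℝ≥0∞, c ≠ 0 ∧ c ≠ ⊤ ∧
    ∀ X : Set (ℝ × ℝ), (μHE[2] : Measure (Die 3)) (ofExtremes '' X) = c * volume X := by
  have hrank : Module.finrank ℝ (WithLp 2 (ℝ × ℝ)) = 2 := by
    rw [(WithLp.linearEquiv 2 ℝ (ℝ × ℝ)).finrank_eq]
    simp
  refine ⟨ENNReal.ofReal ofExtremesLinear.normDet, ?_, ENNReal.ofReal_ne_top, fun X => ?_⟩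
  · rw [ne_eq, ENNReal.ofReal_eq_zero, not_le]
    refine lt_of_le_of_ne (LinearMap.normDet_nonneg _) (Ne.symm ?_)
    exact (ofExtremesLinear.normDet_ne_zero_tfae.out 0 4).2 ofExtremesLinear_injective
  · have h1 := ofExtremesLinear.euclideanHausdorffMeasure_image_eq_normDet_mul_volume
      (WithLp.ofLp ⁻¹' X)
    rw [hrank] at h1
    have h2 : volume (WithLp.ofLp ⁻¹' X : Set (WithLp 2 (ℝ × ℝ))) = volume X :=
      (WithLp.volume_preserving_symm_measurableEquiv_toLp_prod ℝ ℝ).measure_preimage_equiv X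
    rw [← h2, ← h1, ← measure_preimage_add (μHE[2] : Measure (Die 3)) !₂[1 / 2, 1 / 2, 1 / 2]
      (ofExtremes '' X)]
    congr 1
    ext a
    simp only [Set.mem_preimage, Set.mem_image]
    have key (z : ℝ × ℝ) : ofExtremes z = !₂[1 / 2, 1 / 2, 1 / 2] + ofExtremesLinear (WithLp.toLp 2 z) := by
      ext i
      fin_cases i <;> simp [ofExtremes, ofExtremesLinear] <;> ring
    constructor
    · rintro ⟨z, hz, h⟩
      rw [key] at h
      exact ⟨WithLp.toLp 2 z, hz, add_left_cancel h⟩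
    · rintro ⟨z, hz, h⟩
      exact ⟨z.ofLp, hz, by rw [key, ← h]⟩

theorem ofExtremes_of_sorted {a : Die 3} (ha : ∑ i, a i = 3 / 2) :
    ofExtremes (1 - 2 * a 0, 2 * a 2 - 1) = a := by
  rw [Fin.sum_univ_three] at ha
  ext i
  fin_cases i <;> simp [ofExtremes]
  linarith

/-- The isometry of the space of dice that permutes the faces. -/
noncomputable def permuteFaces (σ : Equiv.Perm (Fin 3)) : Die 3 ≃ₗᵢ[ℝ] Die 3 :=
  LinearIsometryEquiv.piLpCongrLeft 2 ℝ ℝ σ.symm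

theorem permuteFaces_apply (σ : Equiv.Perm (Fin 3)) (a : Die 3) (i : Fin 3) :
    permuteFaces σ a i = a (σ i) := rfl

theorem permuteFaces_mem_balancedDice (σ : Equiv.Perm (Fin 3)) (a : Die 3) :
    permuteFaces σ a ∈ balancedDice 3 ↔ a ∈ balancedDice 3 := by
  simp only [balancedDice, Set.mem_ofPred_eq, permuteFaces_apply]
  rw [Equiv.sum_comp σ (fun i => a i), σ.forall_congr_left]
  simp

theorem extremes_permuteFaces (σ : Equiv.Perm (Fin 3)) (a : Die 3) :
    extremes (permuteFaces σ a) = extremes a := by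
  simp only [extremes, permuteFaces_apply]
  rw [σ.iInf_comp (g := fun i => a i), σ.iSup_comp (g := fun i => a i)]

theorem measure_permuteFaces_preimage (σ : Equiv.Perm (Fin 3)) (s : Set (Die 3)) :
    (μHE[2] : Measure (Die 3)) (permuteFaces σ ⁻¹' s) = (μHE[2] : Measure (Die 3)) s := by
  have h := (permuteFaces σ).isometry.euclideanHausdorffMeasure_preimage (d := 2) s
  rwa [(permuteFaces σ).surjective.range_eq, Set.inter_univ] at h

/-- The balanced dice with distinct faces that a given permutation sorts. -/
def sortedDice (σ : Equiv.Perm (Fin 3)) : Set (Die 3) := {a | a ∈ balancedDice 3 ∧ StrictMono (a ∘ σ)}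

theorem sortedDice_eq_preimage (σ : Equiv.Perm (Fin 3)) :
    sortedDice σ = permuteFaces σ ⁻¹' sortedDice 1 := by
  ext a
  simp only [sortedDice, Set.mem_preimage, Set.mem_ofPred_eq, permuteFaces_mem_balancedDice]
  rfl

theorem strictMono_fin_three {f : Fin 3 → ℝ} : StrictMono f ↔ f 0 < f 1 ∧ f 1 < f 2 := by
  rw [Fin.strictMono_iff_lt_succ, Fin.forall_fin_two]
  rfl

theorem measurableSet_balancedDice : MeasurableSet (balancedDice 3) := by
  have h (i : Fin 3) : Measurable fun a : Die 3 => a i := by fun_prop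
  have : balancedDice 3 =
      (⋂ i, (fun a : Die 3 => a i) ⁻¹' Set.Icc 0 1) ∩ {a | ∑ i, a i = (3 : ℕ) / 2} := by
    ext a
    simp [balancedDice]
  rw [this]
  exact (MeasurableSet.iInter fun i => h i measurableSet_Icc).inter
    (measurableSet_eq_fun (Finset.measurable_sum _ fun i _ => h i) measurable_const)

theorem measurableSet_sortedDice (σ : Equiv.Perm (Fin 3)) : MeasurableSet (sortedDice σ) := by
  have h (i : Fin 3) : Measurable fun a : Die 3 => a i := by fun_prop
  simp only [sortedDice, strictMono_fin_three]
  exact measurableSet_balancedDice.inter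
    ((measurableSet_lt (h _) (h _)).inter (measurableSet_lt (h _) (h _)))

theorem pairwise_disjoint_sortedDice : Pairwise (Function.onFun Disjoint sortedDice) := by
  intro σ τ hne
  refine Set.disjoint_left.2 fun a hσ hτ => hne ?_
  have h := Tuple.unique_monotone hσ.2.monotone hτ.2.monotone
  ext i : 1
  have hinj : Function.Injective a :=
    Function.Injective.of_comp_right hσ.2.injective σ.surjective
  exact hinj (congrFun h i)

/-- The faces `(1 - P) / 2`, `(1 + P - Q) / 2`, `(1 + Q) / 2` increase strictly exactly on the plane
cone. There `P` and `Q` are positive, so the range condition on the faces only adds `P ≤ 1` and `Q ≤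
1`. -/
theorem sortedDice_inter_extremes (X : Set (ℝ × ℝ)) : sortedDice 1 ∩ extremes ⁻¹' X =
    ofExtremes '' ({z | z ∈ planeCone ∧ z.1 ≤ 1 ∧ z.2 ≤ 1} ∩ X) := by
  have hs {a : Die 3} (h : StrictMono (a ∘ (1 : Equiv.Perm (Fin 3)))) :
      extremes a = (1 - 2 * a 0, 2 * a 2 - 1) := extremes_of_monotone h.monotone
  ext a
  constructor
  · rintro ⟨⟨⟨h1, h2⟩, h3⟩, h4⟩
    rw [Set.mem_preimage, hs h3] at h4
    obtain ⟨h5, h6⟩ := strictMono_fin_three.1 h3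
    simp only [Function.comp, Equiv.Perm.one_apply] at h5 h6
    rw [Nat.cast_ofNat] at h2
    refine ⟨_, ⟨⟨⟨?_, ?_⟩, ?_, ?_⟩, h4⟩, ofExtremes_of_sorted h2⟩
    all_goals
      rw [Fin.sum_univ_three] at h2
      have := (h1 0).1
      have := (h1 2).2
      simp only
      linarith
  · rintro ⟨z, ⟨⟨⟨h1, h2⟩, h3, h4⟩, h5⟩, rfl⟩
    have hm : StrictMono (ofExtremes z ∘ (1 : Equiv.Perm (Fin 3))) := by
      rw [strictMono_fin_three]
      constructor <;> simp [ofExtremes] <;> linarith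
    refine ⟨⟨⟨fun i => ?_, ?_⟩, hm⟩, ?_⟩
    · fin_cases i <;> constructor <;> simp [ofExtremes] <;> linarith
    · rw [Fin.sum_univ_three]
      simp [ofExtremes]
      ring
    · rw [Set.mem_preimage, hs hm]
      have e : (1 - 2 * ofExtremes z 0, 2 * ofExtremes z 2 - 1) = z := by
        ext <;> simp [ofExtremes] <;> ring
      rwa [e]

theorem volume_snd_eq_mul_fst (m : ℝ) : volume {z : ℝ × ℝ | z.2 = m * z.1} = 0 := by
  rw [Measure.volume_eq_prod, Measure.measure_prod_null]
  · filter_upwards with y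
    have : Prod.mk y ⁻¹' {z : ℝ × ℝ | z.2 = m * z.1} = {m * y} := by
      ext z
      simp
    rw [this, Real.volume_singleton, Pi.zero_apply]
  · exact measurableSet_eq_fun (by fun_prop) (by fun_prop)

/-- After sorting, a die with a repeated face lies over one of the lines `Q = 2 * P` and `P = 2 *
Q`. -/
theorem measure_balancedDice_diff : (μHE[2] : Measure (Die 3))
    (balancedDice 3 \ ⋃ σ, sortedDice σ) = 0 := by
  obtain ⟨c, -, -, hc⟩ := exists_measure_image_ofExtremes
  refine measure_mono_null (t := ⋃ σ, permuteFaces σ ⁻¹'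
    (ofExtremes '' ({z | z.2 = 2 * z.1} ∪ {z | z.2 = 1 / 2 * z.1}))) ?_ ?_
  · rintro a ⟨ha, hn⟩
    have hm : Monotone (a ∘ Tuple.sort a) := Tuple.monotone_sort a
    have hb := (permuteFaces_mem_balancedDice (Tuple.sort a) a).2 ha
    refine Set.mem_iUnion.2 ⟨Tuple.sort a, _, ?_, ofExtremes_of_sorted (by simpa using hb.2)⟩
    have h3 := hb.2
    rw [Fin.sum_univ_three, Nat.cast_ofNat] at h3
    have h1 : ¬ StrictMono (a ∘ Tuple.sort a) := fun h => hn (Set.mem_iUnion.2 ⟨_, ha, h⟩)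
    rw [strictMono_fin_three, not_and_or, not_lt, not_lt] at h1
    have h01 : permuteFaces (Tuple.sort a) a 0 ≤ permuteFaces (Tuple.sort a) a 1 :=
      hm (by decide)
    have h12 : permuteFaces (Tuple.sort a) a 1 ≤ permuteFaces (Tuple.sort a) a 2 :=
      hm (by decide)
    rcases h1 with h1 | h1
    · have h1' : permuteFaces (Tuple.sort a) a 1 ≤ permuteFaces (Tuple.sort a) a 0 := h1
      left
      simp only [Set.mem_ofPred_eq]
      linarith
    · have h1' : permuteFaces (Tuple.sort a) a 2 ≤ permuteFaces (Tuple.sort a) a 1 := h1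
      right
      simp only [Set.mem_ofPred_eq]
      linarith
  · rw [measure_iUnion_null_iff]
    intro σ
    rw [measure_permuteFaces_preimage, hc,
      measure_union_null (volume_snd_eq_mul_fst 2) (volume_snd_eq_mul_fst (1 / 2)), mul_zero]

/-- Up to a null set the balanced dice split into six sorted chambers, one for each ordering.
Permuting faces is an isometry that preserves the extremes, so all chambers contribute equally. -/
theorem measure_balancedDice_inter : ∃ c : ℝ≥0∞, c ≠ 0 ∧ c ≠ ⊤ ∧ ∀ X : Set (ℝ × ℝ),
    MeasurableSet X → (μHE[2] : Measure (Die 3)) (balancedDice 3 ∩ extremes ⁻¹' X) =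
      c * volume (X ∩ kite) := by
  obtain ⟨c, h0, htop, hc⟩ := exists_measure_image_ofExtremes
  refine ⟨6 * c, mul_ne_zero (by simp) h0, ENNReal.mul_ne_top (by simp) htop, fun X hX => ?_⟩
  have hm := measurable_extremes hX
  have h1 : (balancedDice 3 ∩ extremes ⁻¹' X : Set (Die 3)) =ᵐ[(μHE[2] : Measure (Die 3))]
      (⋃ σ, sortedDice σ ∩ extremes ⁻¹' X : Set (Die 3)) := by
    rw [← Set.iUnion_inter]
    refine ae_eq_set_inter ?_ (ae_eq_refl _)
    refine Filter.EventuallyEq.symm ((Set.iUnion_subset fun σ a ha => ha.1).eventuallyLE.antisymm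
      (ae_le_set.2 measure_balancedDice_diff))
  have h2 (σ : Equiv.Perm (Fin 3)) : (μHE[2] : Measure (Die 3)) (sortedDice σ ∩ extremes ⁻¹' X) =
      c * volume (X ∩ kite) := by
    have e : sortedDice σ ∩ extremes ⁻¹' X =
        permuteFaces σ ⁻¹' (sortedDice 1 ∩ extremes ⁻¹' X) := by
      rw [sortedDice_eq_preimage, Set.preimage_inter, ← Set.preimage_comp]
      congr 2
      funext a
      exact (extremes_permuteFaces σ a).symm
    rw [e, measure_permuteFaces_preimage, sortedDice_inter_extremes, hc, Set.inter_comm]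
    congr 1
    refine measure_congr (ae_eq_set_inter (ae_eq_refl _) ?_)
    filter_upwards [volume_ae_fst_ne 1, volume_ae_snd_ne 1] with z h1 h2
    refine propext (and_congr_right fun _ => ?_)
    rw [h1.le_iff_lt, h2.le_iff_lt]
  rw [measure_congr h1, measure_iUnion (fun σ τ h => (pairwise_disjoint_sortedDice h).mono
    Set.inter_subset_left Set.inter_subset_left) fun σ => (measurableSet_sortedDice σ).inter hm,
    tsum_fintype]
  simp only [h2, Finset.sum_const, Finset.card_univ, Fintype.card_perm, Fintype.card_fin]
  rw [nsmul_eq_mul, mul_assoc]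
  rfl

theorem map_extremes_balancedUniform : (balancedUniform 3).map extremes = kiteMeasure := by
  obtain ⟨c, h0, htop, hc⟩ := measure_balancedDice_inter
  ext X hX
  have h1 := hc Set.univ MeasurableSet.univ
  rw [Set.preimage_univ, Set.inter_univ, Set.univ_inter] at h1
  have h2 : 2 * volume kite = 1 := by
    have := measure_univ (μ := kiteMeasure)
    rwa [kiteMeasure, Measure.smul_apply, Measure.restrict_apply_univ] at this
  rw [Measure.map_apply measurable_extremes hX, balancedUniform,
    cond_apply measurableSet_balancedDice, hc X hX, h1, kiteMeasure, Measure.smul_apply,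
    Measure.restrict_apply hX, smul_eq_mul]
  have hk0 : volume kite ≠ 0 := fun h => by simp [h] at h2
  have hk1 : volume kite ≠ ⊤ := fun h => by simp [h] at h2
  rw [ENNReal.mul_inv (Or.inl h0) (Or.inl htop), mul_mul_mul_comm, ENNReal.inv_mul_cancel h0 htop,
    one_mul]
  congr 1
  rw [← ENNReal.mul_left_inj hk0 hk1, h2, ENNReal.inv_mul_cancel hk0 hk1]

/-! ### Dominance of dice compared with dominance of extremes. -/

theorem sign_int_mem (x : ℝ) : -1 ≤ (SignType.sign x : ℤ) ∧ (SignType.sign x : ℤ) ≤ 1 := by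
  rcases SignType.sign x with _ | _ | _ <;> decide

/-- Two increasing triples without ties: the first one dominates the second one if and only if at
least two of its terms are larger than the corresponding terms of the second one. -/
theorem sum_sign_pos_iff_of_monotone {x y : Fin 3 → ℝ} (hx : Monotone x) (hy : Monotone y)
    (h : ∀ i, x i ≠ y i) : 0 < ∑ i, ∑ j, (SignType.sign (x i - y j) : ℤ) ↔
      (y 0 < x 0 ∧ y 1 < x 1) ∨ (y 0 < x 0 ∧ y 2 < x 2) ∨ (y 1 < x 1 ∧ y 2 < x 2) := by
  have hpos {i j : Fin 3} (k : Fin 3) (hk : y k < x k) (h1 : k ≤ i) (h2 : j ≤ k) :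
      (SignType.sign (x i - y j) : ℤ) = 1 := by
    rw [sign_pos (sub_pos.2 ((hy h2).trans_lt (hk.trans_le (hx h1))))]
    rfl
  have hneg {i j : Fin 3} (k : Fin 3) (hk : x k < y k) (h1 : i ≤ k) (h2 : k ≤ j) :
      (SignType.sign (x i - y j) : ℤ) = -1 := by
    rw [sign_neg (sub_neg.2 ((hx h1).trans_lt (hk.trans_le (hy h2))))]
    rfl
  have hb (i j : Fin 3) := sign_int_mem (x i - y j)
  have e00 := hb 0 0
  have e01 := hb 0 1
  have e02 := hb 0 2
  have e10 := hb 1 0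
  have e11 := hb 1 1
  have e12 := hb 1 2
  have e20 := hb 2 0
  have e21 := hb 2 1
  have e22 := hb 2 2
  simp only [Fin.sum_univ_three]
  have p0 (hk : y 0 < x 0) := And.intro (hpos (i := 0) (j := 0) 0 hk le_rfl le_rfl)
    (And.intro (hpos (i := 1) (j := 0) 0 hk (by decide) le_rfl)
      (hpos (i := 2) (j := 0) 0 hk (by decide) le_rfl))
  have p1 (hk : y 1 < x 1) := And.intro (And.intro (hpos (i := 1) (j := 0) 1 hk le_rfl (by decide))
    (hpos (i := 1) (j := 1) 1 hk le_rfl le_rfl))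
    (And.intro (hpos (i := 2) (j := 0) 1 hk (by decide) (by decide))
      (hpos (i := 2) (j := 1) 1 hk (by decide) le_rfl))
  have p2 (hk : y 2 < x 2) := And.intro (hpos (i := 2) (j := 0) 2 hk le_rfl (by decide))
    (And.intro (hpos (i := 2) (j := 1) 2 hk le_rfl (by decide))
      (hpos (i := 2) (j := 2) 2 hk le_rfl le_rfl))
  have n0 (hk : x 0 < y 0) := And.intro (hneg (i := 0) (j := 0) 0 hk le_rfl le_rfl)
    (And.intro (hneg (i := 0) (j := 1) 0 hk le_rfl (by decide))
      (hneg (i := 0) (j := 2) 0 hk le_rfl (by decide)))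
  have n1 (hk : x 1 < y 1) := And.intro (And.intro (hneg (i := 0) (j := 1) 1 hk (by decide) le_rfl)
    (hneg (i := 1) (j := 1) 1 hk le_rfl le_rfl))
    (And.intro (hneg (i := 0) (j := 2) 1 hk (by decide) (by decide))
      (hneg (i := 1) (j := 2) 1 hk le_rfl (by decide)))
  have n2 (hk : x 2 < y 2) := And.intro (hneg (i := 0) (j := 2) 2 hk (by decide) le_rfl)
    (And.intro (hneg (i := 1) (j := 2) 2 hk (by decide) le_rfl)
      (hneg (i := 2) (j := 2) 2 hk le_rfl le_rfl))
  -- Any two comparisons in the same direction fix the signs of five of the nine differences, and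
  -- these outweigh the other four.
  rcases lt_or_gt_of_ne (h 0) with h0 | h0 <;> rcases lt_or_gt_of_ne (h 1) with h1 | h1 <;>
    rcases lt_or_gt_of_ne (h 2) with h2 | h2 <;>
    simp only [h0, h1, h2, h0.not_gt, h1.not_gt, h2.not_gt, and_self, and_true, and_false, or_self, or_true,
      or_false, iff_true, iff_false,
      forall_const] at * <;> omega

/-- The median is `(1 + P - Q) / 2`, because the faces add up to `3 / 2`; a larger median therefore
means a smaller `Q - P`. -/
theorem dominates_iff_beats {a b : Die 3} (ha : a ∈ balancedDice 3) (hb : b ∈ balancedDice 3)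
    (h1 : (extremes a).1 ≠ (extremes b).1) (h2 : (extremes a).2 ≠ (extremes b).2)
    (h3 : (extremes a).2 - (extremes a).1 ≠ (extremes b).2 - (extremes b).1) :
    Dominates a b ↔ Beats (extremes a) (extremes b) := by
  have hsum {a : Die 3} (ha : a ∈ balancedDice 3) :
      a (Tuple.sort a 0) + a (Tuple.sort a 1) + a (Tuple.sort a 2) = 3 / 2 := by
    rw [← Fin.sum_univ_three fun i => a (Tuple.sort a i), Equiv.sum_comp (Tuple.sort a) fun i => a i]
    exact ha.2
  have sa := hsum ha
  have sb := hsum hb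
  have e : ∑ i, ∑ j, (SignType.sign (a i - b j) : ℤ) =
      ∑ i, ∑ j, (SignType.sign ((a ∘ Tuple.sort a) i - (b ∘ Tuple.sort b) j) : ℤ) := by
    rw [← Equiv.sum_comp (Tuple.sort a)]
    refine Finset.sum_congr rfl fun i _ => ?_
    rw [← Equiv.sum_comp (Tuple.sort b)]
    rfl
  rw [extremes_of_monotone (Tuple.monotone_sort a), extremes_of_monotone (Tuple.monotone_sort b)] at *
  simp only at h1 h2 h3
  rw [Dominates, e, sum_sign_pos_iff_of_monotone (Tuple.monotone_sort a) (Tuple.monotone_sort b)]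
  · simp only [Beats, Function.comp]
    have i1 : b (Tuple.sort b 0) < a (Tuple.sort a 0) ↔
        1 - 2 * a (Tuple.sort a 0) < 1 - 2 * b (Tuple.sort b 0) := by
      constructor <;> intro h <;> linarith
    have i2 : b (Tuple.sort b 1) < a (Tuple.sort a 1) ↔
        2 * a (Tuple.sort a 2) - 1 - (1 - 2 * a (Tuple.sort a 0)) <
          2 * b (Tuple.sort b 2) - 1 - (1 - 2 * b (Tuple.sort b 0)) := by
      constructor <;> intro h <;> linarith
    have i3 : b (Tuple.sort b 2) < a (Tuple.sort a 2) ↔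
        2 * b (Tuple.sort b 2) - 1 < 2 * a (Tuple.sort a 2) - 1 := by
      constructor <;> intro h <;> linarith
    rw [i1, i2, i3]
  · intro i hi
    fin_cases i
    · simp only [Function.comp, Fin.zero_eta] at hi
      exact h1 (by rw [hi])
    · simp only [Function.comp, Fin.mk_one] at hi
      exact h3 (by linarith)
    · simp only [Function.comp, Fin.reduceFinMk] at hi
      exact h2 (by rw [hi])

/-! ### Counting configurations in tournaments on four vertices. -/

/-- The tournament on four vertices with prescribed directions of the edges `01`, `02`, `03`, `12`,
`13` and `23`. -/
def tournament (t : Fin 6 → Bool) : Fin 4 → Fin 4 → Bool :=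
  ![![false, t 0, t 1, t 2], ![!t 0, false, t 3, t 4], ![!t 1, !t 3, false, t 5],
    ![!t 2, !t 4, !t 5, false]]

/-- Whether two relations on four vertices are isomorphic. -/
def isomorphicBool (r s : Fin 4 → Fin 4 → Bool) : Bool :=
  decide (∃ e : Equiv.Perm (Fin 4), ∀ u v, r u v = s (e u) (e v))

theorem transitiveChain_adj (u v : Fin 4) :
    transitiveChain.Adj u v ↔ tournament ![true, true, true, true, true, true] u v = true := by
  change u < v ↔ _
  decide +revert

theorem intransitiveFourCycle_adj (u v : Fin 4) : intransitiveFourCycle.Adj u v ↔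
    tournament ![true, true, false, true, true, true] u v = true := by
  simp only [intransitiveFourCycle, Set.mem_insert_iff, Set.mem_singleton_iff, Prod.mk.injEq]
  decide +revert

theorem winnerThreeCycle_adj (u v : Fin 4) : winnerThreeCycle.Adj u v ↔
    tournament ![true, true, true, true, false, true] u v = true := by
  simp only [winnerThreeCycle, Set.mem_insert_iff, Set.mem_singleton_iff, Prod.mk.injEq]
  decide +revert

theorem loserThreeCycle_adj (u v : Fin 4) : loserThreeCycle.Adj u v ↔
    tournament ![false, false, false, true, false, true] u v = true := by
  simp only [loserThreeCycle, Set.mem_insert_iff, Set.mem_singleton_iff, Prod.mk.injEq]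
  decide +revert

theorem isomorphic_iff_isomorphicBool {G H : Digraph (Fin 4)} {r s : Fin 4 → Fin 4 → Bool}
    (hG : ∀ u v, G.Adj u v ↔ r u v = true) (hH : ∀ u v, H.Adj u v ↔ s u v = true) :
    G.Isomorphic H ↔ isomorphicBool r s = true := by
  simp only [Digraph.Isomorphic, isomorphicBool, hG, hH, decide_eq_true_eq, ← Bool.eq_iff_iff]

/-- Two vertices that both beat the other two occur only in the chain, as its top two vertices, and
are seen by `2! * 2! = 4` permutations. A vertex that beats (or loses to) all others is seen by `3!
= 6` permutations. The identities are checked on all 64 tournaments. -/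
theorem tournament_counts : ∀ t₀ t₁ t₂ t₃ t₄ t₅ : Bool,
    let r := tournament ![t₀, t₁, t₂, t₃, t₄, t₅]
    let chain := (isomorphicBool r (tournament ![true, true, true, true, true, true])).toNat
    let cycle := (isomorphicBool r (tournament ![true, true, false, true, true, true])).toNat
    let winner := (isomorphicBool r (tournament ![true, true, true, true, false, true])).toNat
    let loser := (isomorphicBool r (tournament ![false, false, false, true, false, true])).toNat
    4 * chain = ∑ σ : Equiv.Perm (Fin 4),
      (r (σ 0) (σ 2) && r (σ 0) (σ 3) && r (σ 1) (σ 2) && r (σ 1) (σ 3)).toNat ∧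
    6 * (chain + winner) = ∑ σ : Equiv.Perm (Fin 4),
      (r (σ 0) (σ 1) && r (σ 0) (σ 2) && r (σ 0) (σ 3)).toNat ∧
    6 * (chain + loser) = ∑ σ : Equiv.Perm (Fin 4),
      (r (σ 1) (σ 0) && r (σ 2) (σ 0) && r (σ 3) (σ 0)).toNat ∧
    chain + cycle + winner + loser = 1 := by
  decide +kernel

theorem exists_tournament_eq {G : Digraph (Fin 4)} (h0 : ∀ i, ¬ G.Adj i i)
    (h : ∀ i j, i ≠ j → (¬ G.Adj i j ↔ G.Adj j i)) :
    ∃ t₀ t₁ t₂ t₃ t₄ t₅ : Bool, ∀ u v,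
      G.Adj u v ↔ tournament ![t₀, t₁, t₂, t₃, t₄, t₅] u v = true := by
  classical
  refine ⟨decide (G.Adj 0 1), decide (G.Adj 0 2), decide (G.Adj 0 3), decide (G.Adj 1 2),
    decide (G.Adj 1 3), decide (G.Adj 2 3), fun u v => ?_⟩
  fin_cases u <;> fin_cases v <;> simp [tournament, h0, h]

/-- The indicator of a proposition. -/
noncomputable def truthValue (p : Prop) : ℝ := open Classical in if p then 1 else 0

theorem truthValue_eq_toNat {p : Prop} {b : Bool} (h : p ↔ b = true) : truthValue p = b.toNat := by
  cases b <;> simp_all [truthValue]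

theorem truthValue_identities {G : Digraph (Fin 4)} (h0 : ∀ i, ¬ G.Adj i i)
    (h : ∀ i j, i ≠ j → (¬ G.Adj i j ↔ G.Adj j i)) :
    4 * truthValue (G.Isomorphic transitiveChain) = ∑ σ : Equiv.Perm (Fin 4),
      truthValue (G.Adj (σ 0) (σ 2) ∧ G.Adj (σ 0) (σ 3) ∧ G.Adj (σ 1) (σ 2) ∧ G.Adj (σ 1) (σ 3)) ∧
    6 * (truthValue (G.Isomorphic transitiveChain) + truthValue (G.Isomorphic winnerThreeCycle)) =
      ∑ σ : Equiv.Perm (Fin 4),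
        truthValue (G.Adj (σ 0) (σ 1) ∧ G.Adj (σ 0) (σ 2) ∧ G.Adj (σ 0) (σ 3)) ∧
    6 * (truthValue (G.Isomorphic transitiveChain) + truthValue (G.Isomorphic loserThreeCycle)) =
      ∑ σ : Equiv.Perm (Fin 4),
        truthValue (G.Adj (σ 1) (σ 0) ∧ G.Adj (σ 2) (σ 0) ∧ G.Adj (σ 3) (σ 0)) ∧
    truthValue (G.Isomorphic transitiveChain) + truthValue (G.Isomorphic intransitiveFourCycle) +
      truthValue (G.Isomorphic winnerThreeCycle) + truthValue (G.Isomorphic loserThreeCycle) = 1 := by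
  obtain ⟨t₀, t₁, t₂, t₃, t₄, t₅, ht⟩ := exists_tournament_eq h0 h
  rw [truthValue_eq_toNat (isomorphic_iff_isomorphicBool ht transitiveChain_adj),
    truthValue_eq_toNat (isomorphic_iff_isomorphicBool ht intransitiveFourCycle_adj),
    truthValue_eq_toNat (isomorphic_iff_isomorphicBool ht winnerThreeCycle_adj),
    truthValue_eq_toNat (isomorphic_iff_isomorphicBool ht loserThreeCycle_adj)]
  obtain ⟨h1, h2, h3, h4⟩ := tournament_counts t₀ t₁ t₂ t₃ t₄ t₅
  refine ⟨?_, ?_, ?_, ?_⟩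
  · refine Eq.trans (by exact_mod_cast h1) ((Nat.cast_sum _ _).trans
      (Finset.sum_congr rfl fun σ _ => (truthValue_eq_toNat ?_).symm))
    simp only [ht, Bool.and_eq_true, and_assoc]
  · refine Eq.trans (by exact_mod_cast h2) ((Nat.cast_sum _ _).trans
      (Finset.sum_congr rfl fun σ _ => (truthValue_eq_toNat ?_).symm))
    simp only [ht, Bool.and_eq_true, and_assoc]
  · refine Eq.trans (by exact_mod_cast h3) ((Nat.cast_sum _ _).trans
      (Finset.sum_congr rfl fun σ _ => (truthValue_eq_toNat ?_).symm))
    simp only [ht, Bool.and_eq_true, and_assoc]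
  · exact_mod_cast h4

/-! ### Probabilities of these configurations for four independent dice. -/

/-- The law of four independent uniform points of the kite. -/
noncomputable def fourKiteMeasure : Measure (Fin 4 → ℝ × ℝ) := Measure.pi fun _ => kiteMeasure

instance : IsProbabilityMeasure fourKiteMeasure := by
  unfold fourKiteMeasure
  infer_instance

theorem hasLaw_apply (i : Fin 4) :
    HasLaw (fun z : Fin 4 → ℝ × ℝ => z i) kiteMeasure fourKiteMeasure :=
  (measurePreserving_eval (fun _ => kiteMeasure) i).hasLaw

theorem iIndepFun_apply : iIndepFun (fun (i : Fin 4) (z : Fin 4 → ℝ × ℝ) => z i) fourKiteMeasure :=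
  iIndepFun_pi (X := fun _ => id) fun _ => aemeasurable_id

theorem hasLaw_pair {i j : Fin 4} (h : i ≠ j) : HasLaw (fun z : Fin 4 → ℝ × ℝ => (z i, z j))
    (kiteMeasure.prod kiteMeasure) fourKiteMeasure :=
  (iIndepFun_apply.indepFun h).hasLaw_prod (hasLaw_apply i) (hasLaw_apply j)

theorem hasLaw_quadruple (σ : Equiv.Perm (Fin 4)) :
    HasLaw (fun z : Fin 4 → ℝ × ℝ => ((z (σ 0), z (σ 1)), (z (σ 2), z (σ 3))))
      ((kiteMeasure.prod kiteMeasure).prod (kiteMeasure.prod kiteMeasure)) fourKiteMeasure := by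
  have hne {i j : Fin 4} (h : i ≠ j) : σ i ≠ σ j := σ.injective.ne h
  exact (iIndepFun_apply.indepFun_prodMk_prodMk (fun i => measurable_pi_apply i) (σ 0) (σ 1) (σ 2)
    (σ 3) (hne (by decide)) (hne (by decide)) (hne (by decide)) (hne (by decide))).hasLaw_prod
    (hasLaw_pair (hne (by decide))) (hasLaw_pair (hne (by decide)))

theorem measureReal_prod_eq_integral {α β : Type*} [MeasurableSpace α] [MeasurableSpace β]
    (μ : Measure α) (ν : Measure β) [IsFiniteMeasure μ] [IsFiniteMeasure ν] {E : Set (α × β)}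
    (hE : MeasurableSet E) : (μ.prod ν).real E = ∫ x, ν.real (Prod.mk x ⁻¹' E) ∂μ := by
  rw [← integral_indicator_one hE, integral_prod (E.indicator 1)
    ((integrable_const (1 : ℝ)).indicator hE)]
  refine integral_congr_ae (Filter.Eventually.of_forall fun x => ?_)
  simp only
  rw [← integral_indicator_one (measurable_prodMk_left hE)]
  rfl

theorem measurableSet_beats_comp {α : Type*} [MeasurableSpace α] {f g : α → ℝ × ℝ}
    (hf : Measurable f) (hg : Measurable g) : MeasurableSet {x | Beats (f x) (g x)} :=
  (hf.prodMk hg) measurableSet_beats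

theorem measurable_dominance : Measurable dominance :=
  (measurable_measure_prodMk_left measurableSet_beats).ennreal_toReal

theorem dominance_bounds (a : ℝ × ℝ) : 0 ≤ dominance a ∧ dominance a ≤ 1 :=
  ⟨measureReal_nonneg, measureReal_le_one⟩

theorem integrable_dominance_pow (n : ℕ) : Integrable (fun a => dominance a ^ n) kiteMeasure := by
  refine Integrable.of_bound (measurable_dominance.pow_const n).aestronglyMeasurable 1
    (Filter.Eventually.of_forall fun a => ?_)
  rw [Real.norm_eq_abs, abs_of_nonneg (pow_nonneg (dominance_bounds a).1 n)]
  exact pow_le_one₀ (dominance_bounds a).1 (dominance_bounds a).2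

/-- Given the two dominating dice, the other two are independent, so the conditional probability is
the square of `commonDominance`. -/
theorem fourKiteMeasure_pair_beats (σ : Equiv.Perm (Fin 4)) :
    fourKiteMeasure.real {z | Beats (z (σ 0)) (z (σ 2)) ∧ Beats (z (σ 0)) (z (σ 3)) ∧
      Beats (z (σ 1)) (z (σ 2)) ∧ Beats (z (σ 1)) (z (σ 3))} = 110413771 / 258048000 / 6 := by
  have hE : MeasurableSet {q : ((ℝ × ℝ) × ℝ × ℝ) × (ℝ × ℝ) × ℝ × ℝ |
      Beats q.1.1 q.2.1 ∧ Beats q.1.1 q.2.2 ∧ Beats q.1.2 q.2.1 ∧ Beats q.1.2 q.2.2} :=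
    (measurableSet_beats_comp (by fun_prop) (by fun_prop)).inter
      ((measurableSet_beats_comp (by fun_prop) (by fun_prop)).inter
        ((measurableSet_beats_comp (by fun_prop) (by fun_prop)).inter
          (measurableSet_beats_comp (by fun_prop) (by fun_prop))))
  rw [(hasLaw_quadruple σ).measureReal_eq hE, measureReal_prod_eq_integral _ _ hE,
    ← integral_commonDominance_sq]
  refine integral_congr_ae (Filter.Eventually.of_forall fun p => ?_)
  simp only
  rw [pow_two, commonDominance, ← measureReal_prod_prod]
  congr 1
  ext q
  simp only [Set.mem_preimage, Set.mem_ofPred_eq, Set.mem_prod]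
  tauto

theorem fourKiteMeasure_beats_all (σ : Equiv.Perm (Fin 4)) :
    fourKiteMeasure.real {z | Beats (z (σ 0)) (z (σ 1)) ∧ Beats (z (σ 0)) (z (σ 2)) ∧
      Beats (z (σ 0)) (z (σ 3))} = ∫ a, dominance a ^ 3 ∂kiteMeasure := by
  have hE : MeasurableSet {q : ((ℝ × ℝ) × ℝ × ℝ) × (ℝ × ℝ) × ℝ × ℝ |
      Beats q.1.1 q.1.2 ∧ Beats q.1.1 q.2.1 ∧ Beats q.1.1 q.2.2} :=
    (measurableSet_beats_comp (by fun_prop) (by fun_prop)).inter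
      ((measurableSet_beats_comp (by fun_prop) (by fun_prop)).inter
        (measurableSet_beats_comp (by fun_prop) (by fun_prop)))
  -- Conditioning on the first two dice yields the square for the last two, times an indicator for
  -- the second; integrating the latter supplies the third factor.
  have hsec (p : (ℝ × ℝ) × ℝ × ℝ) : (kiteMeasure.prod kiteMeasure).real (Prod.mk p ⁻¹'
      {q : ((ℝ × ℝ) × ℝ × ℝ) × (ℝ × ℝ) × ℝ × ℝ |
        Beats q.1.1 q.1.2 ∧ Beats q.1.1 q.2.1 ∧ Beats q.1.1 q.2.2}) =
      dominance p.1 ^ 2 * {b | Beats p.1 b}.indicator 1 p.2 := by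
    by_cases h : Beats p.1 p.2
    · rw [Set.indicator_of_mem (show p.2 ∈ {b | Beats p.1 b} from h), pow_two, dominance,
        ← measureReal_prod_prod, Pi.one_apply, mul_one]
      congr 1
      ext q
      simp [h]
    · rw [Set.indicator_of_notMem (show p.2 ∉ {b | Beats p.1 b} from h), mul_zero]
      simp [h]
  have hint : Integrable (fun p => dominance p.1 ^ 2 * {b | Beats p.1 b}.indicator 1 p.2)
      (kiteMeasure.prod kiteMeasure) := by
    simp only [← hsec]
    refine Integrable.of_bound
      (measurable_measure_prodMk_left hE).ennreal_toReal.aestronglyMeasurable 1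
      (Filter.Eventually.of_forall fun p => ?_)
    rw [Real.norm_eq_abs, abs_of_nonneg measureReal_nonneg]
    exact measureReal_le_one
  rw [(hasLaw_quadruple σ).measureReal_eq hE, measureReal_prod_eq_integral _ _ hE]
  simp only [hsec]
  rw [integral_prod _ hint]
  refine integral_congr_ae (Filter.Eventually.of_forall fun a => ?_)
  simp only
  rw [integral_const_mul, integral_indicator_one (measurableSet_beats_left a)]
  rw [← dominance, ← pow_succ]

theorem hasLaw_swap : HasLaw (fun z : Fin 4 → ℝ × ℝ => fun i => (z i).swap) fourKiteMeasure
    fourKiteMeasure :=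
  (measurePreserving_pi _ _ fun _ => measurePreserving_swap_kiteMeasure).hasLaw

theorem fourKiteMeasure_loses_all (σ : Equiv.Perm (Fin 4)) :
    fourKiteMeasure.real {z | Beats (z (σ 1)) (z (σ 0)) ∧ Beats (z (σ 2)) (z (σ 0)) ∧
      Beats (z (σ 3)) (z (σ 0))} = ∫ a, dominance a ^ 3 ∂kiteMeasure := by
  rw [← fourKiteMeasure_beats_all σ, ← hasLaw_swap.measureReal_eq]
  · simp only [beats_swap]
  · exact (measurableSet_beats_comp (by fun_prop) (by fun_prop)).inter
      ((measurableSet_beats_comp (by fun_prop) (by fun_prop)).inter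
        (measurableSet_beats_comp (by fun_prop) (by fun_prop)))

theorem dominance_swap (a : ℝ × ℝ) : dominance a.swap = 1 - dominance a := by
  rw [dominance, dominance, ← probReal_compl_eq_one_sub (measurableSet_beats_left a),
    ← kiteMeasure_swap_preimage _ (measurableSet_beats_left a.swap)]
  refine measureReal_congr ?_
  filter_upwards [ae_fst_ne a.1, ae_snd_ne a.2, ae_diag_ne (a.2 - a.1)] with b h1 h2 h3
  refine propext ?_
  change Beats a.swap b.swap ↔ ¬ Beats a b
  rw [beats_swap, not_beats_iff h1.symm h2.symm h3.symm]

/-- The law of `dominance` is symmetric about `1 / 2`, so comparing the integrals of `d` and `d ^ 3`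
with those of `1 - d` and `(1 - d) ^ 3` determines the third moment from the second. -/
theorem integral_dominance_cube : ∫ a, dominance a ^ 3 ∂kiteMeasure = 333 / 2560 := by
  have hsw (n : ℕ) : ∫ a, (1 - dominance a) ^ n ∂kiteMeasure = ∫ a, dominance a ^ n ∂kiteMeasure := by
    rw [← measurePreserving_swap_kiteMeasure.integral_comp
      MeasurableEquiv.prodComm.measurableEmbedding]
    simp only [dominance_swap, sub_sub_cancel]
  have h1 := hsw 1
  have h3 := hsw 3
  have i1 : Integrable dominance kiteMeasure := by simpa using integrable_dominance_pow 1
  have i2 := integrable_dominance_pow 2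
  have i3 := integrable_dominance_pow 3
  simp only [pow_one] at h1
  rw [integral_sub (integrable_const _) i1] at h1
  have e (a : ℝ × ℝ) : (1 - dominance a) ^ 3 =
      1 - 3 * dominance a + 3 * dominance a ^ 2 - dominance a ^ 3 := by ring
  simp only [e] at h3
  have j1 : Integrable (fun a => 1 - 3 * dominance a) kiteMeasure :=
    (integrable_const _).sub (i1.const_mul 3)
  have j2 : Integrable (fun a => 1 - 3 * dominance a + 3 * dominance a ^ 2) kiteMeasure :=
    j1.add (i2.const_mul 3)
  rw [integral_sub j2 i3, integral_add j1 (i2.const_mul 3),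
    integral_sub (integrable_const _) (i1.const_mul 3), integral_const_mul, integral_const_mul,
    integral_dominance_sq] at h3
  simp only [integral_const, probReal_univ, smul_eq_mul, mul_one] at h1 h3
  linarith

/-! ### From the configurations to the four isomorphism classes. -/

/-- The directed graph of dominance between four dice given by their extremes. -/
def beatsGraph (z : Fin 4 → ℝ × ℝ) : Digraph (Fin 4) where
  Adj i j := Beats (z i) (z j)

/-- Two points of the kite without a common value of `P`, of `Q` or of `Q - P`. -/
def NoTie (a b : ℝ × ℝ) : Prop := a.1 ≠ b.1 ∧ a.2 ≠ b.2 ∧ a.2 - a.1 ≠ b.2 - b.1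

theorem not_beats_self (a : ℝ × ℝ) : ¬ Beats a a := by
  simp [Beats]

theorem not_dominates_self {n : ℕ} (a : Die n) : ¬ Dominates a a := by
  have h : ∑ i, ∑ j, (SignType.sign (a i - a j) : ℤ) =
      -∑ i, ∑ j, (SignType.sign (a i - a j) : ℤ) := by
    conv_lhs => rw [Finset.sum_comm]
    simp only [← Finset.sum_neg_distrib]
    refine Finset.sum_congr rfl fun i _ => Finset.sum_congr rfl fun j _ => ?_
    rw [← neg_sub, Left.sign_neg, SignType.coe_neg]
  exact fun hd => hd.ne' (self_eq_neg.1 h)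

theorem measurableSet_isomorphic (H : Digraph (Fin 4)) :
    MeasurableSet {z | (beatsGraph z).Isomorphic H} := by
  have : {z | (beatsGraph z).Isomorphic H} =
      ⋃ e : Equiv.Perm (Fin 4), ⋂ u, ⋂ v, {z | Beats (z u) (z v) ↔ H.Adj (e u) (e v)} := by
    ext z
    simp only [Set.mem_iUnion, Set.mem_iInter]
    rfl
  rw [this]
  refine MeasurableSet.iUnion fun e => MeasurableSet.iInter fun u => MeasurableSet.iInter fun v => ?_
  have h : MeasurableSet {z : Fin 4 → ℝ × ℝ | Beats (z u) (z v)} :=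
    measurableSet_beats_comp (by fun_prop) (by fun_prop)
  by_cases hH : H.Adj (e u) (e v)
  · simpa only [hH, iff_true] using h
  · simp only [hH, iff_false]
    exact h.compl

theorem ae_noTie : ∀ᵐ z ∂fourKiteMeasure, ∀ i j, i ≠ j → NoTie (z i) (z j) := by
  rw [ae_all_iff]
  intro i
  rw [ae_all_iff]
  intro j
  rw [ae_all_iff]
  intro h
  have h2 : ∀ᵐ p ∂(kiteMeasure.prod kiteMeasure), NoTie p.1 p.2 := by
    filter_upwards [ae_prod_fst_ne, ae_prod_snd_ne, ae_prod_diag_ne] with p h1 h2 h3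
    exact ⟨h1.symm, h2.symm, h3.symm⟩
  rw [← (hasLaw_pair h).map_eq] at h2
  exact ae_of_ae_map (hasLaw_pair h).aemeasurable h2

theorem integral_truthValue {α : Type*} [MeasurableSpace α] (μ : Measure α) {p : α → Prop}
    (hp : MeasurableSet {x | p x}) : ∫ x, truthValue (p x) ∂μ = μ.real {x | p x} := by
  rw [← integral_indicator_one hp]
  rfl

theorem integrable_truthValue {α : Type*} [MeasurableSpace α] (μ : Measure α) [IsFiniteMeasure μ]
    {p : α → Prop} (hp : MeasurableSet {x | p x}) : Integrable (fun x => truthValue (p x)) μ :=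
  (integrable_const (1 : ℝ)).indicator hp

theorem fourKiteMeasure_isomorphic :
    fourKiteMeasure.real {z | (beatsGraph z).Isomorphic transitiveChain} =
      110413771 / 258048000 ∧
    fourKiteMeasure.real {z | (beatsGraph z).Isomorphic intransitiveFourCycle} =
      99930571 / 258048000 ∧
    fourKiteMeasure.real {z | (beatsGraph z).Isomorphic winnerThreeCycle} =
      23851829 / 258048000 ∧
    fourKiteMeasure.real {z | (beatsGraph z).Isomorphic loserThreeCycle} =
      23851829 / 258048000 := by
  -- Almost surely there are no ties, so the graph is a tournament and the counting identities hold
  -- pointwise; integrating them gives four linear equations for the four probabilities.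
  have hid : ∀ᵐ z ∂fourKiteMeasure, _ := ae_noTie.mono fun z hz =>
    truthValue_identities (G := beatsGraph z) (fun i => not_beats_self (z i)) fun i j hij =>
      not_beats_iff (hz i j hij).1 (hz i j hij).2.1 (hz i j hij).2.2
  have hm (i j : Fin 4) : MeasurableSet {z : Fin 4 → ℝ × ℝ | Beats (z i) (z j)} :=
    measurableSet_beats_comp (by fun_prop) (by fun_prop)
  have hi (H : Digraph (Fin 4)) := integrable_truthValue fourKiteMeasure (measurableSet_isomorphic H)
  -- The configuration has the same probability for each of the 24 permutations.
  have hsum (p : Equiv.Perm (Fin 4) → (Fin 4 → ℝ × ℝ) → Prop) (x : ℝ)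
      (hp : ∀ σ, MeasurableSet {z | p σ z}) (hx : ∀ σ, fourKiteMeasure.real {z | p σ z} = x) :
      ∫ z, ∑ σ, truthValue (p σ z) ∂fourKiteMeasure = 24 * x := by
    rw [integral_finsetSum _ fun σ _ => integrable_truthValue _ (hp σ)]
    simp only [integral_truthValue _ (hp _), hx, Finset.sum_const, Finset.card_univ,
      Fintype.card_perm, Fintype.card_fin, nsmul_eq_mul]
    norm_num [Nat.factorial]
  have e1 := (integral_congr_ae (hid.mono fun z hz => hz.1)).trans <| hsum _ _
    (fun σ => (hm (σ 0) (σ 2)).inter ((hm (σ 0) (σ 3)).inter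
      ((hm (σ 1) (σ 2)).inter (hm (σ 1) (σ 3))))) fourKiteMeasure_pair_beats
  have e2 := (integral_congr_ae (hid.mono fun z hz => hz.2.1)).trans <| hsum _ _
    (fun σ => (hm (σ 0) (σ 1)).inter ((hm (σ 0) (σ 2)).inter (hm (σ 0) (σ 3))))
    fourKiteMeasure_beats_all
  have e3 := (integral_congr_ae (hid.mono fun z hz => hz.2.2.1)).trans <| hsum _ _
    (fun σ => (hm (σ 1) (σ 0)).inter ((hm (σ 2) (σ 0)).inter (hm (σ 3) (σ 0))))
    fourKiteMeasure_loses_all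
  have e4 := integral_congr_ae (hid.mono fun z hz => hz.2.2.2)
  have j2 : Integrable (fun z => truthValue ((beatsGraph z).Isomorphic transitiveChain) +
      truthValue ((beatsGraph z).Isomorphic intransitiveFourCycle)) fourKiteMeasure := (hi _).add (hi _)
  have j3 : Integrable (fun z => truthValue ((beatsGraph z).Isomorphic transitiveChain) +
      truthValue ((beatsGraph z).Isomorphic intransitiveFourCycle) +
      truthValue ((beatsGraph z).Isomorphic winnerThreeCycle)) fourKiteMeasure := j2.add (hi _)
  rw [integral_const_mul] at e1
  rw [integral_const_mul, integral_add (hi _) (hi _), integral_dominance_cube] at e2 e3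
  rw [integral_add j3 (hi _), integral_add j2 (hi _), integral_add (hi _) (hi _)] at e4
  simp only [integral_truthValue _ (measurableSet_isomorphic _), integral_const, probReal_univ,
    smul_eq_mul, mul_one] at e1 e2 e3 e4
  refine ⟨?_, ?_, ?_, ?_⟩ <;> linarith

theorem theorem11 {Ω : Type*} [MeasurableSpace Ω] (P : Measure Ω) [IsProbabilityMeasure P]
    (A : Fin 4 → Ω → Die 3)
    (hlaw : ∀ i, HasLaw (A i) (balancedUniform 3) P)
    (hindep : iIndepFun A P) :
    P.real {ω | (dominanceGraph fun i => A i ω).Isomorphic transitiveChain}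
        = 110413771 / 258048000 ∧
    P.real {ω | (dominanceGraph fun i => A i ω).Isomorphic intransitiveFourCycle}
        = 99930571 / 258048000 ∧
    P.real {ω | (dominanceGraph fun i => A i ω).Isomorphic winnerThreeCycle}
        = 23851829 / 258048000 ∧
    P.real {ω | (dominanceGraph fun i => A i ω).Isomorphic loserThreeCycle}
        = 23851829 / 258048000 := by
  have hext : HasLaw extremes kiteMeasure (balancedUniform 3) :=
    ⟨measurable_extremes.aemeasurable, map_extremes_balancedUniform⟩
  have hZ : HasLaw (fun ω i => extremes (A i ω)) fourKiteMeasure P :=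
    (hindep.comp (fun _ => extremes) fun _ => measurable_extremes).hasLaw_pi
      fun i => hext.comp (hlaw i)
  have hbal (i : Fin 4) : ∀ᵐ ω ∂P, A i ω ∈ balancedDice 3 := by
    refine ae_of_ae_map (hlaw i).aemeasurable ?_
    rw [(hlaw i).map_eq]
    exact ae_cond_mem measurableSet_balancedDice
  have htie : ∀ᵐ ω ∂P, ∀ i j, i ≠ j → NoTie (extremes (A i ω)) (extremes (A j ω)) := by
    have h := ae_noTie
    rw [← hZ.map_eq] at h
    exact ae_of_ae_map hZ.aemeasurable h
  -- Almost surely every die is balanced and no two dice tie, so the dominance graph depends on the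
  -- extremes only; neither graph has loops.
  have hgraph : ∀ᵐ ω ∂P, (dominanceGraph fun i => A i ω) =
      beatsGraph fun i => extremes (A i ω) := by
    filter_upwards [ae_all_iff.2 hbal, htie] with ω h1 h2
    ext i j
    change Dominates _ _ ↔ Beats _ _
    by_cases hij : i = j
    · subst hij
      exact iff_of_false (not_dominates_self _) (not_beats_self _)
    · obtain ⟨t1, t2, t3⟩ := h2 i j hij
      exact dominates_iff_beats (h1 i) (h1 j) t1 t2 t3
  have key (H : Digraph (Fin 4)) : P.real {ω | (dominanceGraph fun i => A i ω).Isomorphic H} =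
      fourKiteMeasure.real {z | (beatsGraph z).Isomorphic H} := by
    rw [← hZ.measureReal_eq (measurableSet_isomorphic H)]
    refine measureReal_congr ?_
    filter_upwards [hgraph] with ω h
    change (dominanceGraph fun i => A i ω).Isomorphic H = _
    rw [h]
    rfl
  simpa only [key] using fourKiteMeasure_isomorphic
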